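/- Let $E$ and $N$ be finite-dimensional complex vector spaces, and let $N=N_1\supset N_2\supset\dots\supset N_{r+1}=0$ be a flag with $\dim N_k/N_{k+1}=d_k$ (some $d_k$ may be zero; put $N_k=0$ for $k>r+1$). Let $\mathrm{GL}(\underline d)$ be the group of linear automorphisms of $N$ preserving the flag, and let $\widetilde M_r\subset \mathrm{Hom}(E^\vee\oplus \mathrm{Sym}^2N,N)$ be the set of maps $\psi=\psi_1\oplus\psi_2$ such that $\psi_2(N_i\otimes N_j)\subset N_{i+j}$ for all $i,j\ge 1$ and $\psi$ is surjective. It is a Zariski open subset of a vector space, and $\mathrm{GL}(\underline d)$ acts on it by $g\cdot\psi=(g\psi_1,\ g\,\psi_2(g^{-1}\cdot,g^{-1}\cdot))$. Let $M_r=\widetilde M_r/\mathrm{GL}(\underline d)$ be the orbit space (the nonassociative Hilbert scheme), with the quotient Zariski topology and with the invariant regular functions on $\widetilde M_r$ as regular functions. Then: 1. The action of $\mathrm{GL}(\underline d)$ on $\widetilde M_r$ is free: all stabilizers are trivial. 2. $M_r$ is a smooth complex algebraic variety: it is a finite union of Zariski open subsets isomorphic to nonsingular affine varieties. It is compact and Hausdorff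 in the classical topology (the quotient of the classical topology of $\widetilde M_r$). 3. $M_r$ is a tower of Grassmann bundles. For $0\le k\le r$ let $M_k$ be the orbit space of the same kind for $N/N_{k+1}$ with the induced flag (of length $k$, with dimensions $d_1,\dots,d_k$). Let $D_k=(N/N_{k+1})^\vee$, and for $k\ge1$ let $S_k\subset \mathrm{Sym}^2D_{k-1}$ be the span of the products $D_i\cdot D_j$ with $i,j\ge1$, $i+j\le k$. The dual of a surjection $\psi$ representing a point of $M_{k-1}$ embeds $D_{k-1}$ into $E\oplus S_k$. Then $M_0$ is a point; for $1\le k\le r$ the spaces $(E\oplus S_k)/D_{k-1}$ form an algebraic vector bundle over $M_{k-1}$ (Zariski locally, $\widetilde M_{k-1}\to M_{k-1}$ has a regular section along which $D_{k-1}$ has a constant complement in $E\oplus S_k$); there is an isomorphism of varieties $$M_k\;\cong\; G_{d_k}\bigl((E\oplus S_k)/D_{k-1}\bigr)$$ onto the Grassmann bundle of $d_k$-dimensional subspaces over $M_{k-1}$, taking the class of $\psi$ to the class of $(\bar\psi,\psi^\vee(D_k)/D_{k-1})$, where $\bar\psi$ is the structure induced by $\psi$ on $N/N_k$; and $M_r$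 as defined from $N$ agrees with the last stage $M_r$ of the tower via $N\cong N/N_{r+1}$. -/

import Mathlib

open Module

noncomputable section

/-! ### Complex algebraic varieties as spaces with functions -/

/-- A space with functions: a topology on `X` and, for each open set `U`, the set of functions
that are regular on `U` (only the values on `U` matter). -/
structure SpaceWithFunctions (X : Type*) where
  zariski : TopologicalSpace X
  IsRegularOn : Set X → (X → ℂ) → Prop

namespace SpaceWithFunctions

variable {X Y : Type*}

/-- `U` is open for the Zariski topology of `A`. -/
def IsZariskiOpen (A : SpaceWithFunctions X) (U : Set X) : Prop :=
  @IsOpen X A.zariski U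

/-- A morphism is a continuous map that pulls regular functions back to regular functions. -/
def IsMorphism (A : SpaceWithFunctions X) (B : SpaceWithFunctions Y) (φ : X → Y) : Prop :=
  ∀ V : Set Y, B.IsZariskiOpen V →
    A.IsZariskiOpen (φ ⁻¹' V) ∧
      ∀ f : Y → ℂ, B.IsRegularOn V f → A.IsRegularOn (φ ⁻¹' V) (f ∘ φ)

/-- An isomorphism: a bijection that is a morphism in both directions. -/
def IsIso (A : SpaceWithFunctions X) (B : SpaceWithFunctions Y) (e : X ≃ Y) : Prop :=
  A.IsMorphism B e ∧ B.IsMorphism A e.symm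

/-- The structure induced on an open subset. -/
def restrict (A : SpaceWithFunctions X) (U : Set X) : SpaceWithFunctions U where
  zariski := A.zariski.induced Subtype.val
  IsRegularOn V f := A.IsRegularOn (Subtype.val '' V) (Function.extend Subtype.val f 0)

/-- The quotient structure along a surjection `π`: `U` is open iff its preimage is, and `f` is
regular on `U` iff `f ∘ π` is regular on the preimage of `U`. -/
def quotient (A : SpaceWithFunctions X) (π : X → Y) : SpaceWithFunctions Y where
  zariski := A.zariski.coinduced π
  IsRegularOn U f := A.IsRegularOn (π ⁻¹' U) (f ∘ π)

/-- A map to a vector space is regular on `U` if all its coordinates are. -/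
def IsRegularMapOn {V : Type*} [AddCommGroup V] [Module ℂ V]
    (A : SpaceWithFunctions X) (U : Set X) (σ : X → V) : Prop :=
  ∀ l : Dual ℂ V, A.IsRegularOn U (fun x => l (σ x))

end SpaceWithFunctions

section Affine

variable (V : Type*) [AddCommGroup V] [Module ℂ V]

/-- The polynomial functions on a vector space: the algebra generated by linear functionals. -/
def polyFunctions : Subalgebra ℂ (V → ℂ) :=
  Algebra.adjoin ℂ (Set.range fun (l : Dual ℂ V) (v : V) => l v)

/-- The Zariski topology of a (finite-dimensional) vector space, with the basis of open sets
`{p ≠ 0}` for polynomial functions `p`. -/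
@[reducible] def zariskiTopology : TopologicalSpace V :=
  TopologicalSpace.generateFrom {U | ∃ p ∈ polyFunctions V, U = {v | p v ≠ 0}}

/-- The classical topology of a finite-dimensional complex vector space: the coarsest one for
which all linear functionals are continuous. -/
@[reducible] def classicalTopology : TopologicalSpace V :=
  ⨅ l : Dual ℂ V, TopologicalSpace.induced l inferInstance

variable {V}

/-- A (locally closed) subset of a vector space as a quasi-affine variety: the regular functions
are those that are locally quotients of polynomial functions. -/
def quasiAffine (Z : Set V) : SpaceWithFunctions Z where
  zariski := (zariskiTopology V).induced Subtype.val
  IsRegularOn U f :=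
    ∀ x ∈ U, ∃ p ∈ polyFunctions V, ∃ q ∈ polyFunctions V, q x ≠ 0 ∧
      ∀ y ∈ U, q y ≠ 0 → f y = p y / q y

/-- The classical topology of a subset of a vector space. -/
@[reducible] def classicalTopologyOn (Z : Set V) : TopologicalSpace Z :=
  (classicalTopology V).induced Subtype.val

end Affine

/-- A nonsingular closed subvariety of affine space (Jacobian criterion): near each of its points
it is cut out by polynomials that vanish on it and whose differentials there are independent. -/
def IsNonsingularAffine {m : ℕ} (Z : Set (Fin m → ℂ)) : Prop :=
  (∃ S : Set (MvPolynomial (Fin m) ℂ), Z = {w | ∀ p ∈ S, MvPolynomial.eval w p = 0}) ∧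
  ∀ z ∈ Z, ∃ (c : ℕ) (f : Fin c → MvPolynomial (Fin m) ℂ) (g : MvPolynomial (Fin m) ℂ),
    (∀ i, ∀ w ∈ Z, MvPolynomial.eval w (f i) = 0) ∧
    LinearIndependent ℂ (fun (i : Fin c) (j : Fin m) =>
      MvPolynomial.eval z (MvPolynomial.pderiv j (f i))) ∧
    MvPolynomial.eval z g ≠ 0 ∧
    ∀ w, MvPolynomial.eval w g ≠ 0 → (∀ i, MvPolynomial.eval w (f i) = 0) → w ∈ Z

/-- A smooth (pre)variety: a finite union of open subsets that are isomorphic to nonsingular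
affine varieties. Separatedness is the Hausdorff property of the classical topology. -/
def SpaceWithFunctions.IsSmoothVariety {X : Type*} (A : SpaceWithFunctions X) : Prop :=
  ∃ (n : ℕ) (U : Fin n → Set X), (⋃ i, U i) = Set.univ ∧
    ∀ i, A.IsZariskiOpen (U i) ∧
      ∃ (m : ℕ) (Z : Set (Fin m → ℂ)) (e : U i ≃ Z),
        IsNonsingularAffine Z ∧ (A.restrict (U i)).IsIso (quasiAffine Z) e

/-! ### Flags, filtered structure maps, and the orbit space -/

section Hilbert

variable (E : Type*) {N N' : Type*} [AddCommGroup E] [Module ℂ E]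
  [AddCommGroup N] [Module ℂ N] [AddCommGroup N'] [Module ℂ N']

/-- `F` is a flag `N = F 1 ⊇ F 2 ⊇ ⋯ ⊇ F (r + 1) = 0` with `dim (F k / F (k + 1)) = d k`. -/
structure IsFlag (r : ℕ) (d : ℕ → ℕ) (F : ℕ → Submodule ℂ N) : Prop where
  antitone : Antitone F
  one : F 1 = ⊤
  last : F (r + 1) = ⊥
  finrank_step : ∀ k, 1 ≤ k → k ≤ r →
    finrank ℂ (F k ⧸ (F (k + 1)).submoduleOf (F k)) = d k

/-- The flag induced by `F` on the quotient `N ⧸ F m`. -/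
def quotFlag (F : ℕ → Submodule ℂ N) (m : ℕ) : ℕ → Submodule ℂ (N ⧸ F m) :=
  fun i => (F i).map (F m).mkQ

/-- The group of linear automorphisms of `N` that preserve the flag `F`. -/
def flagGL (F : ℕ → Submodule ℂ N) : Subgroup (N ≃ₗ[ℂ] N) where
  carrier := {g | ∀ k, (F k).map (g : N →ₗ[ℂ] N) = F k}
  one_mem' k := Submodule.map_id (F k)
  mul_mem' {g h} hg hh k := by
    have : ((g * h : N ≃ₗ[ℂ] N) : N →ₗ[ℂ] N) = (g : N →ₗ[ℂ] N) ∘ₗ (h : N →ₗ[ℂ] N) := rfl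
    rw [this, Submodule.map_comp, hh k, hg k]
  inv_mem' {g} hg k := by
    have : ((g⁻¹ : N ≃ₗ[ℂ] N) : N →ₗ[ℂ] N) ∘ₗ (g : N →ₗ[ℂ] N) = LinearMap.id := by
      ext x; exact g.symm_apply_apply x
    conv_lhs => rw [← hg k]
    rw [← Submodule.map_comp, this, Submodule.map_id]

variable (N) in
/-- The vector space of pairs of a linear map `E^∨ → N` and a bilinear map `N × N → N`. -/
abbrev StructureMaps : Type _ := (Dual ℂ E →ₗ[ℂ] N) × (N →ₗ[ℂ] N →ₗ[ℂ] N)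

/-- The set of linear maps `ψ₁ ⊕ ψ₂ : E^∨ ⊕ Sym² N → N` that are surjective and filtered,
`ψ₂ (F i ⊗ F j) ⊆ F (i + j)`. A linear map on `Sym² N` is a symmetric bilinear map. -/
def filteredMaps (F : ℕ → Submodule ℂ N) : Set (StructureMaps E N) :=
  {ψ | (∀ x y, ψ.2 x y = ψ.2 y x) ∧
    (∀ i j, 1 ≤ i → 1 ≤ j → ∀ x ∈ F i, ∀ y ∈ F j, ψ.2 x y ∈ F (i + j)) ∧
    Function.Surjective (ψ.1.coprod (TensorProduct.lift ψ.2))}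

/-- The action of linear automorphisms of `N` on structure maps by transport:
`g ψ₁` and `(x, y) ↦ g (ψ₂ (g⁻¹ x, g⁻¹ y))`. -/
def transport (g : N ≃ₗ[ℂ] N) (ψ : StructureMaps E N) : StructureMaps E N :=
  ((g : N →ₗ[ℂ] N) ∘ₗ ψ.1,
    (ψ.2.compl₁₂ (g.symm : N →ₗ[ℂ] N) (g.symm : N →ₗ[ℂ] N)).compr₂ (g : N →ₗ[ℂ] N))

variable {E}

theorem flagGL_apply_mem {F : ℕ → Submodule ℂ N} {g : N ≃ₗ[ℂ] N} (hg : g ∈ flagGL F)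
    {k : ℕ} {x : N} (hx : x ∈ F k) : g x ∈ F k := by
  rw [← hg k]
  exact Submodule.mem_map_of_mem hx

theorem transport_mem {F : ℕ → Submodule ℂ N} {g : N ≃ₗ[ℂ] N} (hg : g ∈ flagGL F)
    {ψ : StructureMaps E N} (hψ : ψ ∈ filteredMaps E F) :
    transport E g ψ ∈ filteredMaps E F := by
  obtain ⟨hs, hf, hsurj⟩ := hψ
  refine ⟨fun x y => ?_, fun i j hi hj x hx y hy => ?_, fun z => ?_⟩
  · simp [transport, hs (g.symm x)]
  · exact flagGL_apply_mem hg (hf i j hi hj _ (flagGL_apply_mem ((flagGL F).inv_mem hg) hx) _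
      (flagGL_apply_mem ((flagGL F).inv_mem hg) hy))
  · obtain ⟨⟨a, t⟩, h⟩ := hsurj (g.symm z)
    refine ⟨(a, TensorProduct.map (g : N →ₗ[ℂ] N) (g : N →ₗ[ℂ] N) t), ?_⟩
    have key : (TensorProduct.lift (transport E g ψ).2) ∘ₗ
        TensorProduct.map (g : N →ₗ[ℂ] N) (g : N →ₗ[ℂ] N) =
        (g : N →ₗ[ℂ] N) ∘ₗ TensorProduct.lift ψ.2 := by
      ext x y
      simp [transport]
    have key' := LinearMap.congr_fun key t
    simp only [LinearMap.comp_apply] at key'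
    rw [LinearMap.coprod_apply] at h ⊢
    rw [key']
    have : g (ψ.1 a + TensorProduct.lift ψ.2 t) = z := by rw [h]; simp
    simpa [transport] using this

variable (E) in
instance filteredMapsAction (F : ℕ → Submodule ℂ N) :
    MulAction (flagGL F) (filteredMaps E F) where
  smul g ψ := ⟨transport E g.1 ψ.1, transport_mem g.2 ψ.2⟩
  one_smul _ := rfl
  mul_smul _ _ _ := rfl

variable (E) in
/-- The nonassociative Hilbert scheme: the orbit space of the action. -/
abbrev NonassocHilb (F : ℕ → Submodule ℂ N) : Type _ :=
  MulAction.orbitRel.Quotient (flagGL F) (filteredMaps E F)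

/-- The orbit of a filtered surjective structure map. -/
def NonassocHilb.mk {F : ℕ → Submodule ℂ N} (ψ : filteredMaps E F) : NonassocHilb E F :=
  Quotient.mk _ ψ

variable (E) in
/-- The orbit space as a space with functions: regular functions are the invariant ones. -/
def NonassocHilb.variety (F : ℕ → Submodule ℂ N) : SpaceWithFunctions (NonassocHilb E F) :=
  (quasiAffine (filteredMaps E F)).quotient NonassocHilb.mk

variable (E) in
/-- The classical (quotient) topology of the orbit space. -/
@[reducible] def NonassocHilb.classical (F : ℕ → Submodule ℂ N) : TopologicalSpace (NonassocHilb E F) :=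
  (classicalTopologyOn (filteredMaps E F)).coinduced NonassocHilb.mk

/-- `ψ'` is the structure map that `ψ` induces on the quotient `q : N → N'`. -/
def Induces (q : N →ₗ[ℂ] N') (ψ : StructureMaps E N) (ψ' : StructureMaps E N') : Prop :=
  ψ'.1 = q ∘ₗ ψ.1 ∧ ∀ x y, ψ'.2 (q x) (q y) = q (ψ.2 x y)

/-! ### The dual picture and the Grassmann bundles

Write `D = N^∨`. The space `Sym² D` is the space of symmetric bilinear forms on `N`, inside all
bilinear forms, with `a · b` the form `a ⊗ b + b ⊗ a`. -/

/-- The product `a · b` of two elements of `N^∨` in `Sym² (N^∨)`. -/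
def symProd (a b : Dual ℂ N) : LinearMap.BilinForm ℂ N :=
  (LinearMap.mul ℂ ℂ).compl₁₂ a b + (LinearMap.mul ℂ ℂ).compl₁₂ b a

variable (E) in
/-- The subspace `E ⊕ S_k` of `E ⊕ Sym² D`, with `S_k` spanned by the `D_i · D_j`, `i + j ≤ k`,
where `D_i = (N / F (i + 1))^∨` is the annihilator of `F (i + 1)`. -/
def extSpace (F : ℕ → Submodule ℂ N) (k : ℕ) :
    Submodule ℂ (E × LinearMap.BilinForm ℂ N) :=
  Submodule.prod ⊤ (Submodule.span ℂ {β | ∃ i j, 1 ≤ i ∧ 1 ≤ j ∧ i + j ≤ k ∧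
    ∃ a ∈ (F (i + 1)).dualAnnihilator, ∃ b ∈ (F (j + 1)).dualAnnihilator, β = symProd a b})

/-- Pull-back of bilinear forms along a linear map. -/
def pullForm (q : N →ₗ[ℂ] N') : LinearMap.BilinForm ℂ N' →ₗ[ℂ] LinearMap.BilinForm ℂ N where
  toFun β := β.compl₁₂ q q
  map_add' _ _ := rfl
  map_smul' _ _ := rfl

variable (E) in
/-- The map `id ⊕ q^*` from `E ⊕ Sym² (N'^∨)` to `E ⊕ Sym² (N^∨)`. -/
def pullExt (q : N →ₗ[ℂ] N') :
    (E × LinearMap.BilinForm ℂ N') →ₗ[ℂ] (E × LinearMap.BilinForm ℂ N) :=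
  LinearMap.id.prodMap (pullForm q)

/-- The map `D → E ⊕ Sym² D` dual to `ψ : E^∨ ⊕ Sym² N → N`. -/
def dualMaps [FiniteDimensional ℂ E] (ψ : StructureMaps E N) :
    Dual ℂ N →ₗ[ℂ] E × LinearMap.BilinForm ℂ N :=
  ((evalEquiv ℂ E).symm.toLinearMap ∘ₗ ψ.1.dualMap).prod
    { toFun := fun l => ψ.2.compr₂ l
      map_add' := fun _ _ => rfl
      map_smul' := fun _ _ => rfl }

variable [FiniteDimensional ℂ E]

variable (E) in
/-- Pairs of a point `ψ` over the orbit space and a `d`-dimensional subspace of the fibre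
`(E ⊕ S_k) / D`, given as a subspace `W` with `D ⊆ W ⊆ E ⊕ S_k`, `dim W = dim D + d`; here `D`
is embedded by the dual of `ψ`. -/
abbrev GrassmannPairs (F : ℕ → Submodule ℂ N) (k d : ℕ) : Type _ :=
  {p : filteredMaps E F × Submodule ℂ (E × LinearMap.BilinForm ℂ N) //
    LinearMap.range (dualMaps p.1.1) ≤ p.2 ∧ p.2 ≤ extSpace E F k ∧
      finrank ℂ p.2 = finrank ℂ N + d}

variable (E) in
/-- The Grassmann bundle `G_d ((E ⊕ S_k) / D)` over the orbit space: pairs modulo the diagonal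
action of the group of the flag. -/
def GrassmannBundle (F : ℕ → Submodule ℂ N) (k d : ℕ) : Type _ :=
  Quot fun p p' : GrassmannPairs E F k d => ∃ g : flagGL F,
    p'.1.1 = g • p.1.1 ∧
      p'.1.2 = p.1.2.map (pullExt E ((g⁻¹ : flagGL F).1 : N →ₗ[ℂ] N))

variable (E) in
/-- Frames: pairs of a point `ψ` and `d` vectors of `E ⊕ S_k` that are independent modulo `D`. -/
def grassmannFrames (F : ℕ → Submodule ℂ N) (k d : ℕ) :
    Set (StructureMaps E N × ((Fin d → ℂ) →ₗ[ℂ] (E × LinearMap.BilinForm ℂ N))) :=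
  {x | x.1 ∈ filteredMaps E F ∧
    LinearMap.range x.2 ⊔ LinearMap.range (dualMaps x.1) ≤ extSpace E F k ∧
    finrank ℂ ↥(LinearMap.range x.2 ⊔ LinearMap.range (dualMaps x.1)) = finrank ℂ N + d}

/-- The point of the Grassmann bundle spanned by a frame. -/
def GrassmannBundle.ofFrame {F : ℕ → Submodule ℂ N} {k d : ℕ} (x : grassmannFrames E F k d) :
    GrassmannBundle E F k d :=
  Quot.mk _ ⟨(⟨x.1.1, x.2.1⟩, LinearMap.range x.1.2 ⊔ LinearMap.range (dualMaps x.1.1)),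
    le_sup_right, x.2.2⟩

variable (E) in
/-- The Grassmann bundle as a space with functions: the quotient of the variety of frames. -/
def GrassmannBundle.variety (F : ℕ → Submodule ℂ N) (k d : ℕ) :
    SpaceWithFunctions (GrassmannBundle E F k d) :=
  (quasiAffine (grassmannFrames E F k d)).quotient GrassmannBundle.ofFrame

variable (E) in
/-- `(E ⊕ S_k) / D` is an algebraic vector bundle over the orbit space: Zariski locally there is
a regular section `σ` of the quotient map, and a fixed subspace `C` of `E ⊕ S_k` that is
complementary to the image of `D` under the dual of `σ u`, so that `C` trivializes the bundle. -/
def IsLocallyTrivialQuotient (F : ℕ → Submodule ℂ N) (k : ℕ) : Prop :=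
  ∀ y : NonassocHilb E F, ∃ (U : Set (NonassocHilb E F)) (σ : NonassocHilb E F → StructureMaps E N)
    (C : Submodule ℂ (E × LinearMap.BilinForm ℂ N)),
    (NonassocHilb.variety E F).IsZariskiOpen U ∧ y ∈ U ∧
    (NonassocHilb.variety E F).IsRegularMapOn U σ ∧
    ∀ u ∈ U, (∃ h : σ u ∈ filteredMaps E F, NonassocHilb.mk ⟨σ u, h⟩ = u) ∧
      C ⊓ LinearMap.range (dualMaps (σ u)) = ⊥ ∧
      C ⊔ LinearMap.range (dualMaps (σ u)) = extSpace E F k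

end Hilbert

end

/-!
Everything rests on one observation about a filtered structure map `φ`: since
`φ (F i ⊗ F j) ⊆ F (i + j)`, the operator `g ↦ φ ∘ (1 ⊕ g ⊗ g)` improves congruences, turning
agreement modulo `F k` into agreement modulo `F (k + 1)` (`totalMap_extMap_sub_mem`). As the
filtration is finite, equations in which `g` appears on the right through this operator have at
most one solution, and iteration finds it after finitely many steps.

* *Freeness.* A stabilizing `g` satisfies `g ψ = ψ (1 ⊕ g ⊗ g)`, as the identity does, and `ψ` is
  surjective; so `g = 1` (`IsHom.unique`). In the same way a morphism to a surjective filtered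
  structure map is surjective (`IsHom.surjective`).
* *Charts.* Fix `ψ₀`, a right inverse `s` of it, and a basis adapted to the flag. The maps `ψ` for
  which `ψ s` is the identity plus an endomorphism strictly lowering the level form an affine space
  `ψ₀ + L` that meets every orbit at most once, and near its points the element `g` that moves `φ`
  into it is found by iteration of a regular operation: the flag-preserving factor in the
  decomposition of an endomorphism into a flag-preserving and an opposite unipotent one
  (`exists_slice`). So the orbit space is covered by open subsets isomorphic to affine spaces
  (`exists_affine_chart`), finitely many by compactness.
* *Hausdorff.* The only candidate for a morphism from `ψ` to `φ` is found by iteration, hence is a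
  regular function of the pair. So the orbit relation is closed (`exists_poly_separating`), and the
  quotient map is open.
* *Compactness.* Let `A` be the matrix of `ψ` in an adapted basis. The equation
  `A (1 ⊕ H ⊗ H) Aᴴ = H` is solved by iteration from `H = 1`, and the solution is positive definite
  (`exists_posDef_fixed`). Bringing `H` to the identity by a triangular, hence flag-preserving,
  change of basis gives a representative of the orbit with `A Aᴴ = 1`
  (`exists_isHom_orthonormal`); these matrices form a compact set.
* *The tower.* Let `q` be the quotient of `N` by the last nonzero step of the flag. A filtered `ψ₂`
  factors through `q ⊗ q`, so `ψ` is the same as the induced structure map on the quotient together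
  with the components of `ψ` along the kernel of `q`, that is, with `d` vectors of `E ⊕ S_k`. After
  a choice of splitting of `q`, structure maps and frames correspond by mutually inverse linear maps
  `toFrame` and `ofFrameLin`; surjectivity of `ψ` means, dually, that the frame is independent
  modulo `D` (`IsFlagStep.toFrame_mem`, `IsFlagStep.ofFrameLin_mem`). Isomorphic structures
  correspond to equivalent frames (`IsFlagStep.ofFrame_eq_of_mk_eq`,
  `IsFlagStep.mk_eq_of_framePair`), and both quotients carry the quotient structure.
-/

open scoped TensorProduct

noncomputable section

/-! ### Germs of regular functions on a vector space -/

section RegularAt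

variable {V W W₁ W₂ W₃ : Type*} [AddCommGroup V] [Module ℂ V] [AddCommGroup W] [Module ℂ W]
  [AddCommGroup W₁] [Module ℂ W₁] [AddCommGroup W₂] [Module ℂ W₂] [AddCommGroup W₃] [Module ℂ W₃]

theorem dual_mem_polyFunctions (l : Dual ℂ V) : (fun v => l v) ∈ polyFunctions V :=
  Algebra.subset_adjoin ⟨l, rfl⟩

/-- The algebra of functions on `V` that agree with a quotient of polynomial functions on a
Zariski neighbourhood of `x`. -/
def regularAt (x : V) : Subalgebra ℂ (V → ℂ) where
  carrier := {f | ∃ p ∈ polyFunctions V, ∃ q ∈ polyFunctions V, q x ≠ 0 ∧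
    ∀ y, q y ≠ 0 → f y = p y / q y}
  mul_mem' := by
    rintro f g ⟨p, hp, q, hq, hx, h⟩ ⟨p', hp', q', hq', hx', h'⟩
    refine ⟨p * p', mul_mem hp hp', q * q', mul_mem hq hq', mul_ne_zero hx hx', fun y hy => ?_⟩
    have h1 := left_ne_zero_of_mul hy
    have h2 := right_ne_zero_of_mul hy
    simp only [Pi.mul_apply, h y h1, h' y h2]
    field_simp
  add_mem' := by
    rintro f g ⟨p, hp, q, hq, hx, h⟩ ⟨p', hp', q', hq', hx', h'⟩
    refine ⟨p * q' + q * p', add_mem (mul_mem hp hq') (mul_mem hq hp'), q * q', mul_mem hq hq',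
      mul_ne_zero hx hx', fun y hy => ?_⟩
    have h1 := left_ne_zero_of_mul hy
    have h2 := right_ne_zero_of_mul hy
    simp only [Pi.mul_apply, Pi.add_apply, h y h1, h' y h2]
    field_simp
  algebraMap_mem' c := ⟨algebraMap ℂ _ c, Subalgebra.algebraMap_mem _ c, 1, one_mem _, by simp,
    fun y _ => by simp⟩

variable {x : V}

theorem mem_regularAt_of_eqOn {f g : V → ℂ} (hg : g ∈ regularAt x) {q : V → ℂ}
    (hq : q ∈ polyFunctions V) (hx : q x ≠ 0) (h : ∀ y, q y ≠ 0 → f y = g y) :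
    f ∈ regularAt x := by
  obtain ⟨p', hp', q', hq', hx', h'⟩ := hg
  refine ⟨p' * q, mul_mem hp' hq, q' * q, mul_mem hq' hq, mul_ne_zero hx' hx, fun y hy => ?_⟩
  have h1 := left_ne_zero_of_mul hy
  have h2 := right_ne_zero_of_mul hy
  rw [h y h2, h' y h1]
  simp only [Pi.mul_apply]
  field_simp

theorem polyFunctions_le_regularAt (x : V) : polyFunctions V ≤ regularAt x :=
  fun p hp => ⟨p, hp, 1, one_mem _, by simp, fun y _ => by simp⟩

theorem inv_mem_regularAt {f : V → ℂ} (hf : f ∈ regularAt x) (hfx : f x ≠ 0) :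
    (fun v => (f v)⁻¹) ∈ regularAt x := by
  obtain ⟨p, hp, q, hq, hx, h⟩ := hf
  have hpx : p x ≠ 0 := by
    rw [h x hx] at hfx
    exact (div_ne_zero_iff.mp hfx).1
  refine ⟨q * q, mul_mem hq hq, p * q, mul_mem hp hq, mul_ne_zero hpx hx, fun y hy => ?_⟩
  have h1 := left_ne_zero_of_mul hy
  have h2 := right_ne_zero_of_mul hy
  simp only [Pi.mul_apply, h y h2]
  field_simp

theorem exists_poly_of_regularAt_ne_zero {f : V → ℂ} (hf : f ∈ regularAt x) (hfx : f x ≠ 0) :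
    ∃ q ∈ polyFunctions V, q x ≠ 0 ∧ ∀ y, q y ≠ 0 → f y ≠ 0 := by
  obtain ⟨p, hp, q, hq, hx, h⟩ := hf
  have hpx : p x ≠ 0 := by
    rw [h x hx] at hfx
    exact (div_ne_zero_iff.mp hfx).1
  refine ⟨p * q, mul_mem hp hq, mul_ne_zero hpx hx, fun y hy => ?_⟩
  rw [h y (right_ne_zero_of_mul hy)]
  exact div_ne_zero (left_ne_zero_of_mul hy) (right_ne_zero_of_mul hy)

/-- A map between vector spaces is regular at `x` if its composite with every linear functional
is. The map is total: away from a neighbourhood of `x` its values are irrelevant. -/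
def RegularMapAt (f : V → W) (x : V) : Prop :=
  ∀ l : Dual ℂ W, (fun v => l (f v)) ∈ regularAt x

namespace RegularMapAt

theorem const (w : W) : RegularMapAt (fun _ : V => w) x := fun l =>
  Subalgebra.algebraMap_mem (regularAt x) (l w)

theorem linearMap (L : V →ₗ[ℂ] W) : RegularMapAt L x := fun l =>
  polyFunctions_le_regularAt x (dual_mem_polyFunctions (l ∘ₗ L))

theorem fst {x : W₁ × W₂} : RegularMapAt (fun p : W₁ × W₂ => p.1) x :=
  linearMap (LinearMap.fst ℂ W₁ W₂)

theorem snd {x : W₁ × W₂} : RegularMapAt (fun p : W₁ × W₂ => p.2) x :=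
  linearMap (LinearMap.snd ℂ W₁ W₂)

theorem clm {f : V → W} (hf : RegularMapAt f x) (L : W →ₗ[ℂ] W₁) :
    RegularMapAt (fun v => L (f v)) x := fun l => hf (l ∘ₗ L)

theorem add {f g : V → W} (hf : RegularMapAt f x) (hg : RegularMapAt g x) :
    RegularMapAt (fun v => f v + g v) x := fun l => by
  simp only [map_add]
  exact add_mem (hf l) (hg l)

theorem sub {f g : V → W} (hf : RegularMapAt f x) (hg : RegularMapAt g x) :
    RegularMapAt (fun v => f v - g v) x := fun l => by
  simp only [map_sub]
  exact sub_mem (hf l) (hg l)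

theorem sum {ι : Type*} (s : Finset ι) {f : ι → V → W} (hf : ∀ i ∈ s, RegularMapAt (f i) x) :
    RegularMapAt (fun v => ∑ i ∈ s, f i v) x := fun l => by
  have := sum_mem (fun i hi => hf i hi l)
  convert this using 1
  ext v
  simp

theorem smul {f : V → ℂ} {g : V → W} (hf : f ∈ regularAt x) (hg : RegularMapAt g x) :
    RegularMapAt (fun v => f v • g v) x := fun l => by
  simp only [map_smul, smul_eq_mul]
  exact mul_mem hf (hg l)

theorem bilin [FiniteDimensional ℂ W₁] (B : W₁ →ₗ[ℂ] W₂ →ₗ[ℂ] W₃) {f : V → W₁} {g : V → W₂}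
    (hf : RegularMapAt f x) (hg : RegularMapAt g x) :
    RegularMapAt (fun v => B (f v) (g v)) x := by
  have key : (fun v => B (f v) (g v)) = fun v => ∑ i,
      (finBasis ℂ W₁).coord i (f v) • B (finBasis ℂ W₁ i) (g v) := by
    ext v
    conv_lhs => rw [← (finBasis ℂ W₁).sum_repr (f v)]
    rw [map_sum, LinearMap.sum_apply]
    simp only [map_smul, LinearMap.smul_apply, Basis.coord_apply]
  rw [key]
  exact sum _ fun i _ => smul (hf _) (hg.clm _)

theorem apply [FiniteDimensional ℂ W₁] [FiniteDimensional ℂ W₂] {f : V → (W₁ →ₗ[ℂ] W₂)}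
    {g : V → W₁} (hf : RegularMapAt f x) (hg : RegularMapAt g x) :
    RegularMapAt (fun v => f v (g v)) x :=
  bilin LinearMap.id hf hg

theorem of_apply [FiniteDimensional ℂ W₁] {f : V → (W₁ →ₗ[ℂ] W₂)}
    (hf : ∀ w, RegularMapAt (fun v => f v w) x) : RegularMapAt f x := by
  set b := finBasis ℂ W₁
  have key : f = fun v => ∑ i, (LinearMap.toSpanSingleton ℂ W₂ (f v (b i))) ∘ₗ b.coord i := by
    ext v w
    conv_lhs => rw [← b.sum_repr w]
    rw [map_sum, LinearMap.sum_apply]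
    simp only [map_smul, LinearMap.comp_apply, LinearMap.toSpanSingleton_apply, Basis.coord_apply]
  rw [key]
  refine sum _ fun i _ => ?_
  exact (hf (b i)).clm
    { toFun := fun w => (LinearMap.toSpanSingleton ℂ W₂ w) ∘ₗ b.coord i
      map_add' := fun w w' => by ext; simp
      map_smul' := fun c w => by ext; simp [smul_smul, mul_comm] }

theorem mul [FiniteDimensional ℂ W] {f g : V → End ℂ W} (hf : RegularMapAt f x)
    (hg : RegularMapAt g x) : RegularMapAt (fun v => f v * g v) x :=
  of_apply fun w => hf.apply (hg.clm (LinearMap.applyₗ w))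

theorem prodMk {f : V → W₁} {g : V → W₂} (hf : RegularMapAt f x) (hg : RegularMapAt g x) :
    RegularMapAt (fun v => (f v, g v)) x := by
  convert (hf.clm (LinearMap.inl ℂ W₁ W₂)).add (hg.clm (LinearMap.inr ℂ W₁ W₂)) using 2
  simp

theorem comp_poly {f : V → W} (hf : RegularMapAt f x) {p : W → ℂ} (hp : p ∈ polyFunctions W) :
    (fun v => p (f v)) ∈ regularAt x := by
  induction hp using Algebra.adjoin_induction with
  | mem p hp => obtain ⟨l, rfl⟩ := hp; exact hf l
  | algebraMap c => exact Subalgebra.algebraMap_mem (regularAt x) c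
  | add p q _ _ h1 h2 => exact add_mem h1 h2
  | mul p q _ _ h1 h2 => exact mul_mem h1 h2

theorem comp_mem {f : V → W} (hf : RegularMapAt f x) {g : W → ℂ} (hg : g ∈ regularAt (f x)) :
    (fun v => g (f v)) ∈ regularAt x := by
  obtain ⟨p, hp, q, hq, hx, h⟩ := hg
  obtain ⟨q', hq', hx', h'⟩ := exists_poly_of_regularAt_ne_zero (hf.comp_poly hq) hx
  refine mem_regularAt_of_eqOn
    (mul_mem (hf.comp_poly hp) (inv_mem_regularAt (hf.comp_poly hq) hx)) hq' hx' fun y hy => ?_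
  rw [h _ (h' y hy), div_eq_mul_inv]
  rfl

theorem comp {f : V → W} {g : W → W₁} (hg : RegularMapAt g (f x)) (hf : RegularMapAt f x) :
    RegularMapAt (fun v => g (f v)) x := fun l => hf.comp_mem (hg l)

section Matrix

variable {n : Type*} [Fintype n] [DecidableEq n]

theorem det_mem {M : V → Matrix n n ℂ} (hM : ∀ i j, (fun v => M v i j) ∈ regularAt x) :
    (fun v => (M v).det) ∈ regularAt x := by
  have : (fun v => (M v).det) =
      ∑ σ : Equiv.Perm n, ((Equiv.Perm.sign σ : ℤ) : ℂ) • ∏ i, fun v => M v (σ i) i := by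
    ext v
    simp [Matrix.det_apply', Finset.sum_apply, Finset.prod_apply]
  rw [this]
  exact sum_mem fun σ _ => Subalgebra.smul_mem _ (prod_mem fun i _ => hM _ _) _

theorem adjugate_mem {M : V → Matrix n n ℂ} (hM : ∀ i j, (fun v => M v i j) ∈ regularAt x)
    (i j : n) : (fun v => (M v).adjugate i j) ∈ regularAt x := by
  simp only [Matrix.adjugate_apply]
  refine det_mem fun a c => ?_
  by_cases h : a = j
  · subst h
    simp only [Matrix.updateRow_self]
    exact Subalgebra.algebraMap_mem (regularAt x) ((Pi.single i 1 : n → ℂ) c)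
  · simpa [Matrix.updateRow_ne h] using hM a c

end Matrix

variable [FiniteDimensional ℂ W]

theorem toMatrix_mem {f : V → End ℂ W} (hf : RegularMapAt f x) (i j : Fin (finrank ℂ W)) :
    (fun v => LinearMap.toMatrix (finBasis ℂ W) (finBasis ℂ W) (f v) i j) ∈ regularAt x := by
  simp only [LinearMap.toMatrix_apply]
  exact (hf.clm (LinearMap.applyₗ (finBasis ℂ W j))) ((finBasis ℂ W).coord i)

theorem exists_poly_isUnit {f : V → End ℂ W} (hf : RegularMapAt f x) (hx : IsUnit (f x)) :
    ∃ q ∈ polyFunctions V, q x ≠ 0 ∧ ∀ y, q y ≠ 0 → IsUnit (f y) := by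
  simp only [LinearMap.isUnit_iff_isUnit_det, ← LinearMap.det_toMatrix (finBasis ℂ W),
    isUnit_iff_ne_zero] at hx ⊢
  exact exists_poly_of_regularAt_ne_zero (det_mem hf.toMatrix_mem) hx

theorem ringInverse {f : V → End ℂ W} (hf : RegularMapAt f x) (hx : IsUnit (f x)) :
    RegularMapAt (fun v => Ring.inverse (f v)) x := by
  set b := finBasis ℂ W
  have hdet : (LinearMap.toMatrix b b (f x)).det ≠ 0 := by
    rw [LinearMap.det_toMatrix]
    exact ((LinearMap.isUnit_iff_isUnit_det _).mp hx).ne_zero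
  have key : (fun v => Ring.inverse (f v)) = fun v => ∑ i, ∑ j,
      ((LinearMap.toMatrix b b (f v)).det⁻¹ * (LinearMap.toMatrix b b (f v)).adjugate i j) •
        Matrix.toLin b b (Matrix.single i j 1) := by
    ext1 v
    have h1 : LinearMap.toMatrixAlgEquiv b (Ring.inverse (f v)) =
        (LinearMap.toMatrix b b (f v))⁻¹ := by
      rw [Matrix.nonsing_inv_eq_ringInverse]
      by_cases hu : IsUnit (f v)
      · obtain ⟨u, hu⟩ := hu
        rw [← hu, Ring.inverse_unit]
        exact (Ring.inverse_unit
          (Units.mapEquiv (LinearMap.toMatrixAlgEquiv b).toMulEquiv u)).symm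
      · have hu' : ¬ IsUnit (LinearMap.toMatrix b b (f v)) := fun h => hu <| by
          simpa using h.map (LinearMap.toMatrixAlgEquiv b).symm
        rw [Ring.inverse_non_unit _ hu, Ring.inverse_non_unit _ hu', map_zero]
    apply (LinearMap.toMatrix b b).injective
    refine Eq.trans h1 ?_
    ext i j
    simp [Matrix.inv_def, Matrix.sum_apply, Matrix.single_apply, Ring.inverse_eq_inv, ite_and]
  rw [key]
  exact sum _ fun i _ => sum _ fun j _ => smul (mul_mem
    (inv_mem_regularAt (det_mem hf.toMatrix_mem) hdet) (adjugate_mem hf.toMatrix_mem i j)) (const _)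

end RegularMapAt

end RegularAt

/-! ### Zariski open sets and morphisms of quasi-affine varieties -/

section Morphisms

variable {V W : Type*} [AddCommGroup V] [Module ℂ V] [AddCommGroup W] [Module ℂ W]

theorem isOpen_zariskiTopology_iff {U : Set V} :
    @IsOpen V (zariskiTopology V) U ↔
      ∀ x ∈ U, ∃ p ∈ polyFunctions V, p x ≠ 0 ∧ ∀ y, p y ≠ 0 → y ∈ U := by
  let _ := zariskiTopology V
  have hb : TopologicalSpace.IsTopologicalBasis
      {U : Set V | ∃ p ∈ polyFunctions V, U = {v | p v ≠ 0}} :=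
    { exists_subset_inter := by
        rintro _ ⟨p, hp, rfl⟩ _ ⟨q, hq, rfl⟩ x ⟨hx, hx'⟩
        exact ⟨_, ⟨p * q, mul_mem hp hq, rfl⟩, mul_ne_zero hx hx',
          fun y hy => ⟨left_ne_zero_of_mul hy, right_ne_zero_of_mul hy⟩⟩
      sUnion_eq := Set.sUnion_eq_univ_iff.mpr fun x =>
        ⟨_, ⟨1, one_mem _, rfl⟩, one_ne_zero⟩
      eq_generateFrom := rfl }
  rw [hb.isOpen_iff]
  constructor
  · intro h x hx
    obtain ⟨_, ⟨p, hp, rfl⟩, h1, h2⟩ := h x hx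
    exact ⟨p, hp, h1, h2⟩
  · intro h x hx
    obtain ⟨p, hp, h1, h2⟩ := h x hx
    exact ⟨_, ⟨p, hp, rfl⟩, h1, h2⟩

theorem quasiAffine_isZariskiOpen_iff {Z : Set V} {U : Set Z} :
    (quasiAffine Z).IsZariskiOpen U ↔
      ∀ x ∈ U, ∃ p ∈ polyFunctions V, p x ≠ 0 ∧ ∀ y : Z, p y ≠ 0 → y ∈ U := by
  refine (@isOpen_induced_iff _ _ (zariskiTopology V) _ _).trans ?_
  constructor
  · rintro ⟨T, hT, rfl⟩ x hx
    obtain ⟨p, hp, h1, h2⟩ := isOpen_zariskiTopology_iff.mp hT x hx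
    exact ⟨p, hp, h1, fun y hy => h2 y hy⟩
  · intro h
    refine ⟨{v | ∃ p ∈ polyFunctions V, p v ≠ 0 ∧ ∀ y : Z, p y ≠ 0 → y ∈ U},
      isOpen_zariskiTopology_iff.mpr ?_, ?_⟩
    · rintro x ⟨p, hp, h1, h2⟩
      exact ⟨p, hp, h1, fun y hy => ⟨p, hp, hy, h2⟩⟩
    · ext x
      exact ⟨fun ⟨p, hp, h1, h2⟩ => h2 x h1, fun hx => h x hx⟩

/-- A map from a subset `Z` of `V` to `W` is locally regular at `z` if, on a Zariski neighbourhood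
of `z` in `Z`, it is the restriction of a map `V → W` that is regular at `z`. -/
def LocallyRegularAt {Z : Set V} (φ : Z → W) (z : Z) : Prop :=
  ∃ Φ : V → W, RegularMapAt Φ z ∧ ∃ q ∈ polyFunctions V, q z ≠ 0 ∧ ∀ y : Z, q y ≠ 0 → φ y = Φ y

theorem LocallyRegularAt.of_regularMapAt {Z : Set V} {z : Z} {Φ : V → W}
    (h : RegularMapAt Φ z) : LocallyRegularAt (fun y : Z => Φ y) z :=
  ⟨Φ, h, 1, one_mem _, one_ne_zero, fun _ _ => rfl⟩

theorem LocallyRegularAt.isRegularOn {Z : Set V} {U : Set Z} {f : Z → ℂ}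
    (h : ∀ z ∈ U, LocallyRegularAt f z) : (quasiAffine Z).IsRegularOn U f := by
  intro z hz
  obtain ⟨Φ, hΦ, q, hq, hqz, h1⟩ := h z hz
  obtain ⟨p', hp', q', hq', hq'z, h2⟩ := hΦ LinearMap.id
  refine ⟨p' * q, mul_mem hp' hq, q' * q, mul_mem hq' hq, mul_ne_zero hq'z hqz, fun y _ hy => ?_⟩
  have h3 := left_ne_zero_of_mul hy
  have h4 := right_ne_zero_of_mul hy
  have h5 := h2 y h3
  simp only [LinearMap.id_apply] at h5
  rw [h1 y h4, h5]
  simp only [Pi.mul_apply]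
  field_simp

variable {Z : Set V} {Z' : Set W} {O : Set Z} {φ : Z → Z'}

theorem isZariskiOpen_inter_preimage
    (hφ : ∀ z ∈ O, LocallyRegularAt (fun y => (φ y : W)) z)
    (hO : (quasiAffine Z).IsZariskiOpen O) {U : Set Z'} (hU : (quasiAffine Z').IsZariskiOpen U) :
    (quasiAffine Z).IsZariskiOpen (O ∩ φ ⁻¹' U) := by
  rw [quasiAffine_isZariskiOpen_iff] at *
  rintro z ⟨hz, hzU⟩
  obtain ⟨p, hp, hpz, hpU⟩ := hU _ hzU
  obtain ⟨p', hp', hpz', hpO⟩ := hO z hz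
  obtain ⟨Φ, hΦ, q, hq, hqz, h1⟩ := hφ z hz
  have h1z : (φ z : W) = Φ z := h1 z hqz
  rw [h1z] at hpz
  obtain ⟨q', hq', hqz', h2⟩ := exists_poly_of_regularAt_ne_zero (hΦ.comp_poly hp) hpz
  refine ⟨p' * (q * q'), mul_mem hp' (mul_mem hq hq'), mul_ne_zero hpz' (mul_ne_zero hqz hqz'),
    fun y hy => ⟨hpO y (left_ne_zero_of_mul hy), hpU _ ?_⟩⟩
  have h3 := right_ne_zero_of_mul hy
  have h4 : (φ y : W) = Φ y := h1 y (left_ne_zero_of_mul h3)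
  rw [h4]
  exact h2 y (right_ne_zero_of_mul h3)

theorem isRegularOn_comp
    (hφ : ∀ z ∈ O, LocallyRegularAt (fun y => (φ y : W)) z)
    {U : Set Z'} {f : Z' → ℂ} (hf : (quasiAffine Z').IsRegularOn U f) :
    (quasiAffine Z).IsRegularOn (O ∩ φ ⁻¹' U) (f ∘ φ) := by
  rintro z ⟨hz, hzU⟩
  obtain ⟨p, hp, q, hq, hqz, h1⟩ := hf _ hzU
  obtain ⟨Φ, hΦ, q', hq', hqz', h2⟩ := hφ z hz
  have h2z : (φ z : W) = Φ z := h2 z hqz'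
  rw [h2z] at hqz
  obtain ⟨s, hs, t, ht, htz, h3⟩ := mul_mem (hΦ.comp_poly hp)
    (inv_mem_regularAt (hΦ.comp_poly hq) hqz)
  obtain ⟨q'', hq'', hqz'', h4⟩ := exists_poly_of_regularAt_ne_zero (hΦ.comp_poly hq) hqz
  refine ⟨s * (q' * q''), mul_mem hs (mul_mem hq' hq''), t * (q' * q''),
    mul_mem ht (mul_mem hq' hq''), mul_ne_zero htz (mul_ne_zero hqz' hqz''), fun y hyU hy => ?_⟩
  have h5 := right_ne_zero_of_mul hy
  have h6 := h4 y (right_ne_zero_of_mul h5)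
  have h7 := h3 y (left_ne_zero_of_mul hy)
  have h8 : (φ y : W) = Φ y := h2 y (left_ne_zero_of_mul h5)
  rw [← h8] at h6
  simp only [Pi.mul_apply, ← h8] at h7
  have h9 := left_ne_zero_of_mul hy
  have h10 := h1 (φ y) hyU.2 h6
  rw [Function.comp_apply, h10, div_eq_mul_inv, h7]
  exact (mul_div_mul_right _ _ h5).symm

/-- A map of quasi-affine varieties with local regular representatives is a morphism. -/
theorem isMorphism_quasiAffine (hφ : ∀ z, LocallyRegularAt (fun y => (φ y : W)) z) :
    (quasiAffine Z).IsMorphism (quasiAffine Z') φ := by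
  intro U hU
  have h1 := isZariskiOpen_inter_preimage (O := Set.univ) (fun z _ => hφ z)
    (quasiAffine_isZariskiOpen_iff.mpr fun x _ => ⟨1, one_mem _, one_ne_zero, fun _ _ => trivial⟩)
    hU
  have h2 := fun f (hf : (quasiAffine Z').IsRegularOn U f) =>
    isRegularOn_comp (O := Set.univ) (fun z _ => hφ z) hf
  rw [Set.univ_inter] at h1 h2
  exact ⟨h1, h2⟩

theorem isMorphism_of_linearMap (L : V →ₗ[ℂ] W) (hL : ∀ z ∈ Z, L z ∈ Z') :
    (quasiAffine Z).IsMorphism (quasiAffine Z') (fun z => ⟨L z, hL z z.2⟩) :=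
  isMorphism_quasiAffine fun _ => .of_regularMapAt (.linearMap L)

end Morphisms

namespace SpaceWithFunctions

variable {X Y T : Type*} {A : SpaceWithFunctions X} {B : SpaceWithFunctions Y}
  {C : SpaceWithFunctions T}

theorem IsMorphism.comp {ψ : Y → T} {φ : X → Y} (hψ : B.IsMorphism C ψ) (hφ : A.IsMorphism B φ) :
    A.IsMorphism C (ψ ∘ φ) := fun U hU =>
  ⟨(hφ _ (hψ U hU).1).1, fun f hf => (hφ _ (hψ U hU).1).2 _ ((hψ U hU).2 f hf)⟩

theorem isMorphism_quotient (A : SpaceWithFunctions X) (π : X → Y) :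
    A.IsMorphism (A.quotient π) π := fun _ hU => ⟨hU, fun _ hf => hf⟩

theorem isMorphism_quotient_iff {π : X → Y} {φ : Y → T} :
    (A.quotient π).IsMorphism C φ ↔ A.IsMorphism C (φ ∘ π) := Iff.rfl

/-- A morphism whose values lie in an open subset is a morphism to that subset. -/
theorem isMorphism_restrict {U : Set Y} (hU : B.IsZariskiOpen U) {φ : X → U}
    (hφ : A.IsMorphism B (fun x => (φ x : Y))) : A.IsMorphism (B.restrict U) φ := by
  intro O hO
  have hO' : B.IsZariskiOpen (Subtype.val '' O) := by
    let _ := B.zariski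
    exact hU.isOpenMap_subtype_val O hO
  have key : (fun x => (φ x : Y)) ⁻¹' (Subtype.val '' O) = φ ⁻¹' O := by
    ext x; simp
  obtain ⟨h1, h2⟩ := hφ _ hO'
  rw [key] at h1 h2
  refine ⟨h1, fun f hf => ?_⟩
  convert h2 _ hf using 1
  ext x
  exact (Subtype.val_injective.extend_apply f 0 (φ x)).symm

end SpaceWithFunctions

/-! ### Filtrations and adapted bases -/

section Filtration

variable {N : Type*} [AddCommGroup N] [Module ℂ N]

/-- A decreasing filtration `F 1 = ⊤ ⊇ F 2 ⊇ ⋯ ⊇ F (r + 1) = ⊥`; a flag with its dimensions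
forgotten. -/
structure IsFlagFiltration (r : ℕ) (F : ℕ → Submodule ℂ N) : Prop where
  antitone : Antitone F
  one : F 1 = ⊤
  last : F (r + 1) = ⊥

namespace IsFlagFiltration

variable {r : ℕ} {F : ℕ → Submodule ℂ N}

theorem zero (hF : IsFlagFiltration r F) : F 0 = ⊤ :=
  top_le_iff.mp (hF.one ▸ hF.antitone zero_le_one)

theorem mem_one (hF : IsFlagFiltration r F) (x : N) : x ∈ F 1 := hF.one ▸ Submodule.mem_top

theorem eq_bot (hF : IsFlagFiltration r F) {k : ℕ} (hk : r + 1 ≤ k) : F k = ⊥ :=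
  le_bot_iff.mp (hF.last ▸ hF.antitone hk)

/-- A linearly independent set that spans every step of the filtration by its intersection with it,
built by extension from the last step upwards. -/
theorem exists_adapted_set (hF : IsFlagFiltration r F) :
    ∃ S : Set N, LinearIndepOn ℂ id S ∧ ∀ m, Submodule.span ℂ (S ∩ F m) = F m := by
  have key : ∀ j ≤ r + 1, ∃ S : Set N, LinearIndepOn ℂ id S ∧ S ⊆ F (r + 1 - j) ∧
      ∀ m, r + 1 - j ≤ m → Submodule.span ℂ (S ∩ F m) = F m := by
    intro j
    induction j with
    | zero =>
      refine fun _ => ⟨∅, linearIndepOn_empty ℂ id, Set.empty_subset _, fun m hm => ?_⟩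
      rw [hF.eq_bot hm, Set.empty_inter, Submodule.span_empty]
    | succ j ih =>
      intro hj
      obtain ⟨S, hS, hSF, hspan⟩ := ih (by omega)
      have hk : r + 1 - j = (r + 1 - (j + 1)) + 1 := by omega
      rw [hk] at hSF hspan
      set k := r + 1 - (j + 1)
      obtain ⟨S', h1, h2, h3, h4⟩ := exists_linearIndepOn_id_extension hS
        (hSF.trans (hF.antitone (Nat.le_succ k)))
      refine ⟨S', h4, h1, fun m hm => le_antisymm
        (Submodule.span_le.mpr Set.inter_subset_right) ?_⟩
      rcases hm.eq_or_lt with rfl | hm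
      · rw [Set.inter_eq_left.mpr h1]
        exact h3
      · conv_lhs => rw [← hspan m hm]
        exact Submodule.span_mono (Set.inter_subset_inter_left _ h2)
  obtain ⟨S, h1, -, h3⟩ := key (r + 1) le_rfl
  exact ⟨S, h1, fun m => h3 m (by omega)⟩

/-- A filtered finite-dimensional space has a basis adapted to the filtration, ordered by level. -/
theorem exists_adapted_basis [FiniteDimensional ℂ N] (hF : IsFlagFiltration r F) :
    ∃ (b : Basis (Fin (finrank ℂ N)) ℂ N) (lev : Fin (finrank ℂ N) → ℕ), Monotone lev ∧
      ∀ k x, x ∈ F k ↔ ∀ i, lev i < k → b.repr x i = 0 := by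
  classical
  obtain ⟨S, hS, hspan⟩ := hF.exists_adapted_set
  have htop : ⊤ ≤ Submodule.span ℂ (Set.range ((↑) : S → N)) := by
    rw [Subtype.range_coe, ← hF.zero, ← hspan 0]
    exact Submodule.span_mono Set.inter_subset_left
  let b₀ : Basis S ℂ N := Basis.mk hS htop
  have : Fintype S := FiniteDimensional.fintypeBasisIndex b₀
  have hcard : Fintype.card S = finrank ℂ N := (finrank_eq_card_basis b₀).symm
  let e₀ : S ≃ Fin (finrank ℂ N) := Fintype.equivFinOfCardEq hcard
  let lev₀ : S → ℕ := fun s => Nat.findGreatest (fun m => (s : N) ∈ F m) (r + 1)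
  have hlev : ∀ (s : S) (m : ℕ), (s : N) ∈ F m ↔ m ≤ lev₀ s := by
    intro s m
    have hne : (s : N) ≠ 0 := hS.ne_zero (i := s.1) s.2
    constructor
    · intro h
      refine Nat.le_findGreatest ?_ h
      by_contra hm
      rw [hF.eq_bot (by omega)] at h
      exact hne h
    · intro h
      have h0 : (s : N) ∈ F 0 := hF.zero ▸ Submodule.mem_top
      exact hF.antitone h
        (Nat.findGreatest_spec (P := fun m => (s : N) ∈ F m) (Nat.zero_le (r + 1)) h0)
  let σ := Tuple.sort (lev₀ ∘ e₀.symm)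
  refine ⟨b₀.reindex (e₀.trans σ.symm), (lev₀ ∘ e₀.symm) ∘ σ, Tuple.monotone_sort _, fun k x => ?_⟩
  have hb₀ : ∀ s, b₀ s = s := Basis.mk_apply hS htop
  have h1 : F k = Submodule.span ℂ (b₀ '' {s | k ≤ lev₀ s}) := by
    rw [← hspan k]
    congr 1
    ext x
    constructor
    · rintro ⟨h, h'⟩
      exact ⟨⟨x, h⟩, (hlev ⟨x, h⟩ k).mp h', hb₀ _⟩
    · rintro ⟨s, h, rfl⟩
      rw [hb₀]
      exact ⟨s.2, (hlev s k).mpr h⟩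
  rw [h1, Basis.mem_span_image]
  simp only [Basis.repr_reindex_apply]
  constructor
  · intro h i hi
    by_contra hne
    exact absurd hi (not_lt.mpr (h (Finsupp.mem_support_iff.mpr hne)))
  · intro h s hs
    by_contra hlt
    have hlt' : lev₀ s < k := not_le.mp hlt
    have := h ((e₀.trans σ.symm) s) (by simpa using hlt')
    rw [Equiv.symm_apply_apply] at this
    exact (Finsupp.mem_support_iff.mp hs) this

end IsFlagFiltration

theorem mem_flagGL_of_map_le [FiniteDimensional ℂ N] {F : ℕ → Submodule ℂ N} {g : N ≃ₗ[ℂ] N}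
    (hg : ∀ k, ∀ x ∈ F k, g x ∈ F k) : g ∈ flagGL F := fun k =>
  Submodule.eq_of_le_of_finrank_eq (Submodule.map_le_iff_le_comap.mpr fun x hx => hg k x hx)
    (LinearEquiv.finrank_map_eq g (F k))

theorem symm_apply_mem_of_flagGL {F : ℕ → Submodule ℂ N} {g : N ≃ₗ[ℂ] N} (hg : g ∈ flagGL F)
    {k : ℕ} {x : N} (hx : x ∈ F k) : g.symm x ∈ F k :=
  flagGL_apply_mem ((flagGL F).inv_mem hg) hx

end Filtration

/-! ### Filtered structure maps and their morphisms -/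

section StructureMaps

variable {E N N' N'' : Type*} [AddCommGroup E] [Module ℂ E] [AddCommGroup N] [Module ℂ N]
  [AddCommGroup N'] [Module ℂ N'] [AddCommGroup N''] [Module ℂ N'']

/-- The map `E^∨ ⊕ N ⊗ N → N` of a structure map, linearly in the structure map. -/
def totalMap : StructureMaps E N →ₗ[ℂ] (Dual ℂ E × N ⊗[ℂ] N) →ₗ[ℂ] N where
  toFun ψ := ψ.1.coprod (TensorProduct.lift ψ.2)
  map_add' ψ φ := by ext <;> simp
  map_smul' c ψ := by ext <;> simp

@[simp] theorem totalMap_inl (ψ : StructureMaps E N) (ε : Dual ℂ E) :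
    totalMap ψ (ε, 0) = ψ.1 ε := by simp [totalMap]

@[simp] theorem totalMap_tmul (ψ : StructureMaps E N) (x y : N) :
    totalMap ψ (0, x ⊗ₜ y) = ψ.2 x y := by simp [totalMap]

theorem totalMap_apply (ψ : StructureMaps E N) (t) :
    totalMap ψ t = ψ.1 t.1 + TensorProduct.lift ψ.2 t.2 := rfl

variable (E) in
/-- The map `id ⊕ g ⊗ g` from `E^∨ ⊕ N ⊗ N` to `E^∨ ⊕ N' ⊗ N'`. -/
def extMap (g : N →ₗ[ℂ] N') : (Dual ℂ E × N ⊗[ℂ] N) →ₗ[ℂ] (Dual ℂ E × N' ⊗[ℂ] N') :=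
  LinearMap.id.prodMap (TensorProduct.map g g)

@[simp] theorem extMap_inl (g : N →ₗ[ℂ] N') (ε : Dual ℂ E) : extMap E g (ε, 0) = (ε, 0) := by
  simp [extMap]

@[simp] theorem extMap_tmul (g : N →ₗ[ℂ] N') (x y : N) :
    extMap E g (0, x ⊗ₜ y) = (0, g x ⊗ₜ g y) := by simp [extMap]

@[simp] theorem extMap_id : extMap E (LinearMap.id : N →ₗ[ℂ] N) = LinearMap.id := by
  ext <;> simp

theorem extMap_comp (g : N →ₗ[ℂ] N') (g' : N' →ₗ[ℂ] N'') :
    extMap E (g' ∘ₗ g) = extMap E g' ∘ₗ extMap E g := by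
  ext <;> simp

/-- `g` intertwines the structure maps `ψ` and `φ`. -/
def IsHom (g : N →ₗ[ℂ] N') (ψ : StructureMaps E N) (φ : StructureMaps E N') : Prop :=
  g ∘ₗ totalMap ψ = totalMap φ ∘ₗ extMap E g

theorem isHom_iff {g : N →ₗ[ℂ] N'} {ψ : StructureMaps E N} {φ : StructureMaps E N'} :
    IsHom g ψ φ ↔ (∀ ε, g (ψ.1 ε) = φ.1 ε) ∧ ∀ x y, g (ψ.2 x y) = φ.2 (g x) (g y) := by
  constructor
  · intro h
    exact ⟨fun ε => by simpa using LinearMap.congr_fun h (ε, 0),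
      fun x y => by simpa using LinearMap.congr_fun h (0, x ⊗ₜ y)⟩
  · rintro ⟨h1, h2⟩
    refine LinearMap.prod_ext (LinearMap.ext fun ε => by simpa using h1 ε)
      (TensorProduct.ext' fun x y => by simpa using h2 x y)

theorem IsHom.comp {g : N →ₗ[ℂ] N'} {g' : N' →ₗ[ℂ] N''} {ψ : StructureMaps E N}
    {φ : StructureMaps E N'} {χ : StructureMaps E N''} (h' : IsHom g' φ χ) (h : IsHom g ψ φ) :
    IsHom (g' ∘ₗ g) ψ χ := by
  rw [IsHom, LinearMap.comp_assoc, h, ← LinearMap.comp_assoc, h', extMap_comp,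
    LinearMap.comp_assoc]

theorem isHom_id (ψ : StructureMaps E N) : IsHom LinearMap.id ψ ψ := by simp [IsHom]

theorem transport_eq_iff {g : N ≃ₗ[ℂ] N} {ψ φ : StructureMaps E N} :
    transport E g ψ = φ ↔ IsHom (g : N →ₗ[ℂ] N) ψ φ := by
  rw [isHom_iff]
  constructor
  · rintro rfl
    exact ⟨fun ε => rfl, fun x y => by simp [transport]⟩
  · rintro ⟨h1, h2⟩
    refine Prod.ext (LinearMap.ext h1) (LinearMap.ext₂ fun x y => ?_)
    simpa [transport] using h2 (g.symm x) (g.symm y)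

/-- Transport of structure maps along a linear equivalence, linearly in the structure map. -/
def transferLin (u : N ≃ₗ[ℂ] N') : StructureMaps E N →ₗ[ℂ] StructureMaps E N' where
  toFun ψ := (u.toLinearMap ∘ₗ ψ.1,
    (ψ.2.compl₁₂ u.symm.toLinearMap u.symm.toLinearMap).compr₂ u.toLinearMap)
  map_add' ψ φ := Prod.ext (by ext; simp) (by ext; simp)
  map_smul' c ψ := Prod.ext (by ext; simp) (by ext; simp)

variable (E) in
/-- The vector space of symmetric filtered structure maps, without the surjectivity condition. -/
def filteredSpace (F : ℕ → Submodule ℂ N) : Submodule ℂ (StructureMaps E N) where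
  carrier := {ψ | (∀ x y, ψ.2 x y = ψ.2 y x) ∧
    ∀ i j, 1 ≤ i → 1 ≤ j → ∀ x ∈ F i, ∀ y ∈ F j, ψ.2 x y ∈ F (i + j)}
  add_mem' := by
    rintro ψ φ ⟨h1, h2⟩ ⟨h1', h2'⟩
    exact ⟨fun x y => by simp [h1 x, h1' x], fun i j hi hj x hx y hy =>
      add_mem (h2 i j hi hj x hx y hy) (h2' i j hi hj x hx y hy)⟩
  zero_mem' := ⟨fun _ _ => rfl, fun _ _ _ _ _ _ _ _ => zero_mem _⟩
  smul_mem' := by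
    rintro c ψ ⟨h1, h2⟩
    exact ⟨fun x y => by simp [h1 x], fun i j hi hj x hx y hy =>
      Submodule.smul_mem _ c (h2 i j hi hj x hx y hy)⟩

theorem mem_filteredMaps_iff {F : ℕ → Submodule ℂ N} {ψ : StructureMaps E N} :
    ψ ∈ filteredMaps E F ↔ ψ ∈ filteredSpace E F ∧ Function.Surjective (totalMap ψ) :=
  and_assoc.symm

theorem mk_eq_mk_iff {F : ℕ → Submodule ℂ N} {ψ φ : filteredMaps E F} :
    NonassocHilb.mk ψ = NonassocHilb.mk φ ↔
      ∃ g ∈ flagGL F, IsHom (g : N →ₗ[ℂ] N) ψ.1 φ.1 := by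
  rw [eq_comm]
  refine Quotient.eq.trans ?_
  rw [MulAction.orbitRel_apply, MulAction.mem_orbit_iff]
  constructor
  · rintro ⟨g, h⟩
    exact ⟨g.1, g.2, transport_eq_iff.mp (congrArg Subtype.val h)⟩
  · rintro ⟨g, hg, h⟩
    exact ⟨⟨g, hg⟩, Subtype.ext (transport_eq_iff.mpr h)⟩

theorem mk_surjective {F : ℕ → Submodule ℂ N} :
    Function.Surjective (NonassocHilb.mk : filteredMaps E F → NonassocHilb E F) :=
  Quotient.mk_surjective

theorem mk_smul {F : ℕ → Submodule ℂ N} (g : flagGL F) (ψ : filteredMaps E F) :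
    NonassocHilb.mk (g • ψ) = NonassocHilb.mk ψ :=
  (mk_eq_mk_iff.mpr ⟨g.1, g.2, transport_eq_iff.mp rfl⟩).symm

section Contraction

variable {r : ℕ} {F : ℕ → Submodule ℂ N} {φ : StructureMaps E N}

/-- A filtered structure map raises congruences: if `g` and `g'` agree modulo `F k`, then
`φ ∘ (1 ⊕ g ⊗ g)` and `φ ∘ (1 ⊕ g' ⊗ g')` agree modulo `F (k + 1)`. -/
theorem totalMap_extMap_sub_mem (hF : IsFlagFiltration r F) (hφ : φ ∈ filteredSpace E F)
    {M : Type*} [AddCommGroup M] [Module ℂ M] {g g' : M →ₗ[ℂ] N} {k : ℕ}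
    (hk : 1 ≤ k) (hg : ∀ x, g x - g' x ∈ F k) (t) :
    totalMap φ (extMap E g t) - totalMap φ (extMap E g' t) ∈ F (k + 1) := by
  obtain ⟨ε, t⟩ := t
  simp only [totalMap_apply, extMap, LinearMap.prodMap_apply, LinearMap.id_apply,
    add_sub_add_left_eq_sub]
  induction t using TensorProduct.induction_on with
  | zero => simp
  | tmul x y =>
    have h1 := hφ.2 k 1 hk le_rfl _ (hg x) (g y) (hF.mem_one _)
    have h2 := hφ.2 k 1 hk le_rfl _ (hg y) (g' x) (hF.mem_one _)
    rw [hφ.1] at h2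
    convert add_mem h1 h2 using 1
    simp
  | add s t hs ht =>
    convert add_mem hs ht using 1
    simp only [map_add]
    abel

/-- Two maps are equal if agreement modulo `F k` always implies agreement modulo `F (k + 1)`. -/
theorem eq_of_sub_mem_step (hF : IsFlagFiltration r F) {M : Type*} [AddCommGroup M] [Module ℂ M]
    {g g' : M →ₗ[ℂ] N}
    (h : ∀ k, 1 ≤ k → (∀ x, g x - g' x ∈ F k) → ∀ x, g x - g' x ∈ F (k + 1)) : g = g' := by
  have key : ∀ k, ∀ x, g x - g' x ∈ F (k + 1) := by
    intro k
    induction k with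
    | zero => exact fun x => hF.mem_one _
    | succ k ih => exact h (k + 1) (by omega) ih
  ext x
  have := key r x
  rw [hF.last] at this
  exact sub_eq_zero.mp this

/-- A surjective structure map has at most one morphism to a given filtered structure map. -/
theorem IsHom.unique (hF : IsFlagFiltration r F) (hφ : φ ∈ filteredSpace E F) {M : Type*}
    [AddCommGroup M] [Module ℂ M] {ψ : StructureMaps E M} (hψ : Function.Surjective (totalMap ψ))
    {g g' : M →ₗ[ℂ] N} (hg : IsHom g ψ φ) (hg' : IsHom g' ψ φ) : g = g' := by
  refine eq_of_sub_mem_step hF fun k hk h x => ?_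
  obtain ⟨t, rfl⟩ := hψ x
  have h1 := LinearMap.congr_fun hg t
  have h2 := LinearMap.congr_fun hg' t
  simp only [LinearMap.comp_apply] at h1 h2
  rw [h1, h2]
  exact totalMap_extMap_sub_mem hF hφ hk h t

/-- Every morphism to a surjective filtered structure map is surjective: its image meets all
classes modulo `F k`, by induction on `k`. -/
theorem IsHom.surjective (hF : IsFlagFiltration r F) {M : Type*} [AddCommGroup M]
    [Module ℂ M] {ψ : StructureMaps E M} (hφ : φ ∈ filteredMaps E F) {g : M →ₗ[ℂ] N}
    (hg : IsHom g ψ φ) : Function.Surjective g := by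
  rw [mem_filteredMaps_iff] at hφ
  have key : ∀ k, ∀ y, ∃ x, g x - y ∈ F (k + 1) := by
    intro k
    induction k with
    | zero => exact fun y => ⟨0, hF.mem_one _⟩
    | succ k ih =>
      intro y
      obtain ⟨⟨ε, t⟩, rfl⟩ := hφ.2 y
      induction t using TensorProduct.induction_on generalizing ε with
      | zero =>
        refine ⟨totalMap ψ (ε, 0), ?_⟩
        have h1 := LinearMap.congr_fun hg (ε, 0)
        simp only [LinearMap.comp_apply, extMap_inl] at h1
        rw [h1, sub_self]
        exact zero_mem _
      | tmul x y =>
        obtain ⟨x', hx⟩ := ih x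
        obtain ⟨y', hy⟩ := ih y
        refine ⟨totalMap ψ (ε, x' ⊗ₜ y'), ?_⟩
        have h1 := LinearMap.congr_fun hg (ε, x' ⊗ₜ y')
        simp only [LinearMap.comp_apply] at h1
        rw [h1]
        have h1 := hφ.1.2 (k + 1) 1 (by omega) le_rfl _ hx y (hF.mem_one _)
        have h2 := hφ.1.2 (k + 1) 1 (by omega) le_rfl _ hy (g x') (hF.mem_one _)
        rw [hφ.1.1] at h2
        convert add_mem h1 h2 using 1
        simp [totalMap_apply, extMap]
      | add s t hs ht =>
        obtain ⟨x, hx⟩ := hs ε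
        obtain ⟨y, hy⟩ := ht 0
        refine ⟨x + y, ?_⟩
        convert add_mem hx hy using 1
        simp only [totalMap_apply, map_add, map_zero]
        abel
  intro y
  obtain ⟨x, hx⟩ := key r y
  rw [hF.last] at hx
  exact ⟨x, sub_eq_zero.mp hx⟩

theorem mk_eq_mk_of_isHom (hF : IsFlagFiltration r F) [FiniteDimensional ℂ N]
    {ψ φ : filteredMaps E F} {g : N →ₗ[ℂ] N}
    (hg : IsHom g ψ.1 φ.1) (hgF : ∀ k, ∀ x ∈ F k, g x ∈ F k) :
    NonassocHilb.mk ψ = NonassocHilb.mk φ := by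
  have hs := hg.surjective hF φ.2
  exact mk_eq_mk_iff.mpr ⟨LinearEquiv.ofBijective g
    ⟨LinearMap.injective_iff_surjective.mpr hs, hs⟩, mem_flagGL_of_map_le hgF, hg⟩

theorem stabilizer_eq_bot (hF : IsFlagFiltration r F) (ψ : filteredMaps E F) :
    MulAction.stabilizer (flagGL F) ψ = ⊥ := by
  rw [eq_bot_iff]
  intro g hg
  have h1 : IsHom (g.1 : N →ₗ[ℂ] N) ψ.1 ψ.1 :=
    transport_eq_iff.mp (congrArg Subtype.val (MulAction.mem_stabilizer_iff.mp hg))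
  have hψ := mem_filteredMaps_iff.mp ψ.2
  have h2 := h1.unique hF hψ.1 hψ.2 (isHom_id _)
  rw [Subgroup.mem_bot]
  exact Subtype.ext (LinearEquiv.ext fun x => LinearMap.congr_fun h2 x)

end Contraction

end StructureMaps

/-! ### Flag-preserving and opposite unipotent endomorphisms -/

section Triangular

variable {N ι : Type*} [AddCommGroup N] [Module ℂ N]

/-- Endomorphisms preserving a filtration. -/
def filteredEnd (F : ℕ → Submodule ℂ N) : Submodule ℂ (End ℂ N) where
  carrier := {a | ∀ k, ∀ x ∈ F k, a x ∈ F k}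
  add_mem' ha hb k x hx := add_mem (ha k x hx) (hb k x hx)
  zero_mem' k _ _ := zero_mem (F k)
  smul_mem' c _ ha k x hx := Submodule.smul_mem _ c (ha k x hx)

/-- Endomorphisms that strictly lower the level of the vectors of a basis; they form a complement
to the endomorphisms preserving the filtration by level. -/
def loweringEnd (b : Basis ι ℂ N) (lev : ι → ℕ) : Submodule ℂ (End ℂ N) where
  carrier := {n | ∀ i j, lev j ≤ lev i → b.repr (n (b j)) i = 0}
  add_mem' ha hb i j h := by simp [ha i j h, hb i j h]
  zero_mem' i j _ := by simp
  smul_mem' c _ ha i j h := by simp [ha i j h]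

/-- The basis `b` with levels `lev` is adapted to the filtration `F`. -/
def IsAdapted (F : ℕ → Submodule ℂ N) (b : Basis ι ℂ N) (lev : ι → ℕ) : Prop :=
  ∀ k x, x ∈ F k ↔ ∀ i, lev i < k → b.repr x i = 0

variable {F : ℕ → Submodule ℂ N} {b : Basis ι ℂ N} {lev : ι → ℕ}

theorem one_mem_filteredEnd : (1 : End ℂ N) ∈ filteredEnd F := fun _ _ hx => hx

theorem mul_mem_filteredEnd {a a' : End ℂ N} (h : a ∈ filteredEnd F) (h' : a' ∈ filteredEnd F) :
    a * a' ∈ filteredEnd F := fun k x hx => h k _ (h' k x hx)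

theorem IsAdapted.basis_mem (hb : IsAdapted F b lev) (j : ι) : b j ∈ F (lev j) := by
  classical
  exact (hb _ _).mpr fun i hi => by
    rw [b.repr_self, Finsupp.single_apply, if_neg (fun h => by rw [h] at hi; exact lt_irrefl _ hi)]

variable [Fintype ι]

theorem IsAdapted.mem_filteredEnd_iff (hb : IsAdapted F b lev) {a : End ℂ N} :
    a ∈ filteredEnd F ↔ ∀ i j, lev i < lev j → b.repr (a (b j)) i = 0 := by
  constructor
  · intro h i j hij
    exact (hb _ _).mp (h _ _ (hb.basis_mem j)) i hij
  · intro h k x hx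
    rw [← b.sum_repr x, map_sum]
    refine sum_mem fun j _ => ?_
    rw [map_smul]
    by_cases hj : lev j < k
    · rw [(hb _ _).mp hx j hj, zero_smul]
      exact zero_mem _
    · exact Submodule.smul_mem _ _ ((hb _ _).mpr fun i hi => h i j (by omega))

/-- Uniqueness in the decomposition of an endomorphism into a flag-preserving and an opposite
unipotent factor, modulo a step of the filtration. -/
theorem IsAdapted.sub_mem_of_mul_sub_mem (hb : IsAdapted F b lev) {g u u' : End ℂ N}
    (hg : g ∈ filteredEnd F) (hu : u - 1 ∈ loweringEnd b lev) (hu' : u' - 1 ∈ loweringEnd b lev)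
    {k : ℕ} (h : ∀ x, g (u x) - u' x ∈ F k) (x : N) : g x - x ∈ F k := by
  have hlin : ∀ x, (∀ j, b.repr x j ≠ 0 → g (b j) - b j ∈ F k) → g x - x ∈ F k := by
    intro x hx
    have : g x - x = ∑ j, b.repr x j • (g (b j) - b j) := by
      conv_lhs => rw [← b.sum_repr x, map_sum, ← Finset.sum_sub_distrib]
      simp [smul_sub]
    rw [this]
    refine sum_mem fun j _ => ?_
    by_cases hj : b.repr x j = 0
    · rw [hj, zero_smul]
      exact zero_mem _
    · exact Submodule.smul_mem _ _ (hx j hj)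
  have key : ∀ m j, lev j = m → g (b j) - b j ∈ F k := by
    intro m
    induction m using Nat.strong_induction_on with
    | _ m ih =>
      intro j hj
      have h1 : g ((u - 1) (b j)) - (u - 1) (b j) ∈ F k := by
        refine hlin _ fun i hi => ih (lev i) ?_ i rfl
        by_contra hlt
        exact hi (hu i j (by omega))
      have h2 := sub_mem (h (b j)) h1
      refine (hb _ _).mpr fun i hi => ?_
      by_cases hij : lev i < lev j
      · have h3 := hb.mem_filteredEnd_iff.mp (sub_mem hg one_mem_filteredEnd) i j hij
        simpa using h3
      · have h3 := (hb _ _).mp h2 i hi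
        have h4 := hu i j (by omega)
        have h5 := hu' i j (by omega)
        simp only [LinearMap.sub_apply, End.one_apply, map_sub, Finsupp.sub_apply] at h3 h4 h5 ⊢
        linear_combination h3 + h5 - h4
  exact hlin x fun j _ => key _ j rfl

theorem isUnit_of_sub_one_mem_loweringEnd {u : End ℂ N}
    (hu : u - 1 ∈ loweringEnd b lev) : IsUnit u := by
  have : FiniteDimensional ℂ N := b.finiteDimensional_of_finite
  rw [End.isUnit_iff, Function.Bijective, ← LinearMap.injective_iff_surjective, and_self]
  rw [injective_iff_map_eq_zero]
  intro x hx
  by_contra hne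
  classical
  -- a coordinate of maximal level among the nonzero ones survives
  obtain ⟨i, hi, hmax⟩ := Finset.exists_max_image (Finset.univ.filter fun i => b.repr x i ≠ 0) lev
    (by
      by_contra h
      rw [Finset.not_nonempty_iff_eq_empty, Finset.filter_eq_empty_iff] at h
      exact hne (b.ext_elem fun i => by simpa using h (Finset.mem_univ i)))
  simp only [Finset.mem_filter, Finset.mem_univ, true_and] at hi hmax
  apply hi
  have h1 : (u - 1) x = -x := by simp [hx]
  have h2 : b.repr ((u - 1) x) i = 0 := by
    conv_lhs => rw [← b.sum_repr x]
    rw [map_sum, map_sum, Finsupp.finsetSum_apply]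
    refine Finset.sum_eq_zero fun j _ => ?_
    by_cases hj : b.repr x j = 0
    · simp [hj]
    · rw [map_smul, map_smul, Finsupp.smul_apply, hu i j (hmax j hj), smul_zero]
  rw [h1] at h2
  simpa using h2

/-- The projection of endomorphisms to the flag-preserving ones that kills the lowering ones. -/
def IsAdapted.proj (hb : IsAdapted F b lev) : End ℂ N →ₗ[ℂ] filteredEnd F :=
  LinearMap.codRestrict (filteredEnd F)
    { toFun := fun n => b.constr ℂ fun j =>
        ∑ i, (if lev j ≤ lev i then b.repr (n (b j)) i else 0) • b i
      map_add' := fun n n' => b.ext fun j => by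
        simp only [Basis.constr_basis, LinearMap.add_apply, ← Finset.sum_add_distrib, ← add_smul]
        refine Finset.sum_congr rfl fun i _ => ?_
        split_ifs <;> simp
      map_smul' := fun c n => b.ext fun j => by
        simp only [Basis.constr_basis, LinearMap.smul_apply, Finset.smul_sum, smul_smul,
          RingHom.id_apply]
        refine Finset.sum_congr rfl fun i _ => ?_
        split_ifs <;> simp }
    fun n => hb.mem_filteredEnd_iff.mpr fun i j hij => by
      simp only [LinearMap.coe_mk, AddHom.coe_mk, Basis.constr_basis, b.repr_sum_self,
        if_neg (not_le.mpr hij)]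

theorem IsAdapted.repr_proj (hb : IsAdapted F b lev) (n : End ℂ N) (i j : ι) :
    b.repr ((hb.proj n).1 (b j)) i = if lev j ≤ lev i then b.repr (n (b j)) i else 0 := by
  simp only [IsAdapted.proj, LinearMap.codRestrict_apply, LinearMap.coe_mk, AddHom.coe_mk,
    Basis.constr_basis, b.repr_sum_self]

theorem IsAdapted.sub_proj_mem (hb : IsAdapted F b lev) (n : End ℂ N) :
    n - hb.proj n ∈ loweringEnd b lev := fun i j hij => by
  simp [hb.repr_proj, hij]

theorem IsAdapted.proj_eq_one (hb : IsAdapted F b lev) {n : End ℂ N}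
    (hn : n - 1 ∈ loweringEnd b lev) : hb.proj n = ⟨1, one_mem_filteredEnd⟩ := by
  refine Subtype.ext (b.ext fun j => b.ext_elem fun i => ?_)
  rw [hb.repr_proj]
  split_ifs with h
  · have := hn i j h
    simpa [sub_eq_zero] using this
  · classical
    rw [End.one_apply, b.repr_self, Finsupp.single_apply, if_neg]
    rintro rfl
    exact h le_rfl

/-- The linear operator `a ↦ proj (a * M)` on flag-preserving endomorphisms, linearly in `M`. The
flag-preserving factor of `M` is the inverse of the solution `a` of `proj (a * M) = 1`. -/
def IsAdapted.factorOp (hb : IsAdapted F b lev) : End ℂ N →ₗ[ℂ] End ℂ (filteredEnd F) :=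
  LinearMap.mk₂ ℂ (fun M a => hb.proj (a.1 * M)) (fun M M' a => by simp [mul_add])
    (fun c M a => by simp) (fun M a a' => by simp [add_mul]) (fun c M a => by simp)

theorem IsAdapted.factorOp_apply (hb : IsAdapted F b lev) (M : End ℂ N) (a : filteredEnd F) :
    hb.factorOp M a = hb.proj (a.1 * M) := rfl

/-- The equation `proj (a * u) = 1` is uniquely solvable when `u` is opposite unipotent. -/
theorem IsAdapted.isUnit_factorOp (hb : IsAdapted F b lev) {r : ℕ} (hF : IsFlagFiltration r F)
    {u : End ℂ N} (hu : u - 1 ∈ loweringEnd b lev) : IsUnit (hb.factorOp u) := by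
  have : FiniteDimensional ℂ N := b.finiteDimensional_of_finite
  rw [End.isUnit_iff, Function.Bijective, ← LinearMap.injective_iff_surjective, and_self]
  rw [injective_iff_map_eq_zero]
  intro a ha
  rw [hb.factorOp_apply] at ha
  have h1 := hb.sub_proj_mem (a.1 * u)
  rw [ha, ZeroMemClass.coe_zero, sub_zero] at h1
  refine Subtype.ext (LinearMap.ext fun x => ?_)
  have h2 := hb.sub_mem_of_mul_sub_mem (g := 1 + a.1) (u' := u + a.1 * u) (k := r + 1)
    (add_mem one_mem_filteredEnd a.2) hu
    (by rw [add_sub_right_comm]; exact add_mem hu h1) (fun x => by simp) x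
  rw [hF.last] at h2
  simpa using h2

end Triangular

/-! ### Slices of the action -/

section Slice

variable {E N ι : Type*} [AddCommGroup E] [Module ℂ E] [AddCommGroup N] [Module ℂ N] [Fintype ι]
  {F : ℕ → Submodule ℂ N} {b : Basis ι ℂ N} {lev : ι → ℕ}

/-- Structure maps `ψ` with `totalMap ψ ∘ s` strictly lowering: the direction of the slice. -/
def sliceSpace (F : ℕ → Submodule ℂ N) (b : Basis ι ℂ N) (lev : ι → ℕ)
    (s : N →ₗ[ℂ] Dual ℂ E × N ⊗[ℂ] N) : Submodule ℂ (StructureMaps E N) :=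
  filteredSpace E F ⊓ (loweringEnd b lev).comap ((LinearMap.lcomp ℂ N s) ∘ₗ totalMap)

/-- The endomorphism `φ ∘ (1 ⊕ h ⊗ h) ∘ s` of `N`. -/
def twist (s : N →ₗ[ℂ] Dual ℂ E × N ⊗[ℂ] N) (φ : StructureMaps E N) (h : End ℂ N) : End ℂ N :=
  totalMap φ ∘ₗ extMap E h ∘ₗ s

/-- The solution `a` of `proj (a * M) = 1`, with `M = φ ∘ (1 ⊕ h ⊗ h) ∘ s`; a junk value if the
equation is not uniquely solvable. -/
def normalizerInv (hb : IsAdapted F b lev) (s : N →ₗ[ℂ] Dual ℂ E × N ⊗[ℂ] N)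
    (φ : StructureMaps E N) (h : End ℂ N) : filteredEnd F :=
  Ring.inverse (hb.factorOp (twist s φ h)) ⟨1, one_mem_filteredEnd⟩

/-- Successive approximations to the flag-preserving automorphism `h` for which `h⁻¹` moves `φ`
into the slice; they become stationary since structure maps raise congruences. -/
def normalizer (hb : IsAdapted F b lev) (s : N →ₗ[ℂ] Dual ℂ E × N ⊗[ℂ] N)
    (φ : StructureMaps E N) : ℕ → End ℂ N
  | 0 => 1
  | j + 1 => Ring.inverse (normalizerInv hb s φ (normalizer hb s φ j)).1

theorem regularMapAt_extMap {V : Type*} [AddCommGroup V] [Module ℂ V] [FiniteDimensional ℂ N]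
    {x : V} {h : V → End ℂ N} (hh : RegularMapAt h x) (t : Dual ℂ E × N ⊗[ℂ] N) :
    RegularMapAt (fun v => extMap E (h v) t) x := by
  obtain ⟨ε, t⟩ := t
  refine RegularMapAt.prodMk (RegularMapAt.const ε) ?_
  induction t using TensorProduct.induction_on with
  | zero => simpa using RegularMapAt.const 0
  | tmul y z =>
    exact RegularMapAt.bilin (TensorProduct.mk ℂ N N) (hh.clm (LinearMap.applyₗ y))
      (hh.clm (LinearMap.applyₗ z))
  | add t t' ht ht' =>
    convert ht.add ht' using 2
    exact map_add (TensorProduct.map _ _) t t'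

theorem regularMapAt_twist {V : Type*} [AddCommGroup V] [Module ℂ V] [FiniteDimensional ℂ N]
    [FiniteDimensional ℂ E] {x : V} {h : V → End ℂ N} {φ : V → StructureMaps E N}
    (hh : RegularMapAt h x) (hφ : RegularMapAt φ x) (s : N →ₗ[ℂ] Dual ℂ E × N ⊗[ℂ] N) :
    RegularMapAt (fun v => twist s (φ v) (h v)) x :=
  RegularMapAt.of_apply fun y => (hφ.clm totalMap).apply (regularMapAt_extMap hh (s y))

theorem twist_one (s : N →ₗ[ℂ] Dual ℂ E × N ⊗[ℂ] N) (φ : StructureMaps E N) :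
    twist s φ 1 = totalMap φ ∘ₗ s := by
  have h : extMap E (1 : End ℂ N) = LinearMap.id := extMap_id
  rw [twist, h, LinearMap.id_comp]

section

variable (hb : IsAdapted F b lev) {r : ℕ} (hF : IsFlagFiltration r F)
  {s : N →ₗ[ℂ] Dual ℂ E × N ⊗[ℂ] N} {φ ψ : StructureMaps E N}

theorem normalizerInv_of_slice (hF : IsFlagFiltration r F)
    (hψ : totalMap ψ ∘ₗ s - 1 ∈ loweringEnd b lev) :
    normalizerInv hb s ψ 1 = ⟨1, one_mem_filteredEnd⟩ := by
  have hu := hb.isUnit_factorOp hF hψ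
  have h1 : hb.factorOp (totalMap ψ ∘ₗ s) ⟨1, one_mem_filteredEnd⟩ =
      ⟨1, one_mem_filteredEnd⟩ := by
    rw [hb.factorOp_apply, one_mul]
    exact hb.proj_eq_one hψ
  rw [normalizerInv, twist_one]
  conv_lhs => rw [← h1]
  rw [← End.mul_apply, Ring.inverse_mul_cancel _ hu, End.one_apply]

theorem normalizer_of_slice (hF : IsFlagFiltration r F)
    (hψ : totalMap ψ ∘ₗ s - 1 ∈ loweringEnd b lev) (j : ℕ) : normalizer hb s ψ j = 1 := by
  induction j with
  | zero => rfl
  | succ j ih => rw [normalizer, ih, normalizerInv_of_slice hb hF hψ, Ring.inverse_one]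

theorem regularMapAt_normalizer [FiniteDimensional ℂ E] (hF : IsFlagFiltration r F)
    (hψ : totalMap ψ ∘ₗ s - 1 ∈ loweringEnd b lev) (j : ℕ) :
    RegularMapAt (fun φ => normalizer hb s φ j) ψ ∧
    RegularMapAt (fun φ => hb.factorOp (twist s φ (normalizer hb s φ j))) ψ ∧
    RegularMapAt (fun φ => (normalizerInv hb s φ (normalizer hb s φ j)).1) ψ := by
  have : FiniteDimensional ℂ N := b.finiteDimensional_of_finite
  have step : ∀ j, RegularMapAt (fun φ => normalizer hb s φ j) ψ →
      RegularMapAt (fun φ => hb.factorOp (twist s φ (normalizer hb s φ j))) ψ ∧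
      RegularMapAt (fun φ => (normalizerInv hb s φ (normalizer hb s φ j)).1) ψ := by
    intro j h
    have h1 := (regularMapAt_twist h (RegularMapAt.linearMap LinearMap.id) s).clm
      (W₁ := End ℂ (filteredEnd F)) hb.factorOp
    refine ⟨h1, ?_⟩
    have h2 := h1.ringInverse (by
      dsimp only [LinearMap.id_apply]
      rw [normalizer_of_slice hb hF hψ, twist_one]
      exact hb.isUnit_factorOp hF hψ)
    exact (h2.clm (LinearMap.applyₗ (⟨1, one_mem_filteredEnd⟩ : filteredEnd F))).clm
      (filteredEnd F).subtype
  induction j with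
  | zero => exact ⟨RegularMapAt.const 1, step 0 (RegularMapAt.const 1)⟩
  | succ j ih =>
    have h := ih.2.2.ringInverse (by
      rw [normalizer_of_slice hb hF hψ, normalizerInv_of_slice hb hF hψ]
      exact isUnit_one)
    exact ⟨h, step (j + 1) h⟩

theorem exists_poly_isUnit_factorOp [FiniteDimensional ℂ E] (hF : IsFlagFiltration r F)
    (hψ : totalMap ψ ∘ₗ s - 1 ∈ loweringEnd b lev) (m : ℕ) :
    ∃ q ∈ polyFunctions (StructureMaps E N), q ψ ≠ 0 ∧ ∀ φ, q φ ≠ 0 → ∀ j < m,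
      IsUnit (hb.factorOp (twist s φ (normalizer hb s φ j))) := by
  have : FiniteDimensional ℂ N := b.finiteDimensional_of_finite
  induction m with
  | zero => exact ⟨1, one_mem _, one_ne_zero, fun _ _ j hj => absurd hj (Nat.not_lt_zero j)⟩
  | succ m ih =>
    obtain ⟨q, hq, hqψ, h⟩ := ih
    obtain ⟨q', hq', hqψ', h'⟩ := (regularMapAt_normalizer hb hF hψ m).2.1.exists_poly_isUnit (by
      rw [normalizer_of_slice hb hF hψ, twist_one]
      exact hb.isUnit_factorOp hF hψ)
    refine ⟨q * q', mul_mem hq hq', mul_ne_zero hqψ hqψ', fun φ hφ j hj => ?_⟩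
    rcases Nat.lt_succ_iff_lt_or_eq.mp hj with hj | rfl
    · exact h φ (left_ne_zero_of_mul hφ) j hj
    · exact h' φ (right_ne_zero_of_mul hφ)

theorem ringInverse_mem_filteredEnd [FiniteDimensional ℂ N] {a : End ℂ N}
    (ha : a ∈ filteredEnd F) (hu : IsUnit a) : Ring.inverse a ∈ filteredEnd F := by
  intro k x hx
  have hbij := (End.isUnit_iff a).mp hu
  let g : N ≃ₗ[ℂ] N := LinearEquiv.ofBijective a hbij
  have hg : g ∈ flagGL F := mem_flagGL_of_map_le ha
  have h1 : g (g.symm x) = x := g.apply_symm_apply x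
  have h2 : Ring.inverse a (a (g.symm x)) = g.symm x := by
    rw [← End.mul_apply, Ring.inverse_mul_cancel _ hu, End.one_apply]
  have h3 : a (g.symm x) = x := h1
  rw [h3] at h2
  rw [h2]
  exact symm_apply_mem_of_flagGL hg hx

theorem normalizerInv_mul_twist {h : End ℂ N} (hu : IsUnit (hb.factorOp (twist s φ h))) :
    (normalizerInv hb s φ h).1 * twist s φ h - 1 ∈ loweringEnd b lev := by
  have h1 : hb.factorOp (twist s φ h) (normalizerInv hb s φ h) = ⟨1, one_mem_filteredEnd⟩ := by
    rw [normalizerInv, ← End.mul_apply, Ring.mul_inverse_cancel _ hu, End.one_apply]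
  rw [hb.factorOp_apply] at h1
  have h2 := hb.sub_proj_mem ((normalizerInv hb s φ h).1 * twist s φ h)
  rwa [h1] at h2

theorem isUnit_normalizerInv {h : End ℂ N} (hu : IsUnit (hb.factorOp (twist s φ h))) :
    IsUnit (normalizerInv hb s φ h).1 := by
  have : FiniteDimensional ℂ N := b.finiteDimensional_of_finite
  have h1 := isUnit_of_sub_one_mem_loweringEnd (normalizerInv_mul_twist hb hu)
  rw [LinearMap.isUnit_iff_isUnit_det] at h1 ⊢
  rw [map_mul] at h1
  exact isUnit_of_mul_isUnit_left h1

/-- Consecutive approximations agree modulo further and further steps of the filtration. -/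
theorem normalizer_sub_mem (hF : IsFlagFiltration r F) (hφ : φ ∈ filteredSpace E F) {m : ℕ}
    (hu : ∀ j < m + 1, IsUnit (hb.factorOp (twist s φ (normalizer hb s φ j)))) :
    ∀ x, normalizer hb s φ (m + 1) x - normalizer hb s φ m x ∈ F (m + 1) := by
  have : FiniteDimensional ℂ N := b.finiteDimensional_of_finite
  induction m with
  | zero => exact fun x => hF.mem_one _
  | succ m ih =>
    set h := normalizer hb s φ (m + 1) with hh
    set h₀ := normalizer hb s φ m with hh₀
    set a' := normalizerInv hb s φ h with ha'
    set a := normalizerInv hb s φ h₀ with ha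
    have hua' : IsUnit a'.1 := isUnit_normalizerInv hb (hu (m + 1) (by omega))
    have hua : IsUnit a.1 := isUnit_normalizerInv hb (hu m (by omega))
    have hh' : normalizer hb s φ (m + 1 + 1) = Ring.inverse a'.1 := rfl
    have hhF : h ∈ filteredEnd F := ringInverse_mem_filteredEnd a.2 hua
    have hh'F : Ring.inverse a'.1 ∈ filteredEnd F := ringInverse_mem_filteredEnd a'.2 hua'
    have h1 := totalMap_extMap_sub_mem hF hφ (by omega)
      (ih fun j hj => hu j (by omega))
    -- compare the two factorisations after multiplication by `a'`
    have h2 := hb.sub_mem_of_mul_sub_mem (g := a'.1 * h) (u := a.1 * twist s φ h₀)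
      (u' := a'.1 * twist s φ h) (k := m + 1 + 1) (mul_mem_filteredEnd a'.2 hhF)
      (normalizerInv_mul_twist hb (hu m (by omega)))
      (normalizerInv_mul_twist hb (hu (m + 1) (by omega))) (fun x => by
        have e1 : h * a.1 = 1 := Ring.inverse_mul_cancel _ hua
        have e2 : (a'.1 * h) ((a.1 * twist s φ h₀) x) = a'.1 (twist s φ h₀ x) := by
          rw [← End.mul_apply, ← mul_assoc, mul_assoc a'.1 h, e1, mul_one, End.mul_apply]
        rw [e2, End.mul_apply, ← map_sub, ← neg_sub, map_neg]
        exact neg_mem (a'.2 _ _ (h1 (s x))))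
    intro x
    have h3 := hh'F _ _ (h2 x)
    have e3 : Ring.inverse a'.1 * a'.1 = 1 := Ring.inverse_mul_cancel _ hua'
    have e4 : Ring.inverse a'.1 (a'.1 (h x)) = h x := by
      rw [← End.mul_apply, e3, End.one_apply]
    rw [map_sub, End.mul_apply, e4] at h3
    rw [hh', ← neg_sub]
    exact neg_mem h3

end

variable [FiniteDimensional ℂ E] [FiniteDimensional ℂ N]

/-- Through every point `ψ₀` there is an affine subspace `ψ₀ + L` of filtered surjective structure
maps that meets each orbit at most once, and near each point of which structure maps can be moved
into it regularly. -/
theorem exists_slice {r : ℕ} (hF : IsFlagFiltration r F) {ψ₀ : StructureMaps E N}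
    (hψ₀ : ψ₀ ∈ filteredMaps E F) :
    ∃ L : Submodule ℂ (StructureMaps E N),
      (∀ ψ, ψ - ψ₀ ∈ L → ψ ∈ filteredMaps E F) ∧
      (∀ ψ φ, ψ - ψ₀ ∈ L → φ - ψ₀ ∈ L → ∀ g ∈ flagGL F, IsHom (g : N →ₗ[ℂ] N) ψ φ → ψ = φ) ∧
      ∀ ψ, ψ - ψ₀ ∈ L → ∃ ρ : StructureMaps E N → StructureMaps E N, RegularMapAt ρ ψ ∧
        ∃ q ∈ polyFunctions (StructureMaps E N), q ψ ≠ 0 ∧ ∀ φ ∈ filteredMaps E F, q φ ≠ 0 →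
          ρ φ - ψ₀ ∈ L ∧ ∃ g ∈ flagGL F, IsHom (g : N →ₗ[ℂ] N) φ (ρ φ) := by
  obtain ⟨b, lev, -, hb⟩ := hF.exists_adapted_basis
  change IsAdapted F b lev at hb
  have hψ₀' := mem_filteredMaps_iff.mp hψ₀
  obtain ⟨s, hs⟩ := (totalMap ψ₀).exists_rightInverse_of_surjective
    (LinearMap.range_eq_top.mpr hψ₀'.2)
  have hmem : ∀ ψ, ψ - ψ₀ ∈ sliceSpace F b lev s ↔ ψ ∈ filteredSpace E F ∧
      totalMap ψ ∘ₗ s - 1 ∈ loweringEnd b lev := by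
    intro ψ
    have h1 : ((LinearMap.lcomp ℂ N s) ∘ₗ totalMap) (ψ - ψ₀) = totalMap ψ ∘ₗ s - 1 := by
      rw [map_sub]
      exact congrArg _ hs
    rw [sliceSpace, Submodule.mem_inf, Submodule.mem_comap, h1,
      Submodule.sub_mem_iff_left _ hψ₀'.1]
  refine ⟨sliceSpace F b lev s, fun ψ hψ => ?_, fun ψ φ hψ hφ g hg hgh => ?_, fun ψ hψ => ?_⟩
  · obtain ⟨h1, h2⟩ := (hmem ψ).mp hψ
    have h3 := ((End.isUnit_iff _).mp (isUnit_of_sub_one_mem_loweringEnd h2)).2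
    exact mem_filteredMaps_iff.mpr ⟨h1, Function.Surjective.of_comp (g := s) h3⟩
  · obtain ⟨-, h2⟩ := (hmem ψ).mp hψ
    obtain ⟨h1', h2'⟩ := (hmem φ).mp hφ
    have hgF : (g : N →ₗ[ℂ] N) ∈ filteredEnd F := fun k x hx => flagGL_apply_mem hg hx
    have h3 : (g : N →ₗ[ℂ] N) = LinearMap.id := by
      refine eq_of_sub_mem_step hF fun k hk h x => ?_
      refine hb.sub_mem_of_mul_sub_mem hgF h2 h2' (fun x => ?_) x
      have h4 := totalMap_extMap_sub_mem hF h1' hk h (s x)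
      rw [extMap_id] at h4
      have h5 := LinearMap.congr_fun hgh (s x)
      simp only [LinearMap.comp_apply, LinearMap.id_apply] at h4 h5 ⊢
      rw [h5]
      exact h4
    rw [h3] at hgh
    have := isHom_iff.mp hgh
    exact Prod.ext (LinearMap.ext this.1) (LinearMap.ext₂ this.2)
  · obtain ⟨-, h2⟩ := (hmem ψ).mp hψ
    obtain ⟨q, hq, hqψ, hqu⟩ := exists_poly_isUnit_factorOp hb hF h2 (r + 1)
    refine ⟨fun φ => ((normalizerInv hb s φ (normalizer hb s φ r)).1 ∘ₗ φ.1,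
      (φ.2.compl₁₂ (normalizer hb s φ (r + 1)) (normalizer hb s φ (r + 1))).compr₂
        (normalizerInv hb s φ (normalizer hb s φ r)).1), ?_, q, hq, hqψ, fun φ hφ hqφ => ?_⟩
    · have r1 := (regularMapAt_normalizer hb hF h2 r).2.2
      have r2 := (regularMapAt_normalizer hb hF h2 (r + 1)).1
      refine RegularMapAt.prodMk (RegularMapAt.of_apply fun ε => ?_)
        (RegularMapAt.of_apply fun x => RegularMapAt.of_apply fun y => ?_)
      · exact r1.apply (RegularMapAt.fst.clm (LinearMap.applyₗ ε))
      · exact r1.apply ((RegularMapAt.snd.apply (r2.clm (LinearMap.applyₗ x))).apply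
          (r2.clm (LinearMap.applyₗ y)))
    · have hφ' := mem_filteredMaps_iff.mp hφ
      set h₀ := normalizer hb s φ r with hh₀
      set h := normalizer hb s φ (r + 1) with hh
      set a := normalizerInv hb s φ h₀ with ha
      have hur := hqu φ hqφ r (Nat.lt_succ_self r)
      have hua : IsUnit a.1 := isUnit_normalizerInv hb hur
      have hah : a.1 * h = 1 := Ring.mul_inverse_cancel _ hua
      have hha : h * a.1 = 1 := Ring.inverse_mul_cancel _ hua
      have heq : h = h₀ := by
        ext x
        have := normalizer_sub_mem hb hF hφ'.1 (hqu φ hqφ) x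
        rw [hF.last] at this
        exact sub_eq_zero.mp this
      let g : N ≃ₗ[ℂ] N := LinearEquiv.ofBijective a.1 ((End.isUnit_iff _).mp hua)
      have hgF : g ∈ flagGL F := mem_flagGL_of_map_le a.2
      have hg : (g : N →ₗ[ℂ] N) = a.1 := rfl
      have hhom : IsHom (g : N →ₗ[ℂ] N) φ (a.1 ∘ₗ φ.1, (φ.2.compl₁₂ h h).compr₂ a.1) := by
        refine isHom_iff.mpr ⟨fun ε => rfl, fun x y => ?_⟩
        have e := fun x => LinearMap.congr_fun hha x
        simp only [End.mul_apply, End.one_apply] at e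
        simp only [hg, LinearMap.compr₂_apply, LinearMap.compl₁₂_apply, e]
      have hmem' : (a.1 ∘ₗ φ.1, (φ.2.compl₁₂ h h).compr₂ a.1) ∈ filteredSpace E F := by
        rw [← transport_eq_iff.mpr hhom]
        exact (mem_filteredMaps_iff.mp (transport_mem hgF hφ)).1
      refine ⟨(hmem _).mpr ⟨hmem', ?_⟩, g, hgF, hhom⟩
      convert normalizerInv_mul_twist hb hur using 2
      have e1 : totalMap (a.1 ∘ₗ φ.1, (φ.2.compl₁₂ h h).compr₂ a.1) =
          a.1 ∘ₗ totalMap φ ∘ₗ extMap E h := by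
        ext <;> simp
      rw [e1, heq]
      rfl

end Slice

/-! ### The classical topology -/

section Classical

variable {V W : Type*} [AddCommGroup V] [Module ℂ V] [AddCommGroup W] [Module ℂ W]

theorem continuous_dual_classical (l : Dual ℂ V) :
    @Continuous V ℂ (classicalTopology V) _ l := by
  let _ := classicalTopology V
  exact continuous_iInf_dom (i := l) continuous_induced_dom

theorem continuous_classical_iff {T : Type*} [TopologicalSpace T] {f : T → V} :
    @Continuous T V _ (classicalTopology V) f ↔ ∀ l : Dual ℂ V, Continuous fun t => l (f t) := by
  rw [continuous_iInf_rng]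
  exact forall_congr' fun l => continuous_induced_rng

theorem continuous_poly_comp {T : Type*} [TopologicalSpace T] {f : T → V}
    (hf : ∀ l : Dual ℂ V, Continuous fun t => l (f t)) {p : V → ℂ} (hp : p ∈ polyFunctions V) :
    Continuous fun t => p (f t) := by
  induction hp using Algebra.adjoin_induction with
  | mem p hp => obtain ⟨l, rfl⟩ := hp; exact hf l
  | algebraMap c => exact continuous_const
  | add p q _ _ h1 h2 => exact h1.add h2
  | mul p q _ _ h1 h2 => exact h1.mul h2

theorem IsZariskiOpen.isOpen_classical {Z : Set V} {U : Set Z}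
    (hU : (quasiAffine Z).IsZariskiOpen U) : @IsOpen Z (classicalTopologyOn Z) U := by
  let _ := classicalTopologyOn Z
  rw [isOpen_iff_forall_mem_open]
  intro x hx
  obtain ⟨p, hp, hpx, h⟩ := quasiAffine_isZariskiOpen_iff.mp hU x hx
  have hc : Continuous fun y : Z => p y := continuous_poly_comp (fun l => by
    let _ := classicalTopology V
    exact (continuous_dual_classical l).comp continuous_induced_dom) hp
  exact ⟨{y | p y ≠ 0}, h, hc.isOpen_preimage _ isOpen_ne, hpx⟩

theorem RegularMapAt.exists_poly_ne_zero {f : V → W} {x : V} (hf : RegularMapAt f x)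
    (hx : f x ≠ 0) : ∃ q ∈ polyFunctions V, q x ≠ 0 ∧ ∀ y, q y ≠ 0 → f y ≠ 0 := by
  obtain ⟨l, hl⟩ : ∃ l : Dual ℂ W, l (f x) ≠ 0 := by
    by_contra! h
    exact hx ((forall_dual_apply_eq_zero_iff ℂ _).mp h)
  obtain ⟨q, hq, hqx, h⟩ := exists_poly_of_regularAt_ne_zero (hf l) hl
  exact ⟨q, hq, hqx, fun y hy h0 => h y hy (by simp [h0])⟩

end Classical

/-! ### The Hausdorff property -/

section Hausdorff

variable {E N : Type*} [AddCommGroup E] [Module ℂ E] [AddCommGroup N] [Module ℂ N]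

/-- Successive approximations to a morphism `g` from `p.1` to `p.2`, by iteration of the equation
`g = (p.2 ∘ (1 ⊕ g ⊗ g) ∘ s) (p.1 ∘ s)⁻¹`; the linear map `s` has to be such that `p.1 ∘ s` is
invertible. -/
def homApprox (s : N →ₗ[ℂ] Dual ℂ E × N ⊗[ℂ] N) (p : StructureMaps E N × StructureMaps E N) :
    ℕ → End ℂ N
  | 0 => 0
  | j + 1 => twist s p.2 (homApprox s p j) * Ring.inverse (twist s p.1 1)

variable {F : ℕ → Submodule ℂ N} {s : N →ₗ[ℂ] Dual ℂ E × N ⊗[ℂ] N} {ψ φ : StructureMaps E N}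

/-- A morphism from `ψ` to `φ`, if there is one, is the `r`-th approximation. -/
theorem homApprox_eq {r : ℕ} (hF : IsFlagFiltration r F) (hφ : φ ∈ filteredSpace E F)
    (hu : IsUnit (twist s ψ 1)) {g : N →ₗ[ℂ] N} (hg : IsHom g ψ φ) :
    homApprox s (ψ, φ) r = g := by
  have h1 : g = twist s φ g * Ring.inverse (twist s ψ 1) := by
    have h2 : twist s φ g = g * twist s ψ 1 := by
      rw [twist_one, End.mul_eq_comp, ← LinearMap.comp_assoc, hg, LinearMap.comp_assoc]
      rfl
    rw [h2, mul_assoc, Ring.mul_inverse_cancel _ hu, mul_one]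
  have key : ∀ j, ∀ x, homApprox s (ψ, φ) j x - g x ∈ F (j + 1) := by
    intro j
    induction j with
    | zero => exact fun x => hF.mem_one _
    | succ j ih =>
      intro x
      rw [h1]
      exact totalMap_extMap_sub_mem hF hφ (by omega) ih _
  ext x
  have := key r x
  rw [hF.last] at this
  exact sub_eq_zero.mp this

/-- The quotient map is open, as for every group action by homeomorphisms. -/
theorem isOpenQuotientMap_mk (F : ℕ → Submodule ℂ N) :
    @IsOpenQuotientMap _ _ (classicalTopologyOn (filteredMaps E F)) (NonassocHilb.classical E F)
      NonassocHilb.mk := by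
  let _ := classicalTopologyOn (filteredMaps E F)
  let _ := NonassocHilb.classical E F
  refine ⟨mk_surjective, continuous_coinduced_rng, fun U hU => ?_⟩
  rw [isOpen_coinduced]
  have h1 : NonassocHilb.mk ⁻¹' (NonassocHilb.mk '' U) =
      ⋃ g : flagGL F, (fun ψ : filteredMaps E F => g • ψ) ⁻¹' U := by
    ext ψ
    simp only [Set.mem_preimage, Set.mem_image, Set.mem_iUnion]
    constructor
    · rintro ⟨φ, hφ, h⟩
      obtain ⟨g, hg, hgh⟩ := mk_eq_mk_iff.mp h.symm
      refine ⟨⟨g, hg⟩, ?_⟩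
      convert hφ
      exact Subtype.ext (transport_eq_iff.mpr hgh)
    · rintro ⟨g, hg⟩
      exact ⟨_, hg, mk_smul g ψ⟩
  rw [h1]
  refine isOpen_iUnion fun g => hU.preimage ?_
  let _ := classicalTopology (StructureMaps E N)
  rw [continuous_induced_rng]
  refine continuous_classical_iff.mpr fun l => ?_
  exact (continuous_dual_classical (l ∘ₗ transferLin (E := E) g.1)).comp continuous_induced_dom

variable [FiniteDimensional ℂ E] [FiniteDimensional ℂ N]

theorem regularMapAt_homApprox {p : StructureMaps E N × StructureMaps E N}
    (hu : IsUnit (twist s p.1 1)) (j : ℕ) : RegularMapAt (fun p => homApprox s p j) p := by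
  have h1 : RegularMapAt (fun p : StructureMaps E N × StructureMaps E N => p.1) p :=
    RegularMapAt.fst
  have h2 : RegularMapAt (fun p : StructureMaps E N × StructureMaps E N => p.2) p :=
    RegularMapAt.snd
  induction j with
  | zero => exact RegularMapAt.const 0
  | succ j ih =>
    exact (regularMapAt_twist ih h2 s).mul
      ((regularMapAt_twist (RegularMapAt.const 1) h1 s).ringInverse hu)

/-- The orbit relation is Zariski closed in the product: pairs of points in different orbits are
separated from it by a polynomial, because a morphism between two surjective filtered structure
maps is a regular function of the pair. -/
theorem exists_poly_separating {r : ℕ} (hF : IsFlagFiltration r F) (hψ : ψ ∈ filteredMaps E F)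
    (hφ : φ ∈ filteredMaps E F) (h : ¬ ∃ g ∈ flagGL F, IsHom (g : N →ₗ[ℂ] N) ψ φ) :
    ∃ q ∈ polyFunctions (StructureMaps E N × StructureMaps E N), q (ψ, φ) ≠ 0 ∧
      ∀ ψ' φ', φ' ∈ filteredMaps E F → q (ψ', φ') ≠ 0 →
        ¬ ∃ g ∈ flagGL F, IsHom (g : N →ₗ[ℂ] N) ψ' φ' := by
  obtain ⟨s, hs⟩ := (totalMap ψ).exists_rightInverse_of_surjective
    (LinearMap.range_eq_top.mpr (mem_filteredMaps_iff.mp hψ).2)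
  have hu : IsUnit (twist s ψ 1) := by
    rw [twist_one, hs]
    exact isUnit_one
  have h1 : RegularMapAt (fun p : StructureMaps E N × StructureMaps E N => p.1) (ψ, φ) :=
    RegularMapAt.fst
  have h2 : RegularMapAt (fun p : StructureMaps E N × StructureMaps E N => p.2) (ψ, φ) :=
    RegularMapAt.snd
  have hG := regularMapAt_homApprox (p := (ψ, φ)) hu r
  obtain ⟨q, hq, hq0, hqu⟩ :=
    (regularMapAt_twist (RegularMapAt.const 1) h1 s).exists_poly_isUnit hu
  -- it suffices to find a regular function that vanishes on related pairs
  have key : ∀ f : StructureMaps E N × StructureMaps E N → N, RegularMapAt f (ψ, φ) →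
      f (ψ, φ) ≠ 0 → (∀ ψ' φ', ∀ g ∈ flagGL F, homApprox s (ψ', φ') r = g →
        IsHom (g : N →ₗ[ℂ] N) ψ' φ' → f (ψ', φ') = 0) →
      ∃ q ∈ polyFunctions (StructureMaps E N × StructureMaps E N), q (ψ, φ) ≠ 0 ∧
      ∀ ψ' φ', φ' ∈ filteredMaps E F → q (ψ', φ') ≠ 0 →
        ¬ ∃ g ∈ flagGL F, IsHom (g : N →ₗ[ℂ] N) ψ' φ' := by
    intro f hf hf0 hfz
    obtain ⟨q', hq', hq0', hqf⟩ := hf.exists_poly_ne_zero hf0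
    refine ⟨q * q', mul_mem hq hq', mul_ne_zero hq0 hq0', ?_⟩
    rintro ψ' φ' hφ' hne ⟨g, hg, hgh⟩
    exact hqf _ (right_ne_zero_of_mul hne) (hfz ψ' φ' g hg (homApprox_eq hF
      (mem_filteredMaps_iff.mp hφ').1 (hqu _ (left_ne_zero_of_mul hne)) hgh) hgh)
  set G := homApprox s (ψ, φ) r with hGdef
  by_cases hfil : ∀ k, ∀ x ∈ F k, G x ∈ F k
  · have hnot : ¬ IsHom G ψ φ := by
      intro hhom
      have hsurj := hhom.surjective hF hφ
      exact h ⟨LinearEquiv.ofBijective G ⟨LinearMap.injective_iff_surjective.mpr hsurj, hsurj⟩,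
        mem_flagGL_of_map_le hfil, hhom⟩
    rw [isHom_iff, not_and_or, not_forall, not_forall] at hnot
    rcases hnot with ⟨ε, hε⟩ | ⟨x, hx⟩
    · refine key (fun p => homApprox s p r (p.1.1 ε) - p.2.1 ε) ?_ (sub_ne_zero.mpr hε) ?_
      · exact (hG.apply (h1.clm (LinearMap.applyₗ ε ∘ₗ LinearMap.fst ℂ _ _))).sub
          (h2.clm (LinearMap.applyₗ ε ∘ₗ LinearMap.fst ℂ _ _))
      · intro ψ' φ' g _ hgG hg
        dsimp only
        rw [hgG]
        exact sub_eq_zero.mpr ((isHom_iff.mp hg).1 ε)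
    · rw [not_forall] at hx
      obtain ⟨y, hxy⟩ := hx
      refine key (fun p => homApprox s p r (p.1.2 x y) -
        p.2.2 (homApprox s p r x) (homApprox s p r y)) ?_ (sub_ne_zero.mpr hxy) ?_
      · refine (hG.apply (h1.clm (LinearMap.applyₗ y ∘ₗ LinearMap.applyₗ x ∘ₗ
          LinearMap.snd ℂ _ _))).sub ?_
        exact ((h2.clm (LinearMap.snd ℂ _ _)).apply (hG.clm (LinearMap.applyₗ x))).apply
          (hG.clm (LinearMap.applyₗ y))
      · intro ψ' φ' g _ hgG hg
        dsimp only
        rw [hgG]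
        exact sub_eq_zero.mpr ((isHom_iff.mp hg).2 x y)
  · push Not at hfil
    obtain ⟨k, x, hx, hGx⟩ := hfil
    obtain ⟨t, ht⟩ := (F k).mkQ.exists_rightInverse_of_surjective (F k).range_mkQ
    obtain ⟨P, hP⟩ : ∃ P : N →ₗ[ℂ] N, LinearMap.ker P = F k :=
      ⟨t ∘ₗ (F k).mkQ, by
        rw [LinearMap.ker_comp_of_ker_eq_bot _ (LinearMap.ker_eq_bot_of_inverse ht),
          Submodule.ker_mkQ]⟩
    refine key (fun p => P (homApprox s p r x)) ((hG.clm (LinearMap.applyₗ x)).clm P) ?_ ?_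
    · intro h0
      exact hGx (hP ▸ LinearMap.mem_ker.mpr h0)
    · intro ψ' φ' g hg hgG _
      rw [hgG]
      exact LinearMap.mem_ker.mp (hP ▸ flagGL_apply_mem hg hx)

theorem t2Space_nonassocHilb {r : ℕ} (hF : IsFlagFiltration r F) :
    @T2Space _ (NonassocHilb.classical E F) := by
  let _ := classicalTopologyOn (filteredMaps E F)
  let _ := NonassocHilb.classical E F
  rw [t2Space_iff_of_isOpenQuotientMap (isOpenQuotientMap_mk F), ← isOpen_compl_iff,
    isOpen_iff_forall_mem_open]
  rintro ⟨ψ, φ⟩ hne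
  obtain ⟨q, hq, hq0, h⟩ := exists_poly_separating hF ψ.2 φ.2 fun h => hne (mk_eq_mk_iff.mpr h)
  refine ⟨{p | q (p.1.1, p.2.1) ≠ 0}, fun p hp hp' => h _ _ p.2.2 hp (mk_eq_mk_iff.mp hp'),
    Continuous.isOpen_preimage ?_ _ isOpen_ne, hq0⟩
  refine continuous_poly_comp (f := fun p : filteredMaps E F × filteredMaps E F =>
    (p.1.1, p.2.1)) (fun l => ?_) hq
  have hX : ∀ l : Dual ℂ (StructureMaps E N),
      Continuous fun ψ : filteredMaps E F => l ψ := fun l => by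
    let _ := classicalTopology (StructureMaps E N)
    exact (continuous_dual_classical l).comp continuous_induced_dom
  have h1 : (fun p : filteredMaps E F × filteredMaps E F => l (p.1.1, p.2.1)) = fun p =>
      (l ∘ₗ LinearMap.inl ℂ _ _) p.1.1 + (l ∘ₗ LinearMap.inr ℂ _ _) p.2.1 := by
    ext p
    rw [LinearMap.comp_apply, LinearMap.comp_apply, ← map_add]
    simp
  rw [h1]
  exact ((hX _).comp continuous_fst).add ((hX _).comp continuous_snd)

end Hausdorff

/-! ### Compactness -/

section Compact

open scoped Kronecker ComplexOrder Matrix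

/-- A positive definite matrix is brought to the identity by a lower triangular one. -/
theorem exists_triangular_conj_eq_one {n : ℕ} {H : Matrix (Fin n) (Fin n) ℂ} (hH : H.PosDef) :
    ∃ W : Matrix (Fin n) (Fin n) ℂ, IsUnit W ∧ (∀ i j, i < j → W i j = 0) ∧ W * H * Wᴴ = 1 := by
  have hL : IsUnit (LDL.lowerInv hH) := isUnit_of_invertible _
  have hD : (LDL.diag hH).PosDef := by
    rw [LDL.diag_eq_lowerInv_conj]
    exact (Matrix.IsUnit.posDef_star_right_conjugate_iff hL).mpr hH
  have hpos : ∀ i, 0 < LDL.diagEntries hH i := Matrix.posDef_diagonal_iff.mp hD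
  have hre : ∀ i, 0 < (LDL.diagEntries hH i).re := fun i => (Complex.pos_iff.mp (hpos i)).1
  have hreal : ∀ i, LDL.diagEntries hH i = ((LDL.diagEntries hH i).re : ℂ) := fun i =>
    Complex.ext rfl (by simpa using (Complex.pos_iff.mp (hpos i)).2.symm)
  let t : Fin n → ℂ := fun i => ((√(LDL.diagEntries hH i).re)⁻¹ : ℝ)
  have ht : ∀ i, t i * LDL.diagEntries hH i * star (t i) = 1 := by
    intro i
    have h1 : √(LDL.diagEntries hH i).re ≠ 0 := (Real.sqrt_pos.mpr (hre i)).ne'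
    have h2 := Real.mul_self_sqrt (hre i).le
    rw [hreal i]
    simp only [t, Complex.star_def, Complex.conj_ofReal]
    rw [← Complex.ofReal_mul, ← Complex.ofReal_mul, ← Complex.ofReal_one]
    congr 1
    rw [← h2]
    simp only [Real.sqrt_mul_self (Real.sqrt_nonneg _)]
    field_simp
  have hne : ∀ i, t i ≠ 0 := fun i h => by simpa [h] using ht i
  refine ⟨Matrix.diagonal t * LDL.lowerInv hH, ?_, fun i j hij => ?_, ?_⟩
  · refine IsUnit.mul ?_ hL
    rw [Matrix.isUnit_iff_isUnit_det, Matrix.det_diagonal, isUnit_iff_ne_zero]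
    exact Finset.prod_ne_zero_iff.mpr fun i _ => hne i
  · rw [Matrix.diagonal_mul, LDL.lowerInv_triangular hH hij, mul_zero]
  · have h := LDL.diag_eq_lowerInv_conj hH
    rw [Matrix.conjTranspose_mul]
    calc _ = Matrix.diagonal t * (LDL.lowerInv hH * H * (LDL.lowerInv hH)ᴴ) *
          (Matrix.diagonal t)ᴴ := by simp only [Matrix.mul_assoc]
      _ = 1 := by
        rw [← h, LDL.diag, Matrix.diagonal_conjTranspose, Matrix.diagonal_mul_diagonal,
          Matrix.diagonal_mul_diagonal, ← Matrix.diagonal_one]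
        congr 1
        ext i
        exact ht i

variable {m n : ℕ}

/-- The block matrix of the map `1 ⊕ H ⊗ H`. -/
def extMatrix (m : ℕ) (H : Matrix (Fin n) (Fin n) ℂ) :
    Matrix (Fin m ⊕ Fin n × Fin n) (Fin m ⊕ Fin n × Fin n) ℂ :=
  Matrix.fromBlocks 1 0 0 (H ⊗ₖ H)

theorem extMatrix_one : extMatrix m (1 : Matrix (Fin n) (Fin n) ℂ) = 1 := by
  rw [extMatrix, Matrix.one_kronecker_one, Matrix.fromBlocks_one]

theorem extMatrix_mul (A B : Matrix (Fin n) (Fin n) ℂ) :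
    extMatrix m (A * B) = extMatrix m A * extMatrix m B := by
  simp [extMatrix, Matrix.fromBlocks_multiply, Matrix.mul_kronecker_mul]

theorem extMatrix_conjTranspose (A : Matrix (Fin n) (Fin n) ℂ) :
    extMatrix m Aᴴ = (extMatrix m A)ᴴ := by
  simp [extMatrix, Matrix.fromBlocks_conjTranspose, Matrix.conjTranspose_kronecker]

theorem extMatrix_isUnit {W : Matrix (Fin n) (Fin n) ℂ} (hW : IsUnit W) :
    IsUnit (extMatrix m W) := by
  obtain ⟨u, rfl⟩ := hW
  exact ⟨⟨extMatrix m u, extMatrix m (u⁻¹ : (Matrix (Fin n) (Fin n) ℂ)ˣ),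
    by rw [← extMatrix_mul, Units.mul_inv, extMatrix_one],
    by rw [← extMatrix_mul, Units.inv_mul, extMatrix_one]⟩, rfl⟩

theorem extMatrix_posDef {H : Matrix (Fin n) (Fin n) ℂ} (hH : H.PosDef) :
    (extMatrix m H).PosDef := by
  obtain ⟨W, hW, -, h⟩ := exists_triangular_conj_eq_one hH
  rw [← Matrix.IsUnit.posDef_star_right_conjugate_iff (extMatrix_isUnit hW),
    Matrix.star_eq_conjTranspose, ← extMatrix_conjTranspose, ← extMatrix_mul, ← extMatrix_mul, h,
    extMatrix_one]
  exact Matrix.PosDef.one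

theorem mul_mul_conjTranspose_apply_congr {ι κ : Type*} [Fintype κ] {A : Matrix ι κ ℂ}
    {K K' : Matrix κ κ ℂ} {i i' : ι}
    (h : ∀ p q, A i p ≠ 0 → A i' q ≠ 0 → K p q = K' p q) :
    (A * K * Aᴴ) i i' = (A * K' * Aᴴ) i i' := by
  rw [Matrix.mul_apply, Matrix.mul_apply]
  refine Finset.sum_congr rfl fun q _ => ?_
  rw [Matrix.conjTranspose_apply, Matrix.mul_apply, Matrix.mul_apply]
  by_cases hq : A i' q = 0
  · simp [hq]
  congr 1
  refine Finset.sum_congr rfl fun p _ => ?_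
  by_cases hp : A i p = 0
  · simp [hp]
  rw [h p q hp hq]

/-- If the entries of `A` respect levels as those of a filtered structure map do, the equation
`A (1 ⊕ H ⊗ H) Aᴴ = H` has a positive definite solution: iteration from `H = 1` preserves
positivity and becomes stationary. -/
theorem exists_posDef_fixed {A : Matrix (Fin n) (Fin m ⊕ Fin n × Fin n) ℂ} {lev : Fin n → ℕ}
    {r : ℕ} (hlev : ∀ i, 1 ≤ lev i ∧ lev i ≤ r) (hinj : Function.Injective A.vecMul)
    (hA : ∀ i a b, A i (Sum.inr (a, b)) ≠ 0 → lev a + lev b ≤ lev i) :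
    ∃ H : Matrix (Fin n) (Fin n) ℂ, H.PosDef ∧ A * extMatrix m H * Aᴴ = H := by
  let T : Matrix (Fin n) (Fin n) ℂ → Matrix (Fin n) (Fin n) ℂ := fun H =>
    A * extMatrix m H * Aᴴ
  have hpos : ∀ j, (T^[j] 1).PosDef := by
    intro j
    induction j with
    | zero => exact Matrix.PosDef.one
    | succ j ih =>
      rw [Function.iterate_succ_apply']
      exact (extMatrix_posDef ih).mul_mul_conjTranspose_same hinj
  have hstat : ∀ j i i', lev i ≤ j → lev i' ≤ j → T^[j + 1] 1 i i' = T^[j] 1 i i' := by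
    intro j
    induction j with
    | zero => exact fun i i' hi _ => absurd (hlev i).1 (by omega)
    | succ j ih =>
      intro i i' hi hi'
      rw [Function.iterate_succ_apply' T (j + 1), Function.iterate_succ_apply' T j]
      refine mul_mul_conjTranspose_apply_congr fun p q hp hq => ?_
      rcases p with p | ⟨a, c⟩ <;> rcases q with q | ⟨a', c'⟩
      · rfl
      · rfl
      · rfl
      · have h1 := hA i a c hp
        have h2 := hA i' a' c' hq
        have := (hlev a).1
        have := (hlev a').1
        have := (hlev c).1
        have := (hlev c').1
        simp only [extMatrix, Matrix.fromBlocks_apply₂₂, Matrix.kroneckerMap_apply]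
        simp only [Function.iterate_succ_apply'] at ih
        exact congrArg₂ (· * ·) (ih a a' (by omega) (by omega)) (ih c c' (by omega) (by omega))
  refine ⟨T^[r] 1, hpos r, ?_⟩
  change T (T^[r] 1) = _
  rw [← Function.iterate_succ_apply' T r]
  ext i i'
  exact hstat r i i' (hlev i).2 (hlev i').2

variable {E N : Type*} [AddCommGroup E] [Module ℂ E] [AddCommGroup N] [Module ℂ N]

section

variable (c : Basis (Fin m) ℂ (Dual ℂ E)) (b : Basis (Fin n) ℂ N)

/-- The matrix of a structure map with respect to bases of `E^∨` and `N`. -/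
def structureMatrix (ψ : StructureMaps E N) : Matrix (Fin n) (Fin m ⊕ Fin n × Fin n) ℂ :=
  LinearMap.toMatrix (c.prod (b.tensorProduct b)) b (totalMap ψ)

/-- The structure map with a given matrix. -/
def ofStructureMatrix : Matrix (Fin n) (Fin m ⊕ Fin n × Fin n) ℂ →ₗ[ℂ] StructureMaps E N :=
  ((LinearMap.lcomp ℂ N (LinearMap.inl ℂ (Dual ℂ E) (N ⊗[ℂ] N))).prod
    ((TensorProduct.lift.equiv (RingHom.id ℂ) N N N).symm.toLinearMap ∘ₗ
      LinearMap.lcomp ℂ N (LinearMap.inr ℂ (Dual ℂ E) (N ⊗[ℂ] N)))) ∘ₗ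
    (Matrix.toLin (c.prod (b.tensorProduct b)) b).toLinearMap

theorem totalMap_ofStructureMatrix (A : Matrix (Fin n) (Fin m ⊕ Fin n × Fin n) ℂ) :
    totalMap (ofStructureMatrix c b A) = Matrix.toLin (c.prod (b.tensorProduct b)) b A := by
  refine LinearMap.prod_ext (LinearMap.ext fun ε => ?_) (TensorProduct.ext' fun x y => ?_)
  · simp [ofStructureMatrix]
  · simp [ofStructureMatrix]

theorem structureMatrix_ofStructureMatrix (A : Matrix (Fin n) (Fin m ⊕ Fin n × Fin n) ℂ) :
    structureMatrix c b (ofStructureMatrix c b A) = A := by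
  rw [structureMatrix, totalMap_ofStructureMatrix, LinearMap.toMatrix_toLin]

theorem totalMap_injective : Function.Injective
    (totalMap : StructureMaps E N →ₗ[ℂ] (Dual ℂ E × N ⊗[ℂ] N) →ₗ[ℂ] N) := by
  intro ψ φ h
  refine Prod.ext (LinearMap.ext fun ε => ?_) (LinearMap.ext₂ fun x y => ?_)
  · simpa using LinearMap.congr_fun h (ε, 0)
  · simpa using LinearMap.congr_fun h (0, x ⊗ₜ y)

theorem ofStructureMatrix_structureMatrix (ψ : StructureMaps E N) :
    ofStructureMatrix c b (structureMatrix c b ψ) = ψ := by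
  apply totalMap_injective
  rw [totalMap_ofStructureMatrix, structureMatrix, Matrix.toLin_toMatrix]

theorem toMatrix_extMap (g : N →ₗ[ℂ] N) :
    LinearMap.toMatrix (c.prod (b.tensorProduct b)) (c.prod (b.tensorProduct b)) (extMap E g) =
      extMatrix m (LinearMap.toMatrix b b g) := by
  rw [extMap, LinearMap.toMatrix_prodMap, LinearMap.toMatrix_id, TensorProduct.toMatrix_map]
  rfl

theorem structureMatrix_inr (ψ : StructureMaps E N) (i j k : Fin n) :
    structureMatrix c b ψ i (Sum.inr (j, k)) = b.repr (ψ.2 (b j) (b k)) i := by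
  simp [structureMatrix, LinearMap.toMatrix_apply]

theorem surjective_of_mul_conjTranspose_eq_one {ψ : StructureMaps E N}
    (h : structureMatrix c b ψ * (structureMatrix c b ψ)ᴴ = 1) :
    Function.Surjective (totalMap ψ) := by
  have h1 := congrArg (Matrix.toLin b b) h
  rw [Matrix.toLin_mul b (c.prod (b.tensorProduct b)) b, Matrix.toLin_one, structureMatrix,
    Matrix.toLin_toMatrix] at h1
  exact fun x => ⟨_, LinearMap.congr_fun h1 x⟩

end

variable [FiniteDimensional ℂ N]

theorem vecMul_injective_of_surjective (c : Basis (Fin m) ℂ (Dual ℂ E)) (b : Basis (Fin n) ℂ N)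
    {ψ : StructureMaps E N} (h : Function.Surjective (totalMap ψ)) :
    Function.Injective (structureMatrix c b ψ).vecMul := by
  obtain ⟨s, hs⟩ := (totalMap ψ).exists_rightInverse_of_surjective (LinearMap.range_eq_top.mpr h)
  have h1 : structureMatrix c b ψ * LinearMap.toMatrix b (c.prod (b.tensorProduct b)) s = 1 := by
    rw [structureMatrix, ← LinearMap.toMatrix_comp, hs, LinearMap.toMatrix_id]
  intro v w hvw
  have h2 := congrArg (fun u => Matrix.vecMul u
    (LinearMap.toMatrix b (c.prod (b.tensorProduct b)) s)) hvw
  simpa [Matrix.vecMul_vecMul, h1] using h2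

/-- Every orbit contains a structure map whose matrix in an adapted basis has orthonormal rows. -/
theorem exists_isHom_orthonormal (c : Basis (Fin m) ℂ (Dual ℂ E)) {b : Basis (Fin n) ℂ N}
    {lev : Fin n → ℕ} (hmono : Monotone lev) {F : ℕ → Submodule ℂ N} {r : ℕ}
    (hF : IsFlagFiltration r F) (hb : IsAdapted F b lev) {ψ : StructureMaps E N}
    (hψ : ψ ∈ filteredMaps E F) :
    ∃ φ ∈ filteredMaps E F, (∃ g ∈ flagGL F, IsHom (g : N →ₗ[ℂ] N) ψ φ) ∧
      structureMatrix c b φ * (structureMatrix c b φ)ᴴ = 1 := by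
  have hψ' := mem_filteredMaps_iff.mp hψ
  have hlev : ∀ i, 1 ≤ lev i ∧ lev i ≤ r := by
    intro i
    constructor
    · by_contra h
      have h1 := (hb 1 (b i)).mp (hF.mem_one _) i (by omega)
      simp at h1
    · by_contra h
      have h1 := hb.basis_mem i
      rw [hF.eq_bot (by omega)] at h1
      exact b.ne_zero i h1
  obtain ⟨H, hH, hfix⟩ := exists_posDef_fixed (A := structureMatrix c b ψ) hlev
    (vecMul_injective_of_surjective c b hψ'.2) (fun i j k h => by
      rw [structureMatrix_inr] at h
      by_contra hlt
      exact h ((hb _ _).mp (hψ'.1.2 _ _ (hlev j).1 (hlev k).1 _ (hb.basis_mem j) _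
        (hb.basis_mem k)) i (not_le.mp hlt)))
  obtain ⟨W, hW, htri, hWH⟩ := exists_triangular_conj_eq_one hH
  have hgu : IsUnit (Matrix.toLin b b W) := by
    have := hW.map (Matrix.toLinAlgEquiv b)
    exact this
  let g : N ≃ₗ[ℂ] N := LinearEquiv.ofBijective _ ((End.isUnit_iff _).mp hgu)
  have hg' : (g : N →ₗ[ℂ] N) = Matrix.toLin b b W := rfl
  have hg : g ∈ flagGL F := mem_flagGL_of_map_le <| hb.mem_filteredEnd_iff.mpr fun i j hij => by
    change b.repr (Matrix.toLin b b W (b j)) i = 0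
    rw [Matrix.toLin_self, b.repr_sum_self]
    exact htri i j (hmono.reflect_lt hij)
  have hhom : IsHom (g : N →ₗ[ℂ] N) ψ (transport E g ψ) := transport_eq_iff.mp rfl
  refine ⟨_, transport_mem hg hψ, ⟨g, hg, hhom⟩, ?_⟩
  set Φ := structureMatrix c b (transport E g ψ) with hΦ
  have h1 : W * structureMatrix c b ψ = Φ * extMatrix m W := by
    have h2 := congrArg (LinearMap.toMatrix (c.prod (b.tensorProduct b)) b) hhom
    rwa [LinearMap.toMatrix_comp _ b, LinearMap.toMatrix_comp _ (c.prod (b.tensorProduct b)),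
      toMatrix_extMap, hg', LinearMap.toMatrix_toLin] at h2
  calc Φ * Φᴴ = Φ * extMatrix m (W * H * Wᴴ) * Φᴴ := by rw [hWH, extMatrix_one, Matrix.mul_one]
    _ = (Φ * extMatrix m W) * extMatrix m H * (Φ * extMatrix m W)ᴴ := by
      rw [extMatrix_mul, extMatrix_mul, extMatrix_conjTranspose, Matrix.conjTranspose_mul]
      simp only [Matrix.mul_assoc]
    _ = W * (structureMatrix c b ψ * extMatrix m H * (structureMatrix c b ψ)ᴴ) * Wᴴ := by
      rw [← h1, Matrix.conjTranspose_mul]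
      simp only [Matrix.mul_assoc]
    _ = 1 := by rw [hfix, hWH]

/-- The matrices with orthonormal rows of a given linear family form a compact set. -/
theorem isCompact_orthonormal_rows {ι κ : Type*} [Fintype ι] [Fintype κ] [DecidableEq ι]
    (L : Submodule ℂ (Matrix ι κ ℂ)) : IsCompact {A : Matrix ι κ ℂ | A ∈ L ∧ A * Aᴴ = 1} := by
  have hrow : ∀ A : Matrix ι κ ℂ, A * Aᴴ = 1 → ∀ i j, ‖A i j‖ ≤ 1 := by
    intro A hA i j
    have h2 := congrFun (congrFun hA i) i
    rw [Matrix.mul_apply, Matrix.one_apply_eq] at h2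
    have h3 : ∑ k, ‖A i k‖ ^ 2 = 1 := by
      simp only [Matrix.conjTranspose_apply, Complex.star_def, Complex.mul_conj'] at h2
      exact_mod_cast h2
    have h4 : ‖A i j‖ ^ 2 ≤ 1 := h3 ▸ Finset.single_le_sum (f := fun k => ‖A i k‖ ^ 2)
      (fun k _ => sq_nonneg _) (Finset.mem_univ j)
    exact (sq_le_one_iff₀ (norm_nonneg _)).mp h4
  have h1 : IsCompact {A : ι → κ → ℂ | ∀ i j, A i j ∈ Metric.closedBall (0 : ℂ) 1} := by
    convert isCompact_univ_pi fun _ : ι => isCompact_univ_pi fun _ : κ =>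
      isCompact_closedBall (0 : ℂ) 1
    ext A
    simp [Set.mem_pi]
  refine h1.of_isClosed_subset ?_ ?_
  · refine IsClosed.inter L.closed_of_finiteDimensional ?_
    exact isClosed_eq (continuous_id.matrix_mul continuous_id.matrix_conjTranspose)
      continuous_const
  · exact fun A hA i j => mem_closedBall_zero_iff.mpr (hrow A hA.2 i j)

theorem compactSpace_nonassocHilb [FiniteDimensional ℂ E] {r : ℕ} {F : ℕ → Submodule ℂ N}
    (hF : IsFlagFiltration r F) :
    @CompactSpace _ (NonassocHilb.classical E F) := by
  obtain ⟨b, lev, hmono, hb⟩ := hF.exists_adapted_basis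
  change IsAdapted F b lev at hb
  let c := finBasis ℂ (Dual ℂ E)
  let _ := classicalTopologyOn (filteredMaps E F)
  let _ := NonassocHilb.classical E F
  let K := {A | A ∈ (filteredSpace E F).comap (ofStructureMatrix c b) ∧ A * Aᴴ = 1}
  have hK : CompactSpace K := isCompact_iff_compactSpace.mp (isCompact_orthonormal_rows _)
  have hmem : ∀ A : K, ofStructureMatrix c b A.1 ∈ filteredMaps E F := fun A =>
    mem_filteredMaps_iff.mpr ⟨A.2.1, surjective_of_mul_conjTranspose_eq_one c b (by
      rw [structureMatrix_ofStructureMatrix]; exact A.2.2)⟩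
  let f : K → NonassocHilb E F := fun A => NonassocHilb.mk ⟨_, hmem A⟩
  have hf : Continuous f := by
    refine (isOpenQuotientMap_mk F).continuous.comp ?_
    let _ := classicalTopology (StructureMaps E N)
    rw [continuous_induced_rng]
    refine continuous_classical_iff.mpr fun l => ?_
    exact (LinearMap.continuous_of_finiteDimensional (l ∘ₗ ofStructureMatrix c b)).comp
      continuous_subtype_val
  have hsurj : Function.Surjective f := by
    intro y
    obtain ⟨ψ, rfl⟩ := mk_surjective y
    obtain ⟨φ, hφ, hg, hone⟩ := exists_isHom_orthonormal c hmono hF hb ψ.2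
    have h1 := ofStructureMatrix_structureMatrix c b φ
    refine ⟨⟨structureMatrix c b φ, ?_, hone⟩, ?_⟩
    · rw [Submodule.mem_comap, h1]
      exact (mem_filteredMaps_iff.mp hφ).1
    · refine (mk_eq_mk_iff.mpr ?_).symm
      dsimp only
      rwa [h1]
  rw [← isCompact_univ_iff, ← hsurj.range_eq]
  exact isCompact_range hf

end Compact

/-! ### Charts of the orbit space -/

section Charts

variable {E N : Type*} [AddCommGroup E] [Module ℂ E] [AddCommGroup N] [Module ℂ N]
  [FiniteDimensional ℂ E] [FiniteDimensional ℂ N] {F : ℕ → Submodule ℂ N} {r : ℕ}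

/-- Around every point, the orbit space has a Zariski open subset with a regular section whose
image is an affine subspace `ψ₀ + L` of the space of structure maps. -/
theorem exists_regular_section (hF : IsFlagFiltration r F) (ψ₀ : filteredMaps E F) :
    ∃ (L : Submodule ℂ (StructureMaps E N)) (O : Set (NonassocHilb E F))
      (σ : NonassocHilb E F → StructureMaps E N),
      (NonassocHilb.variety E F).IsZariskiOpen O ∧
      (∀ ψ, ψ - ψ₀.1 ∈ L → ∃ h : ψ ∈ filteredMaps E F,
        NonassocHilb.mk ⟨ψ, h⟩ ∈ O ∧ σ (NonassocHilb.mk ⟨ψ, h⟩) = ψ) ∧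
      (∀ u ∈ O, σ u - ψ₀.1 ∈ L ∧ ∃ h : σ u ∈ filteredMaps E F, NonassocHilb.mk ⟨σ u, h⟩ = u) ∧
      ∀ ψ : filteredMaps E F, NonassocHilb.mk ψ ∈ O →
        LocallyRegularAt (fun φ => σ (NonassocHilb.mk φ)) ψ := by
  classical
  obtain ⟨L, hL, huniq, hloc⟩ := exists_slice hF ψ₀.2
  let O : Set (NonassocHilb E F) :=
    {u | ∃ ψ, ψ - ψ₀.1 ∈ L ∧ ∃ h : ψ ∈ filteredMaps E F, NonassocHilb.mk ⟨ψ, h⟩ = u}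
  let σ : NonassocHilb E F → StructureMaps E N := fun u =>
    if h : u ∈ O then h.choose else 0
  have hσ : ∀ u ∈ O, σ u - ψ₀.1 ∈ L ∧
      ∃ h : σ u ∈ filteredMaps E F, NonassocHilb.mk ⟨σ u, h⟩ = u := by
    intro u hu
    have h1 : σ u = hu.choose := dif_pos hu
    rw [h1]
    exact hu.choose_spec
  have hσmk : ∀ ψ (hψ : ψ ∈ filteredMaps E F), ψ - ψ₀.1 ∈ L →
      NonassocHilb.mk ⟨ψ, hψ⟩ ∈ O ∧ σ (NonassocHilb.mk ⟨ψ, hψ⟩) = ψ := by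
    intro ψ hψ hψL
    have hO : NonassocHilb.mk ⟨ψ, hψ⟩ ∈ O := ⟨ψ, hψL, hψ, rfl⟩
    obtain ⟨h1, h2, h3⟩ := hσ _ hO
    obtain ⟨g, hg, hgh⟩ := mk_eq_mk_iff.mp h3
    exact ⟨hO, huniq _ _ h1 hψL g hg hgh⟩
  -- near a point over `O`, the section is `ρ` composed with a transport
  have key : ∀ φ : filteredMaps E F, NonassocHilb.mk φ ∈ O →
      ∃ Φ : StructureMaps E N → StructureMaps E N, RegularMapAt Φ φ.1 ∧
        ∃ q ∈ polyFunctions (StructureMaps E N), q φ ≠ 0 ∧ ∀ y : filteredMaps E F, q y ≠ 0 →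
          NonassocHilb.mk y ∈ O ∧ σ (NonassocHilb.mk y) = Φ y := by
    intro φ hφ
    obtain ⟨h1, h2, h3⟩ := hσ _ hφ
    obtain ⟨g, hg, hgh⟩ := mk_eq_mk_iff.mp h3.symm
    have hgφ : transferLin g φ.1 = σ (NonassocHilb.mk φ) := transport_eq_iff.mpr hgh
    obtain ⟨ρ, hρ, q, hq, hqψ, hρq⟩ := hloc _ h1
    rw [← hgφ] at hρ hqψ
    have hlin : RegularMapAt (transferLin g) φ.1 := RegularMapAt.linearMap _
    obtain ⟨q', hq', hqφ', hqq⟩ := exists_poly_of_regularAt_ne_zero (hlin.comp_poly hq) hqψ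
    refine ⟨_, hρ.comp hlin, q', hq', hqφ', fun y hy => ?_⟩
    obtain ⟨h4, g', hg', hgh'⟩ := hρq _ (transport_mem hg y.2) (hqq y hy)
    have h5 : NonassocHilb.mk y = NonassocHilb.mk ⟨ρ (transport E g y), hL _ h4⟩ := by
      rw [← mk_smul ⟨g, hg⟩ y]
      exact mk_eq_mk_iff.mpr ⟨g', hg', hgh'⟩
    rw [h5]
    exact hσmk _ _ h4
  refine ⟨L, O, σ, ?_, fun ψ hψ => ⟨hL ψ hψ, hσmk ψ _ hψ⟩, hσ, fun ψ hψ => ?_⟩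
  · refine quasiAffine_isZariskiOpen_iff.mpr fun φ hφ => ?_
    obtain ⟨Φ, hΦ, q, hq, hq0, h⟩ := key φ hφ
    exact ⟨q, hq, hq0, fun y hy => (h y hy).1⟩
  · obtain ⟨Φ, hΦ, q, hq, hq0, h⟩ := key ψ hψ
    exact ⟨Φ, hΦ, q, hq, hq0, fun y hy => (h y hy).2⟩

theorem isRegularOn_congr {V : Type*} [AddCommGroup V] [Module ℂ V] {Z : Set V} {U : Set Z}
    {f g : Z → ℂ} (hf : (quasiAffine Z).IsRegularOn U f) (h : ∀ z ∈ U, g z = f z) :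
    (quasiAffine Z).IsRegularOn U g := by
  intro x hx
  obtain ⟨p, hp, q, hq, hqx, hpq⟩ := hf x hx
  exact ⟨p, hp, q, hq, hqx, fun y hy hqy => (h y hy).trans (hpq y hy hqy)⟩

theorem isNonsingularAffine_univ (m : ℕ) : IsNonsingularAffine (Set.univ : Set (Fin m → ℂ)) :=
  ⟨⟨∅, by simp⟩, fun z _ => ⟨0, Fin.elim0, 1, fun i => i.elim0, linearIndependent_empty_type,
    by simp, fun _ _ _ => trivial⟩⟩

/-- Linear coordinates on a subspace, extended to the whole space. -/
theorem exists_linear_coordinates {V : Type*} [AddCommGroup V] [Module ℂ V]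
    [FiniteDimensional ℂ V] (L : Submodule ℂ V) :
    ∃ (m : ℕ) (T : V →ₗ[ℂ] (Fin m → ℂ)) (I : (Fin m → ℂ) →ₗ[ℂ] V),
      (∀ w, I w ∈ L) ∧ (∀ w, T (I w) = w) ∧ ∀ x ∈ L, I (T x) = x := by
  let κ := (finBasis ℂ L).equivFun
  obtain ⟨P, hP⟩ := L.subtype.exists_leftInverse_of_injective L.ker_subtype
  have hP' : ∀ x : L, P x = x := fun x => LinearMap.congr_fun hP x
  refine ⟨_, κ.toLinearMap ∘ₗ P, L.subtype ∘ₗ κ.symm.toLinearMap, fun w => (κ.symm w).2,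
    fun w => ?_, fun x hx => ?_⟩
  · simp [hP']
  · simp [hP' ⟨x, hx⟩]

/-- Every point of the orbit space has a Zariski open neighbourhood isomorphic to an affine
space. -/
theorem exists_affine_chart (hF : IsFlagFiltration r F) (y : NonassocHilb E F) :
    ∃ O : Set (NonassocHilb E F), y ∈ O ∧ (NonassocHilb.variety E F).IsZariskiOpen O ∧
      ∃ (m : ℕ) (e : O ≃ (Set.univ : Set (Fin m → ℂ))),
        ((NonassocHilb.variety E F).restrict O).IsIso (quasiAffine Set.univ) e := by
  obtain ⟨ψ₀, rfl⟩ := mk_surjective y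
  obtain ⟨L, O, σ, hO, hL, hσ, hreg⟩ := exists_regular_section hF ψ₀
  obtain ⟨m, T, I, hI, hTI, hIT⟩ := exists_linear_coordinates L
  have hmem : ∀ w, (ψ₀.1 + I w) - ψ₀.1 ∈ L := fun w => by
    rw [add_sub_cancel_left]
    exact hI w
  let lift : ↥(Set.univ : Set (Fin m → ℂ)) → filteredMaps E F := fun w =>
    ⟨ψ₀.1 + I w.1, (hL _ (hmem w.1)).choose⟩
  have hlift : ∀ w, NonassocHilb.mk (lift w) ∈ O ∧ σ (NonassocHilb.mk (lift w)) = (lift w).1 :=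
    fun w => (hL _ (hmem w.1)).choose_spec
  let e : O ≃ (Set.univ : Set (Fin m → ℂ)) :=
    { toFun := fun u => ⟨T (σ u - ψ₀.1), trivial⟩
      invFun := fun w => ⟨NonassocHilb.mk (lift w), (hlift w).1⟩
      left_inv := fun u => by
        obtain ⟨h1, h2, h3⟩ := hσ u u.2
        refine Subtype.ext (Eq.trans ?_ h3)
        dsimp only
        congr 1
        refine Subtype.ext ?_
        simp only [lift, hIT _ h1]
        abel
      right_inv := fun w => by
        refine Subtype.ext ?_
        simp only [(hlift w).2]
        simp only [lift, add_sub_cancel_left, hTI] }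
  refine ⟨O, ?_, hO, _, e, ?_, ?_⟩
  · obtain ⟨h, h1, -⟩ := hL ψ₀.1 (by simp)
    exact h1
  · let e' : filteredMaps E F → (Set.univ : Set (Fin m → ℂ)) := fun ψ =>
      ⟨T (σ (NonassocHilb.mk ψ) - ψ₀.1), trivial⟩
    have he' : ∀ ψ ∈ NonassocHilb.mk ⁻¹' O, LocallyRegularAt (fun ψ => (e' ψ).1) ψ := by
      intro ψ hψ
      obtain ⟨Φ, hΦ, q, hq, hq0, h⟩ := hreg ψ hψ
      exact ⟨fun v => T (Φ v - ψ₀.1), (hΦ.sub (RegularMapAt.const _)).clm T, q, hq, hq0,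
        fun y hy => by simp only [e', h y hy]⟩
    intro U hU
    have himage : NonassocHilb.mk ⁻¹' (Subtype.val '' (e ⁻¹' U)) =
        NonassocHilb.mk ⁻¹' O ∩ e' ⁻¹' U := by
      ext ψ
      constructor
      · rintro ⟨u, hu, h⟩
        refine ⟨(show NonassocHilb.mk ψ ∈ O from h ▸ u.2), ?_⟩
        rw [Set.mem_preimage] at hu ⊢
        convert hu
        simp only [e', e, ← h, Equiv.coe_fn_mk]
      · rintro ⟨h1, h2⟩
        exact ⟨⟨_, h1⟩, h2, rfl⟩
    have h1 : (NonassocHilb.variety E F).IsZariskiOpen (Subtype.val '' (e ⁻¹' U)) := by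
      change (quasiAffine _).IsZariskiOpen (NonassocHilb.mk ⁻¹' (Subtype.val '' (e ⁻¹' U)))
      rw [himage]
      exact isZariskiOpen_inter_preimage he' hO hU
    refine ⟨?_, fun f hf => ?_⟩
    · let _ := (NonassocHilb.variety E F).zariski
      exact ⟨_, h1, Set.preimage_image_eq _ Subtype.val_injective⟩
    · change (quasiAffine _).IsRegularOn (NonassocHilb.mk ⁻¹' (Subtype.val '' (e ⁻¹' U))) _
      rw [himage]
      refine isRegularOn_congr (isRegularOn_comp he' hf) fun ψ hψ => ?_
      have h2 := Subtype.val_injective.extend_apply (f ∘ e) 0 (⟨_, hψ.1⟩ : O)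
      exact h2
  · refine SpaceWithFunctions.isMorphism_restrict hO ?_
    refine (SpaceWithFunctions.isMorphism_quotient (quasiAffine (filteredMaps E F))
      NonassocHilb.mk).comp (φ := lift) (isMorphism_quasiAffine fun w =>
        LocallyRegularAt.of_regularMapAt (Φ := fun v => ψ₀.1 + I v) ?_)
    exact (RegularMapAt.const ψ₀.1).add (RegularMapAt.linearMap I)

theorem isSmoothVariety_nonassocHilb (hF : IsFlagFiltration r F) :
    (NonassocHilb.variety E F).IsSmoothVariety := by
  choose O hy hO m e he using fun y : NonassocHilb E F => exists_affine_chart hF y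
  let _ := classicalTopologyOn (filteredMaps E F)
  let _ := NonassocHilb.classical E F
  have : CompactSpace (NonassocHilb E F) := compactSpace_nonassocHilb hF
  obtain ⟨t, ht⟩ := isCompact_univ.elim_finite_subcover O
    (fun y => isOpen_coinduced.mpr (IsZariskiOpen.isOpen_classical (hO y)))
    (fun y _ => Set.mem_iUnion.mpr ⟨y, hy y⟩)
  refine ⟨t.card, fun i => O (t.equivFin.symm i), ?_, fun i => ⟨hO _, m _, _, e _,
    isNonsingularAffine_univ _, he _⟩⟩
  refine Set.eq_univ_of_forall fun y => ?_
  obtain ⟨z, hz, hyz⟩ := Set.mem_iUnion₂.mp (ht (Set.mem_univ y))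
  exact Set.mem_iUnion.mpr ⟨t.equivFin ⟨z, hz⟩, by simpa using hyz⟩

end Charts

/-! ### The vector bundle `(E ⊕ S_k) / D` -/

section Bundle

variable {E N : Type*} [AddCommGroup E] [Module ℂ E] [AddCommGroup N] [Module ℂ N]
  {F : ℕ → Submodule ℂ N} {r : ℕ}

/-- The space `S_k` consists of the symmetric forms that vanish on `F i × F j` for `i + j > k`. -/
theorem mem_extSpace_iff [FiniteDimensional ℂ N] (hF : IsFlagFiltration r F) {k : ℕ}
    {w : E × LinearMap.BilinForm ℂ N} :
    w ∈ extSpace E F k ↔ (∀ x y, w.2 x y = w.2 y x) ∧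
      ∀ i j, 1 ≤ i → 1 ≤ j → k < i + j → ∀ x ∈ F i, ∀ y ∈ F j, w.2 x y = 0 := by
  obtain ⟨ε, β⟩ := w
  simp only [extSpace, Submodule.mem_prod, Submodule.mem_top, true_and]
  constructor
  · intro h
    induction h using Submodule.span_induction with
    | mem β hβ =>
      obtain ⟨i', j', hi', hj', hij, a, ha, c, hc, rfl⟩ := hβ
      refine ⟨fun x y => by simp [symProd]; ring, fun i j hi hj hk x hx y hy => ?_⟩
      rw [Submodule.mem_dualAnnihilator] at ha hc
      have hac : a x * c y = 0 := by
        by_cases h : i' + 1 ≤ i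
        · rw [ha x (hF.antitone h hx), zero_mul]
        · rw [hc y (hF.antitone (by omega : j' + 1 ≤ j) hy), mul_zero]
      have hca : c x * a y = 0 := by
        by_cases h : j' + 1 ≤ i
        · rw [hc x (hF.antitone h hx), zero_mul]
        · rw [ha y (hF.antitone (by omega : i' + 1 ≤ j) hy), mul_zero]
      simp [symProd, hac, hca]
    | zero => simp
    | add β γ _ _ h1 h2 =>
      exact ⟨fun x y => by simp [h1.1 x y, h2.1 x y], fun i j hi hj hk x hx y hy => by
        simp [h1.2 i j hi hj hk x hx y hy, h2.2 i j hi hj hk x hx y hy]⟩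
    | smul c β _ h1 =>
      exact ⟨fun x y => by simp [h1.1 x y], fun i j hi hj hk x hx y hy => by
        simp [h1.2 i j hi hj hk x hx y hy]⟩
  · rintro ⟨hsymm, hvan⟩
    obtain ⟨b, lev, -, hb⟩ := hF.exists_adapted_basis
    change IsAdapted F b lev at hb
    have hlev : ∀ i, 1 ≤ lev i := by
      intro i
      by_contra h
      have h1 := (hb 1 (b i)).mp (hF.mem_one _) i (by omega)
      simp at h1
    have hβ : β = ∑ i, ∑ j, (β (b i) (b j) * 2⁻¹) • symProd (b.coord i) (b.coord j) := by
      refine b.ext fun p => b.ext fun q => ?_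
      simp only [LinearMap.sum_apply, LinearMap.smul_apply, symProd, LinearMap.add_apply,
        LinearMap.compl₁₂_apply, LinearMap.mul_apply', Basis.coord_apply, Basis.repr_self,
        Finsupp.single_apply, smul_eq_mul, mul_add, Finset.sum_add_distrib]
      simp [Finset.sum_ite_eq, hsymm (b q) (b p)]
      ring
    have hann : ∀ i, b.coord i ∈ (F (lev i + 1)).dualAnnihilator := fun i =>
      (Submodule.mem_dualAnnihilator _).mpr fun x hx => (hb _ _).mp hx i (Nat.lt_succ_self _)
    rw [hβ]
    refine sum_mem fun i _ => sum_mem fun j _ => ?_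
    by_cases hk : lev i + lev j ≤ k
    · exact Submodule.smul_mem _ _ (Submodule.subset_span
        ⟨lev i, lev j, hlev i, hlev j, hk, _, hann i, _, hann j, rfl⟩)
    · rw [hvan _ _ (hlev i) (hlev j) (not_le.mp hk) _ (hb.basis_mem i) _ (hb.basis_mem j),
        zero_mul, zero_smul]
      exact zero_mem _

variable [FiniteDimensional ℂ E]

theorem dualMaps_apply_snd (ψ : StructureMaps E N) (l : Dual ℂ N) (x y : N) :
    (dualMaps ψ l).2 x y = l (ψ.2 x y) := rfl

theorem apply_dualMaps_fst (ψ : StructureMaps E N) (l : Dual ℂ N) (ε : Dual ℂ E) :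
    ε (dualMaps ψ l).1 = l (ψ.1 ε) := by
  simp [dualMaps]

theorem ext_of_dual {w w' : E × LinearMap.BilinForm ℂ N} (h1 : ∀ ε : Dual ℂ E, ε w.1 = ε w'.1)
    (h2 : ∀ x y, w.2 x y = w'.2 x y) : w = w' :=
  Prod.ext (sub_eq_zero.mp ((forall_dual_apply_eq_zero_iff ℂ _).mp fun ε => by
    rw [map_sub, h1, sub_self])) (LinearMap.ext₂ h2)

/-- Dually to surjectivity of `ψ`, the space `D` embeds into `E ⊕ Sym² D`. -/
theorem dualMaps_injective_iff {ψ : StructureMaps E N} :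
    Function.Injective (dualMaps ψ) ↔ Function.Surjective (totalMap ψ) := by
  have key : ∀ l, dualMaps ψ l = 0 ↔ (totalMap ψ).dualMap l = 0 := by
    intro l
    constructor
    · intro hl
      refine LinearMap.prod_ext (LinearMap.ext fun ε => ?_) (TensorProduct.ext' fun x y => ?_)
      · have := apply_dualMaps_fst ψ l ε
        rw [hl] at this
        simpa using this.symm
      · have := dualMaps_apply_snd ψ l x y
        rw [hl] at this
        simpa using this.symm
    · intro hl
      refine ext_of_dual (fun ε => ?_) fun x y => ?_
      · rw [apply_dualMaps_fst]
        simpa using LinearMap.congr_fun hl (ε, 0)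
      · rw [dualMaps_apply_snd]
        simpa using LinearMap.congr_fun hl (0, x ⊗ₜ y)
  rw [← LinearMap.dualMap_injective_iff, injective_iff_map_eq_zero, injective_iff_map_eq_zero]
  simp only [key]

variable [FiniteDimensional ℂ N]

theorem range_dualMaps_le (hF : IsFlagFiltration r F) {ψ : StructureMaps E N}
    (hψ : ψ ∈ filteredSpace E F) {k : ℕ} (hk : r ≤ k) :
    LinearMap.range (dualMaps ψ) ≤ extSpace E F k := by
  rintro _ ⟨l, rfl⟩
  refine (mem_extSpace_iff hF).mpr ⟨fun x y => ?_, fun i j hi hj hij x hx y hy => ?_⟩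
  · rw [dualMaps_apply_snd, dualMaps_apply_snd, hψ.1]
  · have := hψ.2 i j hi hj x hx y hy
    rw [hF.eq_bot (by omega), Submodule.mem_bot] at this
    rw [dualMaps_apply_snd, this, map_zero]

/-- The dual of a structure map, linearly in the structure map. -/
def dualMapsLin : StructureMaps E N →ₗ[ℂ] Dual ℂ N →ₗ[ℂ] E × LinearMap.BilinForm ℂ N where
  toFun := dualMaps
  map_add' ψ φ := LinearMap.ext fun l => Prod.ext
    (by
      change (evalEquiv ℂ E).symm (l ∘ₗ (ψ.1 + φ.1)) =
        (evalEquiv ℂ E).symm (l ∘ₗ ψ.1) + (evalEquiv ℂ E).symm (l ∘ₗ φ.1)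
      rw [LinearMap.comp_add, map_add])
    (LinearMap.ext₂ fun x y => map_add l (ψ.2 x y) (φ.2 x y))
  map_smul' c ψ := LinearMap.ext fun l => Prod.ext
    (by
      change (evalEquiv ℂ E).symm (l ∘ₗ (c • ψ.1)) = c • (evalEquiv ℂ E).symm (l ∘ₗ ψ.1)
      rw [LinearMap.comp_smul, map_smul])
    (LinearMap.ext₂ fun x y => map_smul l c (ψ.2 x y))

/-- A complement of the image of `D` at one point of a section remains a complement on the open
subset where the projection along it restricts to an automorphism of `D`. -/
theorem isLocallyTrivialQuotient (hF : IsFlagFiltration r F) {k : ℕ} (hk : r ≤ k) :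
    IsLocallyTrivialQuotient E F k := by
  intro y
  obtain ⟨ψ₀, rfl⟩ := mk_surjective y
  obtain ⟨L, O, σ, hO, hL, hσ, hreg⟩ := exists_regular_section hF ψ₀
  obtain ⟨h₀, hO₀, hσ₀⟩ := hL ψ₀.1 (by simp)
  have hψ₀ := mem_filteredMaps_iff.mp ψ₀.2
  have hinj := dualMaps_injective_iff.mpr hψ₀.2
  -- a complement of the image of the dual of `ψ₀`, and the projection that it determines
  obtain ⟨C', hC'⟩ := Submodule.exists_isCompl (LinearMap.range (dualMaps ψ₀.1))
  let D₀ : Dual ℂ N ≃ₗ[ℂ] LinearMap.range (dualMaps ψ₀.1) := LinearEquiv.ofInjective _ hinj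
  obtain ⟨P, hP1, hP2⟩ : ∃ P : (E × LinearMap.BilinForm ℂ N) →ₗ[ℂ] Dual ℂ N,
      P ∘ₗ dualMaps ψ₀.1 = LinearMap.id ∧ ∀ w ∈ C', P w = 0 := by
    refine ⟨D₀.symm.toLinearMap ∘ₗ Submodule.projectionOnto _ _ hC', ?_, ?_⟩
    · ext1 l
      have : dualMaps ψ₀.1 l = D₀ l := rfl
      rw [LinearMap.comp_apply, this, LinearMap.comp_apply,
        Submodule.projectionOnto_apply_left]
      simp
    · intro w hw
      rw [LinearMap.comp_apply, (Submodule.projectionOnto_apply_eq_zero_iff hC').mpr hw,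
        map_zero]
  let C := C' ⊓ extSpace E F k
  have hC : finrank ℂ C + finrank ℂ N = finrank ℂ (extSpace E F k) := by
    have hle := range_dualMaps_le hF hψ₀.1 hk
    have h1 : LinearMap.range (dualMaps ψ₀.1) ⊔ C = extSpace E F k :=
      (sup_inf_assoc_of_le C' hle).symm.trans (by rw [hC'.sup_eq_top, top_inf_eq])
    have h2 : LinearMap.range (dualMaps ψ₀.1) ⊓ C = ⊥ := by
      rw [eq_bot_iff, ← hC'.inf_eq_bot]
      exact inf_le_inf_left _ inf_le_left
    have h3 := Submodule.finrank_sup_add_finrank_inf_eq (LinearMap.range (dualMaps ψ₀.1)) C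
    rw [h1, h2, finrank_bot, add_zero, LinearMap.finrank_range_of_inj hinj,
      Subspace.dual_finrank_eq] at h3
    rw [h3, add_comm]
  let U : Set (NonassocHilb E F) := O ∩ {u | IsUnit (P ∘ₗ dualMaps (σ u) : End ℂ (Dual ℂ N))}
  have hU : NonassocHilb.mk ψ₀ ∈ U := by
    refine ⟨hO₀, ?_⟩
    change IsUnit (P ∘ₗ dualMaps (σ (NonassocHilb.mk ψ₀)) : End ℂ (Dual ℂ N))
    rw [hσ₀, hP1]
    exact isUnit_one
  refine ⟨U, σ, C, ?_, hU, fun l => LocallyRegularAt.isRegularOn fun ψ hψ => ?_, fun u hu => ?_⟩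
  · refine quasiAffine_isZariskiOpen_iff.mpr fun φ hφ => ?_
    obtain ⟨p, hp, hp0, hpO⟩ := quasiAffine_isZariskiOpen_iff.mp hO φ hφ.1
    obtain ⟨Φ, hΦ, q, hq, hq0, h⟩ := hreg φ hφ.1
    have h1 : RegularMapAt (fun v => (P ∘ₗ dualMapsLin (Φ v) : End ℂ (Dual ℂ N))) φ.1 :=
      RegularMapAt.of_apply fun w => ((hΦ.clm dualMapsLin).clm (LinearMap.applyₗ w)).clm P
    have h2 : IsUnit (P ∘ₗ dualMapsLin (Φ φ.1) : End ℂ (Dual ℂ N)) := by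
      have h3 : σ (NonassocHilb.mk φ) = Φ φ := h φ hq0
      rw [← h3]
      exact hφ.2
    obtain ⟨q', hq', hq0', hu⟩ := h1.exists_poly_isUnit h2
    refine ⟨p * (q * q'), mul_mem hp (mul_mem hq hq'), mul_ne_zero hp0 (mul_ne_zero hq0 hq0'),
      fun y hy => ⟨hpO y (left_ne_zero_of_mul hy), ?_⟩⟩
    have h3 := right_ne_zero_of_mul hy
    change IsUnit (P ∘ₗ dualMapsLin (σ (NonassocHilb.mk y)) : End ℂ (Dual ℂ N))
    have h4 : σ (NonassocHilb.mk y) = Φ y := h y (left_ne_zero_of_mul h3)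
    rw [h4]
    exact hu y (right_ne_zero_of_mul h3)
  · obtain ⟨Φ, hΦ, q, hq, hq0, h⟩ := hreg ψ hψ.1
    exact ⟨fun v => l (Φ v), fun l' => (hΦ.clm l) l', q, hq, hq0,
      fun y hy => congrArg l (h y hy)⟩
  · obtain ⟨h1, h2, h3⟩ := hσ u hu.1
    have hmem := mem_filteredMaps_iff.mp h2
    have hle := range_dualMaps_le hF hmem.1 hk
    have hdisj : C ⊓ LinearMap.range (dualMaps (σ u)) = ⊥ := by
      rw [eq_bot_iff]
      rintro _ ⟨hw, l, rfl⟩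
      have h4 : (P ∘ₗ dualMaps (σ u)) l = 0 := hP2 _ hw.1
      have h5 := ((End.isUnit_iff _).mp hu.2).1
      have h6 : l = 0 := h5 (h4.trans (map_zero _).symm)
      rw [h6, map_zero]
      exact zero_mem _
    refine ⟨⟨h2, h3⟩, hdisj, Submodule.eq_of_le_of_finrank_eq (sup_le inf_le_right hle) ?_⟩
    have h4 := Submodule.finrank_sup_add_finrank_inf_eq C (LinearMap.range (dualMaps (σ u)))
    rw [hdisj, finrank_bot, add_zero,
      LinearMap.finrank_range_of_inj (dualMaps_injective_iff.mpr hmem.2),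
      Subspace.dual_finrank_eq] at h4
    rw [h4, hC]

end Bundle

/-! ### Structure maps and frames over a quotient -/

section Pairing

variable {E N N' N'' : Type*} [AddCommGroup E] [Module ℂ E] [AddCommGroup N] [Module ℂ N]
  [AddCommGroup N'] [Module ℂ N'] [AddCommGroup N''] [Module ℂ N'']

/-- The pairing of `E ⊕ Bil N` with `E^∨ ⊕ N ⊗ N`. -/
def formPairing (w : E × LinearMap.BilinForm ℂ N) : (Dual ℂ E × N ⊗[ℂ] N) →ₗ[ℂ] ℂ :=
  (Dual.eval ℂ E w.1).coprod (TensorProduct.lift w.2)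

theorem formPairing_dualMaps [FiniteDimensional ℂ E] (ψ : StructureMaps E N) (l : Dual ℂ N) :
    formPairing (dualMaps ψ l) = l ∘ₗ totalMap ψ := by
  refine LinearMap.prod_ext (LinearMap.ext fun ε => ?_) (TensorProduct.ext' fun x y => ?_)
  · simp [formPairing, apply_dualMaps_fst]
  · simp [formPairing, dualMaps_apply_snd]

theorem formPairing_pullExt (f : N →ₗ[ℂ] N') (w : E × LinearMap.BilinForm ℂ N') :
    formPairing (pullExt E f w) = formPairing w ∘ₗ extMap E f := by
  refine LinearMap.prod_ext (LinearMap.ext fun ε => ?_) (TensorProduct.ext' fun x y => ?_)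
  · simp [formPairing, pullExt]
  · simp [formPairing, pullExt, pullForm]
    rfl

theorem pullExt_comp (f : N →ₗ[ℂ] N') (g : N' →ₗ[ℂ] N'') :
    pullExt E (g ∘ₗ f) = pullExt E f ∘ₗ pullExt E g := rfl

theorem pullExt_id : pullExt E (LinearMap.id : N →ₗ[ℂ] N) = LinearMap.id := rfl

theorem pullExt_injective {f : N →ₗ[ℂ] N'} (hf : Function.Surjective f) :
    Function.Injective (pullExt E f) := by
  obtain ⟨s, hs⟩ := f.exists_rightInverse_of_surjective (LinearMap.range_eq_top.mpr hf)
  intro w w' h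
  have h1 := congrArg (pullExt E s) h
  rw [← LinearMap.comp_apply, ← LinearMap.comp_apply, ← pullExt_comp, hs, pullExt_id] at h1
  exact h1

theorem dualMaps_of_isHom [FiniteDimensional ℂ E] {g : N →ₗ[ℂ] N'} {ψ : StructureMaps E N}
    {φ : StructureMaps E N'} (h : IsHom g ψ φ) (l : Dual ℂ N') :
    pullExt E g (dualMaps φ l) = dualMaps ψ (l ∘ₗ g) := by
  obtain ⟨h1, h2⟩ := isHom_iff.mp h
  refine ext_of_dual (fun ε => ?_) fun x y => ?_
  · rw [apply_dualMaps_fst, LinearMap.comp_apply, h1]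
    exact apply_dualMaps_fst φ l ε
  · rw [dualMaps_apply_snd, LinearMap.comp_apply, h2]
    rfl

end Pairing

section Step

variable {E N' N'' : Type*} [AddCommGroup E] [Module ℂ E]
  [AddCommGroup N'] [Module ℂ N'] [AddCommGroup N''] [Module ℂ N''] {d : ℕ}

/-- A splitting of a surjection whose kernel has dimension `d`. -/
theorem exists_splitting [FiniteDimensional ℂ N'] [FiniteDimensional ℂ N''] {q : N' →ₗ[ℂ] N''}
    (hq : Function.Surjective q) (hd : finrank ℂ N' = finrank ℂ N'' + d) :
    ∃ e : N' ≃ₗ[ℂ] N'' × (Fin d → ℂ), ∀ x, (e x).1 = q x := by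
  have hk : finrank ℂ (LinearMap.ker q) = finrank ℂ (Fin d → ℂ) := by
    have h1 := q.finrank_range_add_finrank_ker
    rw [LinearMap.range_eq_top.mpr hq, finrank_top] at h1
    rw [finrank_fin_fun]
    omega
  let κ : LinearMap.ker q ≃ₗ[ℂ] (Fin d → ℂ) := LinearEquiv.ofFinrankEq _ _ hk
  obtain ⟨P, hP⟩ := (LinearMap.ker q).subtype.exists_leftInverse_of_injective
    (LinearMap.ker q).ker_subtype
  have hP' : ∀ x : LinearMap.ker q, P x = x := fun x => LinearMap.congr_fun hP x
  have hinj : Function.Injective (q.prod (κ.toLinearMap ∘ₗ P)) := by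
    rw [injective_iff_map_eq_zero]
    intro x hx
    have hx1 : q x = 0 := congrArg Prod.fst hx
    have h2 : P x = 0 := κ.map_eq_zero_iff.mp (congrArg Prod.snd hx)
    have h3 : P x = ⟨x, hx1⟩ := hP' ⟨x, hx1⟩
    rw [h2] at h3
    exact (congrArg Subtype.val h3).symm
  refine ⟨LinearEquiv.ofInjectiveOfFinrankEq _ hinj (by simp [hd]), fun x => rfl⟩

variable (e : N' ≃ₗ[ℂ] N'' × (Fin d → ℂ))

/-- The projection determined by a splitting. -/
def splitProj : N' →ₗ[ℂ] N'' := LinearMap.fst ℂ _ _ ∘ₗ e.toLinearMap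

/-- The section of the projection determined by a splitting. -/
def splitSection : N'' →ₗ[ℂ] N' := e.symm.toLinearMap ∘ₗ LinearMap.inl ℂ _ _

/-- The coordinates on the kernel determined by a splitting. -/
def splitCoord : N' →ₗ[ℂ] (Fin d → ℂ) := LinearMap.snd ℂ _ _ ∘ₗ e.toLinearMap

@[simp] theorem splitProj_section (x : N'') : splitProj e (splitSection e x) = x := by
  simp [splitProj, splitSection]

theorem splitProj_surjective : Function.Surjective (splitProj e) :=
  fun x => ⟨_, splitProj_section e x⟩

@[simp] theorem splitProj_symm (p : N'' × (Fin d → ℂ)) : splitProj e (e.symm p) = p.1 := by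
  simp [splitProj]

@[simp] theorem splitCoord_symm (p : N'' × (Fin d → ℂ)) : splitCoord e (e.symm p) = p.2 := by
  simp [splitCoord]

theorem split_ext {x y : N'} (h1 : splitProj e x = splitProj e y)
    (h2 : splitCoord e x = splitCoord e y) : x = y :=
  e.injective (Prod.ext h1 h2)

/-- The structure map induced on the quotient, linearly in the structure map. -/
def pushStructure : StructureMaps E N' →ₗ[ℂ] StructureMaps E N'' where
  toFun ψ := (splitProj e ∘ₗ ψ.1,
    (ψ.2.compl₁₂ (splitSection e) (splitSection e)).compr₂ (splitProj e))
  map_add' ψ φ := Prod.ext (by ext; simp) (by ext; simp)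
  map_smul' c ψ := Prod.ext (by ext; simp) (by ext; simp)

/-- The structure map with a given frame, linearly in the frame. -/
def ofFrameLin : (StructureMaps E N'' × ((Fin d → ℂ) →ₗ[ℂ] (E × LinearMap.BilinForm ℂ N'')))
    →ₗ[ℂ] StructureMaps E N' where
  toFun p :=
    (e.symm.toLinearMap ∘ₗ p.1.1.prod (LinearMap.pi fun i => Dual.eval ℂ E (p.2 (Pi.single i 1)).1),
      LinearMap.mk₂ ℂ (fun x y => e.symm (p.1.2 (splitProj e x) (splitProj e y),
        fun i => (p.2 (Pi.single i 1)).2 (splitProj e x) (splitProj e y)))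
        (fun x x' y => by rw [← map_add]; congr 1; ext <;> simp)
        (fun c x y => by rw [← map_smul]; congr 1; ext <;> simp)
        (fun x y y' => by rw [← map_add]; congr 1; ext <;> simp)
        (fun c x y => by rw [← map_smul]; congr 1; ext <;> simp))
  map_add' p p' := Prod.ext
    (LinearMap.ext fun ε => split_ext e (by simp) (by ext; simp))
    (LinearMap.ext₂ fun x y => split_ext e (by simp) (by ext; simp))
  map_smul' c p := Prod.ext
    (LinearMap.ext fun ε => split_ext e (by simp) (by ext; simp))
    (LinearMap.ext₂ fun x y => split_ext e (by simp) (by ext; simp))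

section Apply

variable (p : StructureMaps E N'' × ((Fin d → ℂ) →ₗ[ℂ] (E × LinearMap.BilinForm ℂ N'')))

@[simp] theorem splitProj_ofFrameLin_fst (ε : Dual ℂ E) :
    splitProj e ((ofFrameLin e p).1 ε) = p.1.1 ε := splitProj_symm e _

@[simp] theorem splitCoord_ofFrameLin_fst (ε : Dual ℂ E) (i : Fin d) :
    splitCoord e ((ofFrameLin e p).1 ε) i = ε (p.2 (Pi.single i 1)).1 :=
  congrFun (splitCoord_symm e _) i

@[simp] theorem splitProj_ofFrameLin_snd (x y : N') :
    splitProj e ((ofFrameLin e p).2 x y) = p.1.2 (splitProj e x) (splitProj e y) :=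
  splitProj_symm e _

@[simp] theorem splitCoord_ofFrameLin_snd (x y : N') (i : Fin d) :
    splitCoord e ((ofFrameLin e p).2 x y) i =
      (p.2 (Pi.single i 1)).2 (splitProj e x) (splitProj e y) :=
  congrFun (splitCoord_symm e _) i

end Apply

/-- The bilinear part of a structure map factors through the projection. -/
def FactorsThrough (ψ : StructureMaps E N') : Prop :=
  ∀ x y, ψ.2 (splitSection e (splitProj e x)) (splitSection e (splitProj e y)) = ψ.2 x y

section Factors

variable {e} {ψ : StructureMaps E N'}

theorem factorsThrough_ofFrameLin
    (p : StructureMaps E N'' × ((Fin d → ℂ) →ₗ[ℂ] (E × LinearMap.BilinForm ℂ N''))) :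
    FactorsThrough e (ofFrameLin e p) :=
  fun x y => split_ext e (by simp) (by ext; simp)

theorem FactorsThrough.isHom (h : FactorsThrough e ψ) :
    IsHom (splitProj e) ψ (pushStructure e ψ) :=
  isHom_iff.mpr ⟨fun _ => rfl, fun x y => congrArg (splitProj e) (h x y).symm⟩

/-- If `ψ` factors through the projection, then `ψ ∘ (1 ⊕ g ⊗ g)` depends on `g` only modulo the
kernel of the projection. -/
theorem FactorsThrough.congr (h : FactorsThrough e ψ) {M : Type*} [AddCommGroup M] [Module ℂ M]
    {g g' : M →ₗ[ℂ] N'} (hg : ∀ x, splitProj e (g x) = splitProj e (g' x)) :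
    totalMap ψ ∘ₗ extMap E g = totalMap ψ ∘ₗ extMap E g' := by
  refine LinearMap.prod_ext (LinearMap.ext fun ε => by simp) (TensorProduct.ext' fun x y => ?_)
  have h1 := h (g x) (g y)
  rw [hg, hg, h] at h1
  simpa using h1.symm

end Factors

variable [FiniteDimensional ℂ E]

/-- The dual of a structure map, as a map to forms on the quotient. -/
def dualToBase (ψ : StructureMaps E N') : Dual ℂ N' →ₗ[ℂ] E × LinearMap.BilinForm ℂ N'' :=
  pullExt E (splitSection e) ∘ₗ dualMaps ψ

theorem apply_dualToBase_fst (ψ : StructureMaps E N') (l : Dual ℂ N') (ε : Dual ℂ E) :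
    ε (dualToBase e ψ l).1 = l (ψ.1 ε) := apply_dualMaps_fst ψ l ε

theorem dualToBase_apply_snd (ψ : StructureMaps E N') (l : Dual ℂ N') (x y : N'') :
    (dualToBase e ψ l).2 x y = l (ψ.2 (splitSection e x) (splitSection e y)) := rfl

/-- The frame of a structure map: the images of the coordinates on the kernel of the projection,
linearly in the structure map. -/
def toFrame : StructureMaps E N' →ₗ[ℂ]
    StructureMaps E N'' × ((Fin d → ℂ) →ₗ[ℂ] (E × LinearMap.BilinForm ℂ N'')) :=
  (pushStructure e).prod (LinearMap.lcomp ℂ _ ((splitCoord e).dualMap ∘ₗ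
    (Pi.basisFun ℂ (Fin d)).toDual) ∘ₗ
    (LinearMap.compRight ℂ (pullExt E (splitSection e))) ∘ₗ dualMapsLin)

theorem toFrame_snd_apply (ψ : StructureMaps E N') (v : Fin d → ℂ) :
    (toFrame e ψ).2 v =
      dualToBase e ψ ((Pi.basisFun ℂ (Fin d)).toDual v ∘ₗ splitCoord e) := rfl

theorem toFrame_snd_single (ψ : StructureMaps E N') (i : Fin d) :
    (toFrame e ψ).2 (Pi.single i 1) = dualToBase e ψ (LinearMap.proj i ∘ₗ splitCoord e) := by
  rw [toFrame_snd_apply]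
  congr 2
  refine LinearMap.ext fun v => ?_
  rw [← Pi.basisFun_apply ℂ, Basis.toDual_apply_right]
  simp

theorem toFrame_ofFrameLin
    (p : StructureMaps E N'' × ((Fin d → ℂ) →ₗ[ℂ] (E × LinearMap.BilinForm ℂ N''))) :
    toFrame e (ofFrameLin e p) = p := by
  refine Prod.ext (Prod.ext ?_ ?_) ?_
  · ext ε
    simp [toFrame, pushStructure]
  · ext x y
    simp [toFrame, pushStructure]
  · refine LinearMap.pi_ext' fun i => LinearMap.ext_ring ?_
    rw [LinearMap.comp_apply, LinearMap.comp_apply, LinearMap.single_apply, toFrame_snd_single]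
    refine ext_of_dual (fun ε => ?_) fun x y => ?_
    · rw [apply_dualToBase_fst]
      simp
    · rw [dualToBase_apply_snd]
      simp

variable {e} {ψ : StructureMaps E N'}

theorem FactorsThrough.ofFrameLin_toFrame (h : FactorsThrough e ψ) :
    ofFrameLin e (toFrame e ψ) = ψ := by
  refine Prod.ext (LinearMap.ext fun ε => split_ext e ?_ ?_)
    (LinearMap.ext₂ fun x y => split_ext e ?_ ?_)
  · rw [splitProj_ofFrameLin_fst]
    rfl
  · ext i
    rw [splitCoord_ofFrameLin_fst, toFrame_snd_single, apply_dualToBase_fst]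
    rfl
  · rw [splitProj_ofFrameLin_snd, ← h x y]
    rfl
  · ext i
    rw [splitCoord_ofFrameLin_snd, toFrame_snd_single, dualToBase_apply_snd, h x y]
    rfl

theorem FactorsThrough.pullExt_dualToBase (h : FactorsThrough e ψ) (l : Dual ℂ N') :
    pullExt E (splitProj e) (dualToBase e ψ l) = dualMaps ψ l :=
  ext_of_dual (fun _ => rfl) fun x y => congrArg l (h x y)

theorem FactorsThrough.dualToBase_comp (h : FactorsThrough e ψ) (l : Dual ℂ N'') :
    dualToBase e ψ (l ∘ₗ splitProj e) = dualMaps (pushStructure e ψ) l := by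
  apply pullExt_injective (splitProj_surjective e)
  rw [h.pullExt_dualToBase, dualMaps_of_isHom h.isHom]

/-- The frame of `ψ` and the space `D` of the quotient together span the dual of `ψ`. -/
theorem FactorsThrough.range_dualToBase (h : FactorsThrough e ψ) :
    LinearMap.range (toFrame e ψ).2 ⊔ LinearMap.range (dualMaps (toFrame e ψ).1) =
      LinearMap.range (dualToBase e ψ) := by
  refine le_antisymm (sup_le ?_ ?_) ?_
  · rintro _ ⟨v, rfl⟩
    exact ⟨_, rfl⟩
  · rintro _ ⟨l, rfl⟩
    exact ⟨_, h.dualToBase_comp l⟩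
  · rintro _ ⟨l, rfl⟩
    set a : Dual ℂ N'' := l ∘ₗ splitSection e
    set b : Fin d → ℂ := (Pi.basisFun ℂ (Fin d)).toDualEquiv.symm
      (l ∘ₗ e.symm.toLinearMap ∘ₗ LinearMap.inr ℂ _ _)
    have hb : (Pi.basisFun ℂ (Fin d)).toDual b =
        l ∘ₗ e.symm.toLinearMap ∘ₗ LinearMap.inr ℂ N'' (Fin d → ℂ) :=
      (Pi.basisFun ℂ (Fin d)).toDualEquiv.apply_symm_apply _
    have hl : l = (Pi.basisFun ℂ (Fin d)).toDual b ∘ₗ splitCoord e + a ∘ₗ splitProj e := by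
      refine LinearMap.ext fun x => ?_
      obtain ⟨⟨u, v⟩, rfl⟩ := e.symm.surjective x
      rw [hb]
      simp only [LinearMap.add_apply, LinearMap.comp_apply, splitCoord_symm, splitProj_symm, a,
        splitSection, LinearEquiv.coe_coe, LinearMap.inl_apply, LinearMap.inr_apply]
      rw [← map_add, ← map_add]
      simp
    rw [hl, map_add]
    exact Submodule.add_mem_sup ⟨b, toFrame_snd_apply e ψ b⟩ ⟨a, (h.dualToBase_comp a).symm⟩

end Step

/-! ### The orbit space as a Grassmann bundle -/

section GrassmannStep

variable {E N' N'' : Type*} [AddCommGroup E] [Module ℂ E]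
  [AddCommGroup N'] [Module ℂ N'] [AddCommGroup N''] [Module ℂ N''] {d k : ℕ}
  {F' : ℕ → Submodule ℂ N'} {F'' : ℕ → Submodule ℂ N''} {e : N' ≃ₗ[ℂ] N'' × (Fin d → ℂ)}

/-- The projection of the splitting `e` is the quotient by the last nonzero step `F' (k + 1)` of a
filtration `F'` of length `k + 1`, and `F''` is the filtration induced on the quotient. -/
structure IsFlagStep (k : ℕ) (F' : ℕ → Submodule ℂ N') (F'' : ℕ → Submodule ℂ N'')
    (e : N' ≃ₗ[ℂ] N'' × (Fin d → ℂ)) : Prop where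
  total : IsFlagFiltration (k + 1) F'
  base : IsFlagFiltration k F''
  map_eq : ∀ i, (F' i).map (splitProj e) = F'' i
  mem_of_proj_eq_zero : ∀ x, splitProj e x = 0 → x ∈ F' (k + 1)

namespace IsFlagStep

theorem proj_mem (h : IsFlagStep k F' F'' e) {i : ℕ} {x : N'} (hx : x ∈ F' i) :
    splitProj e x ∈ F'' i := h.map_eq i ▸ Submodule.mem_map_of_mem hx

theorem exists_lift (h : IsFlagStep k F' F'' e) {i : ℕ} {x : N''} (hx : x ∈ F'' i) :
    ∃ y ∈ F' i, splitProj e y = x := by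
  rwa [← h.map_eq i] at hx

theorem mem_of_proj_mem (h : IsFlagStep k F' F'' e) {i : ℕ} (hi : i ≤ k + 1) {x : N'}
    (hx : splitProj e x ∈ F'' i) : x ∈ F' i := by
  obtain ⟨y, hy, hxy⟩ := h.exists_lift hx
  have h1 : x - y ∈ F' (k + 1) := h.mem_of_proj_eq_zero _ (by rw [map_sub, hxy, sub_self])
  simpa using add_mem (h.total.antitone hi h1) hy

/-- An endomorphism preserves the filtration as soon as it does so after projection: up to the
step `k + 1` the filtration is determined by its projection, and above it is zero. -/
theorem apply_mem (h : IsFlagStep k F' F'' e) {g : N' →ₗ[ℂ] N'}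
    (hg : ∀ i, ∀ x ∈ F' i, splitProj e (g x) ∈ F'' i) : ∀ i, ∀ x ∈ F' i, g x ∈ F' i := by
  intro i x hx
  by_cases hi : i ≤ k + 1
  · exact h.mem_of_proj_mem hi (hg i x hx)
  · have h1 := h.total.eq_bot (by omega : k + 1 + 1 ≤ i)
    rw [h1, Submodule.mem_bot] at hx
    rw [hx, map_zero]
    exact zero_mem _

theorem factorsThrough (h : IsFlagStep k F' F'' e) {ψ : StructureMaps E N'}
    (hψ : ψ ∈ filteredSpace E F') : FactorsThrough e ψ := by
  have key : ∀ z y, splitProj e z = 0 → ψ.2 z y = 0 := fun z y hz => by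
    have := hψ.2 (k + 1) 1 (by omega) le_rfl z (h.mem_of_proj_eq_zero z hz) y (h.total.mem_one y)
    rwa [h.total.last, Submodule.mem_bot] at this
  have key' : ∀ z x y, splitProj e z = splitProj e x → ψ.2 z y = ψ.2 x y := fun z x y hz => by
    rw [← sub_eq_zero, ← LinearMap.sub_apply, ← map_sub]
    exact key _ _ (by rw [map_sub, hz, sub_self])
  intro x y
  rw [key' _ x _ (splitProj_section e _), hψ.1, key' _ y _ (splitProj_section e _), hψ.1]

theorem pushStructure_mem (h : IsFlagStep k F' F'' e) {ψ : StructureMaps E N'}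
    (hψ : ψ ∈ filteredMaps E F') : pushStructure e ψ ∈ filteredMaps E F'' := by
  rw [mem_filteredMaps_iff] at hψ ⊢
  have hq := (h.factorsThrough hψ.1).isHom
  refine ⟨⟨fun x y => congrArg (splitProj e) (hψ.1.1 _ _), fun i j hi hj x hx y hy => ?_⟩, ?_⟩
  · obtain ⟨x, hx', rfl⟩ := h.exists_lift hx
    obtain ⟨y, hy', rfl⟩ := h.exists_lift hy
    rw [← (isHom_iff.mp hq).2]
    exact h.proj_mem (hψ.1.2 i j hi hj x hx' y hy')
  · have h1 : Function.Surjective (splitProj e ∘ₗ totalMap ψ) :=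
      (splitProj_surjective e).comp hψ.2
    rw [hq] at h1
    exact Function.Surjective.of_comp h1

variable [FiniteDimensional ℂ E] [FiniteDimensional ℂ N'']

theorem toFrame_mem (h : IsFlagStep k F' F'' e) {ψ : StructureMaps E N'}
    (hψ : ψ ∈ filteredMaps E F') : toFrame e ψ ∈ grassmannFrames E F'' (k + 1) d := by
  have hψ' := mem_filteredMaps_iff.mp hψ
  have hfac := h.factorsThrough hψ'.1
  refine ⟨h.pushStructure_mem hψ, ?_, ?_⟩
  · rw [hfac.range_dualToBase]
    rintro _ ⟨l, rfl⟩
    refine (mem_extSpace_iff h.base).mpr ⟨fun x y => congrArg l (hψ'.1.1 _ _),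
      fun i j hi hj hij x hx y hy => ?_⟩
    obtain ⟨x, hx', rfl⟩ := h.exists_lift hx
    obtain ⟨y, hy', rfl⟩ := h.exists_lift hy
    have h1 := hψ'.1.2 i j hi hj x hx' y hy'
    rw [h.total.eq_bot (by omega), Submodule.mem_bot] at h1
    rw [dualToBase_apply_snd, hfac x y, h1, map_zero]
  · have hinj : Function.Injective (dualToBase e ψ) := by
      refine Function.Injective.of_comp (f := pullExt E (splitProj e)) ?_
      rw [show pullExt E (splitProj e) ∘ dualToBase e ψ = dualMaps ψ from
        funext hfac.pullExt_dualToBase]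
      exact dualMaps_injective_iff.mpr hψ'.2
    rw [hfac.range_dualToBase, LinearMap.finrank_range_of_inj hinj, Subspace.dual_finrank_eq,
      e.finrank_eq]
    simp

theorem ofFrameLin_mem (h : IsFlagStep k F' F'' e)
    {p : StructureMaps E N'' × ((Fin d → ℂ) →ₗ[ℂ] (E × LinearMap.BilinForm ℂ N''))}
    (hp : p ∈ grassmannFrames E F'' (k + 1) d) : ofFrameLin e p ∈ filteredMaps E F' := by
  have : FiniteDimensional ℂ N' := e.symm.finiteDimensional
  obtain ⟨hp1, hp2, hp3⟩ := hp
  rw [mem_filteredMaps_iff] at hp1 ⊢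
  have hw : ∀ v, p.2 v ∈ extSpace E F'' (k + 1) := fun v =>
    hp2 (Submodule.mem_sup_left (LinearMap.mem_range_self _ v))
  have hw' := fun v => (mem_extSpace_iff h.base).mp (hw v)
  have hfac : FactorsThrough e (ofFrameLin e p) := factorsThrough_ofFrameLin p
  refine ⟨⟨fun x y => split_ext e ?_ ?_, fun i j hi hj x hx y hy => ?_⟩, ?_⟩
  · rw [splitProj_ofFrameLin_snd, splitProj_ofFrameLin_snd, hp1.1.1]
  · ext i
    rw [splitCoord_ofFrameLin_snd, splitCoord_ofFrameLin_snd, (hw' _).1]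
  · have h1 := hp1.1.2 i j hi hj _ (h.proj_mem hx) _ (h.proj_mem hy)
    rw [← splitProj_ofFrameLin_snd] at h1
    by_cases hij : i + j ≤ k + 1
    · exact h.mem_of_proj_mem hij h1
    · rw [h.base.eq_bot (by omega), Submodule.mem_bot] at h1
      have h2 : (ofFrameLin e p).2 x y = 0 := by
        refine split_ext e (by rw [h1, map_zero]) ?_
        ext l
        rw [splitCoord_ofFrameLin_snd, (hw' _).2 i j hi hj (by omega) _ (h.proj_mem hx) _
          (h.proj_mem hy)]
        simp
      rw [h2]
      exact zero_mem _
  · rw [← dualMaps_injective_iff, show ⇑(dualMaps (ofFrameLin e p)) =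
      pullExt E (splitProj e) ∘ dualToBase e (ofFrameLin e p) from
        funext fun l => (hfac.pullExt_dualToBase l).symm]
    refine (pullExt_injective (splitProj_surjective e)).comp ?_
    have h1 := hfac.range_dualToBase
    rw [toFrame_ofFrameLin] at h1
    rw [h1] at hp3
    have h2 := (dualToBase e (ofFrameLin e p)).finrank_range_add_finrank_ker
    rw [hp3, Subspace.dual_finrank_eq, e.finrank_eq] at h2
    rw [← LinearMap.ker_eq_bot, ← Submodule.finrank_eq_zero]
    simpa using h2

end IsFlagStep

/-- The pair of a structure and a subspace spanned by a frame. -/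
def framePair [FiniteDimensional ℂ E] (x : grassmannFrames E F'' k d) : GrassmannPairs E F'' k d :=
  ⟨(⟨x.1.1, x.2.1⟩, LinearMap.range x.1.2 ⊔ LinearMap.range (dualMaps x.1.1)),
    le_sup_right, x.2.2⟩

/-- Every subspace in the Grassmann bundle is spanned by a frame. -/
theorem framePair_surjective [FiniteDimensional ℂ E] [FiniteDimensional ℂ N''] :
    Function.Surjective (framePair : grassmannFrames E F'' k d → GrassmannPairs E F'' k d) := by
  rintro ⟨⟨φ, W⟩, hDW, hW, hd⟩
  set D := LinearMap.range (dualMaps φ.1)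
  have hD : finrank ℂ D = finrank ℂ N'' := by
    rw [LinearMap.finrank_range_of_inj (dualMaps_injective_iff.mpr
      (mem_filteredMaps_iff.mp φ.2).2), Subspace.dual_finrank_eq]
  obtain ⟨C, hsup, hinf⟩ : ∃ C, C ⊔ D = W ∧ C ⊓ D = ⊥ := by
    obtain ⟨C', hC'⟩ := Submodule.exists_isCompl D
    refine ⟨C' ⊓ W, ?_, ?_⟩
    · rw [sup_comm, ← sup_inf_assoc_of_le C' hDW, hC'.sup_eq_top, top_inf_eq]
    · rw [eq_bot_iff, ← hC'.inf_eq_bot]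
      exact fun x hx => ⟨hx.2, hx.1.1⟩
  have hC : finrank ℂ (Fin d → ℂ) = finrank ℂ C := by
    have h1 := Submodule.finrank_sup_add_finrank_inf_eq C D
    rw [hsup, hinf, finrank_bot] at h1
    simp only at hd
    rw [finrank_fin_fun]
    omega
  have : Module.Free ℂ C := Module.Free.of_divisionRing ℂ C
  have κ : (Fin d → ℂ) ≃ₗ[ℂ] C := LinearEquiv.ofFinrankEq _ _ hC
  let w : (Fin d → ℂ) →ₗ[ℂ] (E × LinearMap.BilinForm ℂ N'') := C.subtype ∘ₗ κ.toLinearMap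
  have hw : LinearMap.range w ⊔ D = W := by
    rw [LinearMap.range_comp, LinearEquiv.range, Submodule.map_top, Submodule.range_subtype, hsup]
  refine ⟨⟨(φ.1, w), φ.2, ?_, ?_⟩, Subtype.ext (Prod.ext rfl hw)⟩
  · exact hw.le.trans hW
  · exact (congrArg (fun S : Submodule ℂ _ => finrank ℂ S) hw).trans hd

namespace IsFlagStep

variable [FiniteDimensional ℂ E] [FiniteDimensional ℂ N'']

/-- Isomorphic structures have equivalent frames. -/
theorem ofFrame_eq_of_mk_eq (h : IsFlagStep k F' F'' e) {ψ ψ' : filteredMaps E F'}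
    (hψ : NonassocHilb.mk ψ = NonassocHilb.mk ψ') :
    GrassmannBundle.ofFrame ⟨toFrame e ψ.1, h.toFrame_mem ψ.2⟩ =
      GrassmannBundle.ofFrame ⟨toFrame e ψ'.1, h.toFrame_mem ψ'.2⟩ := by
  obtain ⟨g, hgF, hg⟩ := mk_eq_mk_iff.mp hψ
  have hfac := h.factorsThrough (mem_filteredMaps_iff.mp ψ.2).1
  have hfac' := h.factorsThrough (mem_filteredMaps_iff.mp ψ'.2).1
  set q := splitProj e
  set γ : N'' →ₗ[ℂ] N'' := q ∘ₗ (g : N' →ₗ[ℂ] N') ∘ₗ splitSection e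
  have hγ : γ ∘ₗ q = q ∘ₗ (g : N' →ₗ[ℂ] N') := by
    refine LinearMap.ext fun x => sub_eq_zero.mp ?_
    have h1 : g (splitSection e (q x) - x) ∈ F' (k + 1) :=
      flagGL_apply_mem hgF (h.mem_of_proj_eq_zero _ (by simp [q]))
    have h2 := h.proj_mem h1
    rw [h.base.last, Submodule.mem_bot, map_sub, map_sub] at h2
    exact h2
  have hγ' : ∀ x, γ (q x) = q (g x) := fun x => LinearMap.congr_fun hγ x
  have hhom : IsHom γ (pushStructure e ψ.1) (pushStructure e ψ'.1) := by
    obtain ⟨h1, h2⟩ := isHom_iff.mp hfac.isHom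
    obtain ⟨h3, h4⟩ := isHom_iff.mp hfac'.isHom
    obtain ⟨h5, h6⟩ := isHom_iff.mp hg
    refine isHom_iff.mpr ⟨fun ε => ?_, fun x y => ?_⟩
    · rw [← h1, hγ' (ψ.1.1 ε), ← h3, ← h5]
      rfl
    · obtain ⟨x, rfl⟩ := splitProj_surjective e x
      obtain ⟨y, rfl⟩ := splitProj_surjective e y
      rw [← h2, hγ' (ψ.1.2 x y), hγ' x, hγ' y, ← h4, ← LinearEquiv.coe_coe, h6]
  have hs := hhom.surjective h.base (h.pushStructure_mem ψ'.2)
  set G : N'' ≃ₗ[ℂ] N'' := LinearEquiv.ofBijective γ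
    ⟨LinearMap.injective_iff_surjective.mpr hs, hs⟩
  have hGγ : (G : N'' →ₗ[ℂ] N'') = γ := rfl
  have hG : G ∈ flagGL F'' := mem_flagGL_of_map_le fun i x hx => by
    obtain ⟨x, hx', rfl⟩ := h.exists_lift hx
    exact (hγ' x).symm ▸ h.proj_mem (flagGL_apply_mem hgF hx')
  have hW : (LinearMap.range (dualToBase e ψ'.1)).map (pullExt E γ) =
      LinearMap.range (dualToBase e ψ.1) := by
    apply Submodule.map_injective_of_injective (f := pullExt E q)
      (pullExt_injective (splitProj_surjective e))
    rw [← LinearMap.range_comp (dualToBase e ψ.1), ← Submodule.map_comp, ← pullExt_comp, hγ,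
      pullExt_comp, Submodule.map_comp, ← LinearMap.range_comp,
      show pullExt E q ∘ₗ dualToBase e ψ'.1 = dualMaps ψ'.1 from
        LinearMap.ext hfac'.pullExt_dualToBase,
      show pullExt E q ∘ₗ dualToBase e ψ.1 = dualMaps ψ.1 from
        LinearMap.ext hfac.pullExt_dualToBase, ← LinearMap.range_comp,
      show pullExt E (g : N' →ₗ[ℂ] N') ∘ₗ dualMaps ψ'.1 =
        dualMaps ψ.1 ∘ₗ g.dualMap.toLinearMap from LinearMap.ext fun l => dualMaps_of_isHom hg l,
      LinearMap.range_comp, LinearEquiv.range, Submodule.map_top]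
  refine Quot.sound ⟨⟨G, hG⟩, Subtype.ext (transport_eq_iff.mpr hhom).symm, ?_⟩
  change LinearMap.range (toFrame e ψ'.1).2 ⊔ LinearMap.range (dualMaps (toFrame e ψ'.1).1) =
    (LinearMap.range (toFrame e ψ.1).2 ⊔ LinearMap.range (dualMaps (toFrame e ψ.1).1)).map
      (pullExt E (G.symm : N'' →ₗ[ℂ] N''))
  rw [hfac.range_dualToBase, hfac'.range_dualToBase, ← hW, ← Submodule.map_comp, ← pullExt_comp,
    ← hGγ, LinearEquiv.comp_symm, pullExt_id, Submodule.map_id]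

/-- Equivalent frames define isomorphic structures. -/
theorem mk_eq_of_framePair (h : IsFlagStep k F' F'' e)
    {x x' : grassmannFrames E F'' (k + 1) d} (g : flagGL F'')
    (h1 : (framePair x').1.1 = g • (framePair x).1.1)
    (h2 : (framePair x').1.2 =
      (framePair x).1.2.map (pullExt E ((g⁻¹ : flagGL F'').1 : N'' →ₗ[ℂ] N''))) :
    NonassocHilb.mk ⟨ofFrameLin e x.1, h.ofFrameLin_mem x.2⟩ =
      NonassocHilb.mk ⟨ofFrameLin e x'.1, h.ofFrameLin_mem x'.2⟩ := by
  have : FiniteDimensional ℂ N' := e.symm.finiteDimensional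
  set ψ := ofFrameLin e x.1 with hψ
  set ψ' := ofFrameLin e x'.1 with hψ'
  set γ : N'' →ₗ[ℂ] N'' := (g.1 : N'' →ₗ[ℂ] N'')
  have hfac : FactorsThrough e ψ := factorsThrough_ofFrameLin x.1
  have hfac' : FactorsThrough e ψ' := factorsThrough_ofFrameLin x'.1
  have hx : (framePair x).1.2 = LinearMap.range (dualToBase e ψ) := by
    rw [← hfac.range_dualToBase, toFrame_ofFrameLin]
    rfl
  have hx' : (framePair x').1.2 = LinearMap.range (dualToBase e ψ') := by
    rw [← hfac'.range_dualToBase, toFrame_ofFrameLin]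
    rfl
  have hpush : pushStructure e ψ = x.1.1 := congrArg Prod.fst (toFrame_ofFrameLin e x.1)
  have hpush' : pushStructure e ψ' = x'.1.1 := congrArg Prod.fst (toFrame_ofFrameLin e x'.1)
  have hbase : IsHom γ (pushStructure e ψ) (pushStructure e ψ') := by
    rw [hpush, hpush']
    exact transport_eq_iff.mp (congrArg Subtype.val h1).symm
  have hW : ∀ l, ∃ m, pullExt E γ (dualToBase e ψ' l) = dualToBase e ψ m := by
    intro l
    have h3 : dualToBase e ψ' l ∈ (framePair x').1.2 := hx' ▸ LinearMap.mem_range_self _ l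
    rw [h2, hx] at h3
    obtain ⟨_, ⟨m, rfl⟩, h3⟩ := h3
    refine ⟨m, ?_⟩
    rw [← h3, ← LinearMap.comp_apply, ← pullExt_comp,
      show ((g⁻¹ : flagGL F'').1 : N'' →ₗ[ℂ] N'') ∘ₗ γ = LinearMap.id from
        LinearEquiv.symm_comp g.1, pullExt_id, LinearMap.id_apply]
  -- The morphism `g'` is the descent of `T` along the surjection `totalMap ψ`.
  set T := totalMap ψ' ∘ₗ extMap E (splitSection e ∘ₗ γ ∘ₗ splitProj e)
  have hker : ∀ t, totalMap ψ t = 0 → T t = 0 := by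
    intro t ht
    refine (forall_dual_apply_eq_zero_iff ℂ _).mp fun l => ?_
    obtain ⟨m, hm⟩ := hW l
    change (l ∘ₗ totalMap ψ') (extMap E (splitSection e ∘ₗ γ ∘ₗ splitProj e) t) = 0
    rw [← formPairing_dualMaps, ← LinearMap.comp_apply, ← formPairing_pullExt, pullExt_comp,
      pullExt_comp]
    change formPairing (pullExt E (splitProj e) (pullExt E γ (dualToBase e ψ' l))) t = 0
    rw [hm, hfac.pullExt_dualToBase, formPairing_dualMaps, LinearMap.comp_apply, ht, map_zero]
  have hsurj := (mem_filteredMaps_iff.mp (h.ofFrameLin_mem x.2)).2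
  obtain ⟨σ, hσ⟩ := (totalMap ψ).exists_rightInverse_of_surjective
    (LinearMap.range_eq_top.mpr hsurj)
  set g' : N' →ₗ[ℂ] N' := T ∘ₗ σ
  have hg' : g' ∘ₗ totalMap ψ = T := by
    refine LinearMap.ext fun t => sub_eq_zero.mp ?_
    have h3 : totalMap ψ (σ (totalMap ψ t)) = totalMap ψ t := LinearMap.congr_fun hσ _
    have h4 := hker (σ (totalMap ψ t) - t) (by rw [map_sub, h3, sub_self])
    rw [map_sub] at h4
    exact h4
  have hproj : ∀ y, splitProj e (g' y) = γ (splitProj e y) := by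
    have h3 : splitProj e ∘ₗ T = γ ∘ₗ splitProj e ∘ₗ totalMap ψ := by
      calc splitProj e ∘ₗ T
          = totalMap (pushStructure e ψ') ∘ₗ extMap E (γ ∘ₗ splitProj e) := by
            rw [← LinearMap.comp_assoc, hfac'.isHom, LinearMap.comp_assoc, ← extMap_comp]
            congr 2
            ext y
            simp
        _ = (γ ∘ₗ totalMap (pushStructure e ψ)) ∘ₗ extMap E (splitProj e) := by
            rw [hbase, extMap_comp, LinearMap.comp_assoc]
        _ = γ ∘ₗ splitProj e ∘ₗ totalMap ψ := by rw [LinearMap.comp_assoc, ← hfac.isHom]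
    intro y
    obtain ⟨t, rfl⟩ := hsurj y
    exact (congrArg (splitProj e) (LinearMap.congr_fun hg' t)).trans (LinearMap.congr_fun h3 t)
  have hhom : IsHom g' ψ ψ' := by
    rw [IsHom, hg']
    refine hfac'.congr fun y => ?_
    rw [hproj]
    simp
  refine mk_eq_mk_of_isHom h.total hhom (h.apply_mem fun i y hy => ?_)
  rw [hproj]
  exact flagGL_apply_mem g.2 (h.proj_mem hy)

/-- The bijection between the orbit space of a filtered space and the Grassmann bundle over the
orbit space of its quotient by the last step. The inverse takes a pair to the structure map of any
frame of it. -/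
def grassmannEquiv (h : IsFlagStep k F' F'' e) :
    NonassocHilb E F' ≃ GrassmannBundle E F'' (k + 1) d where
  toFun := Quotient.lift (fun ψ => GrassmannBundle.ofFrame ⟨toFrame e ψ.1, h.toFrame_mem ψ.2⟩)
    fun _ _ hψ => h.ofFrame_eq_of_mk_eq (Quotient.sound hψ)
  invFun := Quot.lift
    (fun p => NonassocHilb.mk ⟨ofFrameLin e (framePair_surjective p).choose.1,
      h.ofFrameLin_mem (framePair_surjective p).choose.2⟩)
    fun p p' ⟨g, h1, h2⟩ => h.mk_eq_of_framePair g
      (by simpa only [(framePair_surjective _).choose_spec] using h1)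
      (by simpa only [(framePair_surjective _).choose_spec] using h2)
  left_inv y := by
    obtain ⟨ψ, rfl⟩ := mk_surjective y
    set x : grassmannFrames E F'' (k + 1) d := ⟨toFrame e ψ.1, h.toFrame_mem ψ.2⟩
    set x' := (framePair_surjective (framePair x)).choose
    have hx : framePair x' = framePair x := (framePair_surjective (framePair x)).choose_spec
    refine (h.mk_eq_of_framePair (x := x') (x' := x) 1 ?_ ?_).trans ?_
    · rw [hx, one_smul]
    · rw [hx]
      exact (Submodule.map_id _).symm
    · congr 1
      exact Subtype.ext
        (h.factorsThrough (mem_filteredMaps_iff.mp ψ.2).1).ofFrameLin_toFrame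
  right_inv y := by
    obtain ⟨p, rfl⟩ := Quot.exists_rep y
    set x := (framePair_surjective p).choose
    have hx : framePair x = p := (framePair_surjective p).choose_spec
    change GrassmannBundle.ofFrame ⟨toFrame e (ofFrameLin e x.1), _⟩ = _
    simp only [toFrame_ofFrameLin]
    exact congrArg (Quot.mk _) hx

theorem grassmannEquiv_mk (h : IsFlagStep k F' F'' e) (ψ : filteredMaps E F') :
    h.grassmannEquiv (NonassocHilb.mk ψ) =
      GrassmannBundle.ofFrame ⟨toFrame e ψ.1, h.toFrame_mem ψ.2⟩ := rfl

theorem grassmannEquiv_symm_ofFrame (h : IsFlagStep k F' F'' e)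
    (x : grassmannFrames E F'' (k + 1) d) :
    h.grassmannEquiv.symm (GrassmannBundle.ofFrame x) =
      NonassocHilb.mk ⟨ofFrameLin e x.1, h.ofFrameLin_mem x.2⟩ := by
  rw [Equiv.symm_apply_eq, grassmannEquiv_mk]
  simp only [toFrame_ofFrameLin]

theorem isIso_grassmannEquiv (h : IsFlagStep k F' F'' e) :
    (NonassocHilb.variety E F').IsIso (GrassmannBundle.variety E F'' (k + 1) d)
      h.grassmannEquiv := by
  refine ⟨SpaceWithFunctions.isMorphism_quotient_iff.mpr ?_,
    SpaceWithFunctions.isMorphism_quotient_iff.mpr ?_⟩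
  · exact (SpaceWithFunctions.isMorphism_quotient _ GrassmannBundle.ofFrame).comp
      (isMorphism_of_linearMap (V := StructureMaps E N')
        (W := StructureMaps E N'' × ((Fin d → ℂ) →ₗ[ℂ] (E × LinearMap.BilinForm ℂ N'')))
        (toFrame e) fun _ => h.toFrame_mem)
  · rw [show h.grassmannEquiv.symm ∘ GrassmannBundle.ofFrame = NonassocHilb.mk ∘ _ from
      funext h.grassmannEquiv_symm_ofFrame]
    exact (SpaceWithFunctions.isMorphism_quotient _ NonassocHilb.mk).comp
      (isMorphism_of_linearMap
        (V := StructureMaps E N'' × ((Fin d → ℂ) →ₗ[ℂ] (E × LinearMap.BilinForm ℂ N'')))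
        (W := StructureMaps E N') (ofFrameLin e) fun _ => h.ofFrameLin_mem)

/-- The class of a structure map goes to the class of the induced structure map together with the
image of the dual of the structure map. -/
theorem exists_pair (h : IsFlagStep k F' F'' e) (ψ : filteredMaps E F') :
    ∃ p : GrassmannPairs E F'' (k + 1) d, Induces (splitProj e) ψ.1 p.1.1.1 ∧
      p.1.2.map (pullExt E (splitProj e)) = LinearMap.range (dualMaps ψ.1) ∧
      h.grassmannEquiv (NonassocHilb.mk ψ) = Quot.mk _ p := by
  have hfac := h.factorsThrough (mem_filteredMaps_iff.mp ψ.2).1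
  obtain ⟨h1, h2⟩ := isHom_iff.mp hfac.isHom
  refine ⟨framePair ⟨toFrame e ψ.1, h.toFrame_mem ψ.2⟩, ⟨(LinearMap.ext h1).symm,
    fun x y => (h2 x y).symm⟩, ?_, rfl⟩
  change (LinearMap.range (toFrame e ψ.1).2 ⊔ LinearMap.range (dualMaps (toFrame e ψ.1).1)).map _ =
    _
  rw [hfac.range_dualToBase, ← LinearMap.range_comp]
  exact congrArg LinearMap.range (LinearMap.ext hfac.pullExt_dualToBase)

end IsFlagStep

end GrassmannStep

/-! ### The tower of quotients -/

section Transfer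

variable {E N M : Type*} [AddCommGroup E] [Module ℂ E] [AddCommGroup N] [Module ℂ N]
  [AddCommGroup M] [Module ℂ M]

theorem isHom_transferLin (u : N ≃ₗ[ℂ] M) (ψ : StructureMaps E N) :
    IsHom (u : N →ₗ[ℂ] M) ψ (transferLin u ψ) :=
  isHom_iff.mpr ⟨fun _ => rfl, fun x y => by simp [transferLin]⟩

theorem transferLin_symm_apply (u : N ≃ₗ[ℂ] M) (ψ : StructureMaps E N) :
    transferLin u.symm (transferLin u ψ) = ψ :=
  Prod.ext (by ext; simp [transferLin]) (by ext; simp [transferLin])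

variable {F : ℕ → Submodule ℂ N} {G : ℕ → Submodule ℂ M}

theorem transferLin_mem {u : N ≃ₗ[ℂ] M} (hu : ∀ i x, x ∈ F i ↔ u x ∈ G i)
    {ψ : StructureMaps E N} (hψ : ψ ∈ filteredMaps E F) : transferLin u ψ ∈ filteredMaps E G := by
  rw [mem_filteredMaps_iff] at hψ ⊢
  refine ⟨⟨fun x y => congrArg u (hψ.1.1 _ _), fun i j hi hj x hx y hy => ?_⟩, ?_⟩
  · exact (hu _ _).mp (hψ.1.2 i j hi hj _ ((hu _ _).mpr (by simpa using hx)) _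
      ((hu _ _).mpr (by simpa using hy)))
  · have h1 : Function.Surjective ((u : N →ₗ[ℂ] M) ∘ₗ totalMap ψ) := u.surjective.comp hψ.2
    rw [isHom_transferLin u ψ] at h1
    exact Function.Surjective.of_comp h1

theorem mk_transferLin_eq [FiniteDimensional ℂ M] {r : ℕ} (hG : IsFlagFiltration r G)
    {u : N ≃ₗ[ℂ] M} (hu : ∀ i x, x ∈ F i ↔ u x ∈ G i) {ψ ψ' : filteredMaps E F}
    (h : NonassocHilb.mk ψ = NonassocHilb.mk ψ') :
    (NonassocHilb.mk ⟨transferLin u ψ.1, transferLin_mem hu ψ.2⟩ : NonassocHilb E G) =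
      NonassocHilb.mk ⟨transferLin u ψ'.1, transferLin_mem hu ψ'.2⟩ := by
  obtain ⟨g, hgF, hg⟩ := mk_eq_mk_iff.mp h
  have h1 := isHom_transferLin u.symm (transferLin u ψ.1)
  rw [transferLin_symm_apply] at h1
  refine mk_eq_mk_of_isHom hG ((isHom_transferLin u ψ'.1).comp (hg.comp h1)) fun i x hx => ?_
  exact (hu _ _).mp (flagGL_apply_mem hgF ((hu _ _).mpr (by simpa using hx)))

/-- A linear equivalence that matches two filtrations identifies the orbit spaces. -/
def transferEquiv [FiniteDimensional ℂ N] [FiniteDimensional ℂ M] {r : ℕ}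
    (hF : IsFlagFiltration r F) (hG : IsFlagFiltration r G)
    (u : N ≃ₗ[ℂ] M) (hu : ∀ i x, x ∈ F i ↔ u x ∈ G i)
    (hu' : ∀ i x, x ∈ G i ↔ u.symm x ∈ F i) : NonassocHilb E F ≃ NonassocHilb E G where
  toFun := Quotient.lift
    (fun ψ => NonassocHilb.mk ⟨transferLin u ψ.1, transferLin_mem hu ψ.2⟩)
    fun _ _ h => mk_transferLin_eq hG hu (Quotient.sound h)
  invFun := Quotient.lift
    (fun ψ => NonassocHilb.mk ⟨transferLin u.symm ψ.1, transferLin_mem hu' ψ.2⟩)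
    fun _ _ h => mk_transferLin_eq hF hu' (Quotient.sound h)
  left_inv y := by
    obtain ⟨ψ, rfl⟩ := mk_surjective y
    exact congrArg NonassocHilb.mk (Subtype.ext (transferLin_symm_apply u ψ.1))
  right_inv y := by
    obtain ⟨ψ, rfl⟩ := mk_surjective y
    exact congrArg NonassocHilb.mk (Subtype.ext (transferLin_symm_apply u.symm ψ.1))

theorem isIso_transferEquiv [FiniteDimensional ℂ N] [FiniteDimensional ℂ M] {r : ℕ}
    (hF : IsFlagFiltration r F) (hG : IsFlagFiltration r G)
    (u : N ≃ₗ[ℂ] M) (hu : ∀ i x, x ∈ F i ↔ u x ∈ G i)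
    (hu' : ∀ i x, x ∈ G i ↔ u.symm x ∈ F i) :
    (NonassocHilb.variety E F).IsIso (NonassocHilb.variety E G)
      (transferEquiv hF hG u hu hu') :=
  ⟨SpaceWithFunctions.isMorphism_quotient_iff.mpr
    ((SpaceWithFunctions.isMorphism_quotient _ NonassocHilb.mk).comp
      (isMorphism_of_linearMap (V := StructureMaps E N) (W := StructureMaps E M) (transferLin u)
        fun _ => transferLin_mem hu)),
   SpaceWithFunctions.isMorphism_quotient_iff.mpr
    ((SpaceWithFunctions.isMorphism_quotient _ NonassocHilb.mk).comp
      (isMorphism_of_linearMap (V := StructureMaps E M) (W := StructureMaps E N)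
        (transferLin u.symm) fun _ => transferLin_mem hu'))⟩

end Transfer

section Tower

variable {E N : Type*} [AddCommGroup E] [Module ℂ E] [AddCommGroup N] [Module ℂ N]
  {F : ℕ → Submodule ℂ N} {r : ℕ} {d : ℕ → ℕ}

theorem IsFlag.isFlagFiltration (hF : IsFlag r d F) : IsFlagFiltration r F :=
  ⟨hF.antitone, hF.one, hF.last⟩

theorem IsFlagFiltration.quotFlag (hF : IsFlagFiltration r F) (k : ℕ) :
    IsFlagFiltration k (quotFlag F (k + 1)) where
  antitone _ _ hij := Submodule.map_mono (hF.antitone hij)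
  one := by
    rw [_root_.quotFlag, hF.one, Submodule.map_top, Submodule.range_mkQ]
  last := Submodule.mkQ_map_self _

theorem IsFlag.finrank_quotient_succ [FiniteDimensional ℂ N] (hF : IsFlag r d F) {k : ℕ}
    (hk : k < r) :
    finrank ℂ (N ⧸ F (k + 2)) = finrank ℂ (N ⧸ F (k + 1)) + d (k + 1) := by
  have h1 := hF.finrank_step (k + 1) (by omega) hk
  have h2 := ((F (k + 1 + 1)).submoduleOf (F (k + 1))).finrank_quotient_add_finrank
  have h3 := (F (k + 1 + 1)).finrank_quotient_add_finrank
  have h4 := (F (k + 1)).finrank_quotient_add_finrank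
  rw [h1, (Submodule.submoduleOfEquivOfLe (hF.antitone (Nat.le_succ (k + 1)))).finrank_eq] at h2
  simp only [Nat.succ_eq_add_one] at h2
  change finrank ℂ (N ⧸ F (k + 1 + 1)) = _
  omega

theorem IsFlagFiltration.exists_isFlagStep [FiniteDimensional ℂ N] (hF : IsFlagFiltration r F)
    {k m : ℕ} (hm : finrank ℂ (N ⧸ F (k + 2)) = finrank ℂ (N ⧸ F (k + 1)) + m) :
    ∃ e : (N ⧸ F (k + 2)) ≃ₗ[ℂ] (N ⧸ F (k + 1)) × (Fin m → ℂ),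
      splitProj e = Submodule.factor (hF.antitone (Nat.le_succ (k + 1))) ∧
        IsFlagStep k (_root_.quotFlag F (k + 2)) (_root_.quotFlag F (k + 1)) e := by
  obtain ⟨e, he⟩ := exists_splitting
    (Submodule.factor_surjective (hF.antitone (Nat.le_succ (k + 1)))) hm
  have he' : splitProj e = Submodule.factor (hF.antitone (Nat.le_succ (k + 1))) :=
    LinearMap.ext he
  refine ⟨e, he', hF.quotFlag (k + 1), hF.quotFlag k, fun i => ?_, fun x hx => ?_⟩
  · rw [he', _root_.quotFlag, ← Submodule.map_comp]
    congr 1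
  · obtain ⟨x, rfl⟩ := (F (k + 2)).mkQ_surjective x
    rw [he'] at hx
    exact Submodule.mem_map_of_mem ((Submodule.Quotient.mk_eq_zero _).mp hx)

theorem card_nonassocHilb_of_subsingleton [Subsingleton N] :
    Nat.card (NonassocHilb E F) = 1 := by
  have h0 : (0 : StructureMaps E N) ∈ filteredMaps E F :=
    mem_filteredMaps_iff.mpr ⟨zero_mem _, fun y => ⟨0, Subsingleton.elim _ _⟩⟩
  rw [Nat.card_eq_one_iff_unique]
  refine ⟨⟨fun y z => ?_⟩, ⟨NonassocHilb.mk ⟨0, h0⟩⟩⟩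
  obtain ⟨ψ, rfl⟩ := mk_surjective y
  obtain ⟨φ, rfl⟩ := mk_surjective z
  refine congrArg NonassocHilb.mk (Subtype.ext (Prod.ext ?_ ?_))
  · exact LinearMap.ext fun _ => Subsingleton.elim _ _
  · exact LinearMap.ext₂ fun _ _ => Subsingleton.elim _ _

end Tower

end
theorem mainTheorem5 {E N : Type*} [AddCommGroup E] [Module ℂ E] [FiniteDimensional ℂ E]
    [AddCommGroup N] [Module ℂ N] [FiniteDimensional ℂ N]
    (r : ℕ) (d : ℕ → ℕ) (F : ℕ → Submodule ℂ N) (hF : IsFlag r d F) :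
    -- the action is free
    (∀ ψ : filteredMaps E F, MulAction.stabilizer (flagGL F) ψ = ⊥) ∧
    -- the orbit space is a smooth variety, compact and Hausdorff in the classical topology
    (NonassocHilb.variety E F).IsSmoothVariety ∧
    @CompactSpace _ (NonassocHilb.classical E F) ∧
    @T2Space _ (NonassocHilb.classical E F) ∧
    -- the bottom of the tower is a point
    Nat.card (NonassocHilb E (quotFlag F 1)) = 1 ∧
    -- each stage is the Grassmann bundle over the previous one
    (∀ k < r,
      IsLocallyTrivialQuotient E (quotFlag F (k + 1)) (k + 1) ∧
      ∃ Φ : NonassocHilb E (quotFlag F (k + 2)) ≃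
          GrassmannBundle E (quotFlag F (k + 1)) (k + 1) (d (k + 1)),
        (NonassocHilb.variety E (quotFlag F (k + 2))).IsIso
          (GrassmannBundle.variety E (quotFlag F (k + 1)) (k + 1) (d (k + 1))) Φ ∧
        ∀ ψ : filteredMaps E (quotFlag F (k + 2)),
          ∃ p : GrassmannPairs E (quotFlag F (k + 1)) (k + 1) (d (k + 1)),
            Induces (Submodule.factor (hF.antitone (Nat.le_succ (k + 1)))) ψ.1 p.1.1.1 ∧
            p.1.2.map (pullExt E (Submodule.factor (hF.antitone (Nat.le_succ (k + 1))))) =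
              LinearMap.range (dualMaps ψ.1) ∧
            Φ (NonassocHilb.mk ψ) = Quot.mk _ p) ∧
    -- the top of the tower is the orbit space itself
    (∃ Θ : NonassocHilb E F ≃ NonassocHilb E (quotFlag F (r + 1)),
      (NonassocHilb.variety E F).IsIso (NonassocHilb.variety E (quotFlag F (r + 1))) Θ ∧
      ∀ ψ : filteredMaps E F, ∃ ψ' : filteredMaps E (quotFlag F (r + 1)),
        Induces (F (r + 1)).mkQ ψ.1 ψ'.1 ∧ Θ (NonassocHilb.mk ψ) = NonassocHilb.mk ψ') := by
  have hF' := hF.isFlagFiltration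
  refine ⟨stabilizer_eq_bot hF', isSmoothVariety_nonassocHilb hF', compactSpace_nonassocHilb hF',
    t2Space_nonassocHilb hF', ?_, fun k hk => ⟨isLocallyTrivialQuotient (hF'.quotFlag k)
      (Nat.le_succ k), ?_⟩, ?_⟩
  · have : Subsingleton (N ⧸ F 1) := by
      exact Submodule.Quotient.subsingleton_iff.mpr hF.one
    exact card_nonassocHilb_of_subsingleton
  · obtain ⟨e, he, hstep⟩ := hF'.exists_isFlagStep (hF.finrank_quotient_succ hk)
    rw [← he]
    exact ⟨hstep.grassmannEquiv, hstep.isIso_grassmannEquiv, hstep.exists_pair⟩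
  · have hinj : Function.Injective (F (r + 1)).mkQ := by
      rw [← LinearMap.ker_eq_bot, Submodule.ker_mkQ, hF.last]
    let u : N ≃ₗ[ℂ] N ⧸ F (r + 1) :=
      LinearEquiv.ofBijective (F (r + 1)).mkQ ⟨hinj, (F (r + 1)).mkQ_surjective⟩
    have hu : ∀ i x, x ∈ F i ↔ u x ∈ quotFlag F (r + 1) i := fun i x =>
      (hinj.mem_set_image (s := F i)).symm
    have hu' : ∀ i x, x ∈ quotFlag F (r + 1) i ↔ u.symm x ∈ F i := fun i x => by
      rw [hu, u.apply_symm_apply]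
    refine ⟨transferEquiv hF' (hF'.quotFlag r) u hu hu', isIso_transferEquiv _ _ _ _ _,
      fun ψ => ⟨⟨transferLin u ψ.1, transferLin_mem hu ψ.2⟩, ⟨rfl, fun x y => ?_⟩, rfl⟩⟩
    exact ((isHom_iff.mp (isHom_transferLin u ψ.1)).2 x y).symm
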